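/- Let $G$ be a finite group. **Gerbes.** A finite $G$-equivariant gerbe $\mathcal X$ with metric is a $U(1)$-central extension of the action groupoid $X_G$ of a finite $G$-set $X$ (a groupoid with object set $X$; over each arrow $g\colon x\to g\cdot x$ of $X_G$ there is a $U(1)$-torsor of arrows $\mathcal X_{x,g}$, compatibly with composition), together with a $G$-invariant function $x\mapsto k_x>0$ on $X$. Write $\overline{\mathcal X}$ for the conjugate extension and $\mathcal Y\otimes\overline{\mathcal X}$ for the extension of $(Y\times X)_G$ with arrows $v\otimes\bar u$, where $zv\otimes\bar u=v\otimes\overline{z^{-1}u}$ for $z\in U(1)$. A unitary equivariant vector bundle over a gerbe is a functor $E$ to finite-dimensional Hilbert spaces with all $E(u)$ unitary and $E(zu)=zE(u)$ for $z\in U(1)$; morphisms of bundles are arbitrary natural transformations. A morphism $E\colon\mathcal X\to\mathcal Y$ of gerbes is a unitary equivariant vector bundle over $\mathcal Y\otimes\overline{\mathcal X}$; its fibre at $(y,x)$ is denoted $\langle y|E|x\rangle$. Composition is $\langle z|F\circ E|x\rangle=\bigoplus_{y}\frac1{k_y}\langle z|F|y\rangle\otimes\langle y|E|x\rangle$ (inner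 products on summands scaled by the prefix), $w\otimes\bar u$ acting by $F(w\otimes\bar v)\otimes E(v\otimes\bar u)$; the identity is $\langle y|\mathrm{id}|x\rangle=\delta_{xy}k_x\mathbb C$, on which $zu\otimes\bar u$ acts by $z$. Let $[\mathrm{Gerbes}(G)]$ be the category of finite $G$-equivariant gerbes with metrics and isomorphism classes of morphisms, and $[\mathrm{Gerbes}(G)]_{\mathbb C}$ the category with the same objects whose hom-sets are the complexified Grothendieck groups of the categories of bundles over $\mathcal Y\otimes\overline{\mathcal X}$ (generators $[E]$, relations $[E\oplus E']=[E]+[E']$, tensored with $\mathbb C$), with the inner product given by the sesquilinear extension of $\langle[E],[E']\rangle=\dim\mathrm{Hom}(E,E')$. **Geometric character.** For a groupoid $\mathcal G$, let $|a\to|$ be the number of arrows out of $a$. Let $\Lambda BG$ be the groupoid with objects $g\in G$ and arrows $h\colon g\to hgh^{-1}$, and $\Lambda X_G$ the groupoid with objects the pairs $(x,g)$ with $g\cdot x=x$ and arrows $h\colon(x,g)\to(h\cdot x,hgh^{-1})$. Let $\mathrm{Hilb}_G(G)$ be the category of functors from $\Lambda BG$ to finite-dimensional Hilbert spaces sending all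 arrows to unitary maps, with natural transformations as morphisms and the inner products $\langle f,f'\rangle=\sum_{g\in G}\mathrm{Tr}(f_g^*f'_g)/|g\to|$ on hom-sets. The transgressed line bundle $\tau(\mathcal X)_{\mathbb C}$ over $\Lambda X_G$ has as fibre at $(x,g)$ the hermitian line $\mathcal X_{x,g}\times_{U(1)}\mathbb C$, with elements $u\otimes\lambda$ such that $zu\otimes\lambda=u\otimes z\lambda$ and $\langle u\otimes\lambda,u\otimes\lambda'\rangle=\bar\lambda\lambda'$, and $h$ acts by $u\otimes\lambda\mapsto vuv^{-1}\otimes\lambda$ for any $v\in\mathcal X_{x,h}$. The space $\Gamma(\tau(\mathcal X)_{\mathbb C})$ of its flat sections has the inner product $\sum_{(x,g)}\langle s(x,g),s'(x,g)\rangle/|(x,g)\to|$. Let $\mathrm{ch}(\mathcal X)\in\mathrm{Hilb}_G(G)$ be the bundle with fibre at $g$ the space of sections $\psi$ of $\tau(\mathcal X)_{\mathbb C}$ over the fixed points of $g$, with $\langle\psi,\psi'\rangle=\sum_{x}k_x\langle\psi(x,g),\psi'(x,g)\rangle$, and with the natural action of $G$. For $g\cdot x=x$ and $u\in\mathcal X_{x,g}$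 let $\psi_{x,u}\in\mathrm{ch}(\mathcal X)_g$ be the unit vector with value $u\otimes k_x^{-1/2}$ at $x$ and $0$ at all other points. **Theorem.** 1. For each morphism $E\colon\mathcal X\to\mathcal Y$ of finite $G$-equivariant gerbes with metrics there is exactly one morphism $\mathrm{ch}(E)\colon\mathrm{ch}(\mathcal X)\to\mathrm{ch}(\mathcal Y)$ in $\mathrm{Hilb}_G(G)$ with $$\langle\psi_{y,v},\mathrm{ch}(E)_g\,\psi_{x,u}\rangle=\overline{\mathrm{Tr}\,E(v\otimes\bar u)}$$ for all $g\in G$, all fixed points $x\in X$, $y\in Y$ of $g$ and all $u\in\mathcal X_{x,g}$, $v\in\mathcal Y_{y,g}$. It satisfies $\mathrm{ch}(\mathrm{id}_{\mathcal X})=\mathrm{id}$ and $\mathrm{ch}(F\circ E)=\mathrm{ch}(F)\circ\mathrm{ch}(E)$, and depends only on the isomorphism class of $E$. Hence $\mathrm{ch}$ descends to a functor $\mathrm{ch}\colon[\mathrm{Gerbes}(G)]\to\mathrm{Hilb}_G(G)$. 2. The $\mathbb C$-linear extension to hom-sets $\mathrm{ch}_{\mathbb C}\colon[\mathrm{Gerbes}(G)]_{\mathbb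 C}\to\mathrm{Hilb}_G(G)$, with $\mathrm{ch}_{\mathbb C}[E]=\mathrm{ch}(E)$, is a well-defined functor, and it is unitarily fully faithful: it is full and faithful and preserves the inner products on hom-sets. 3. On hom-sets $\mathrm{ch}_{\mathbb C}$ is a rearrangement of the twisted character isomorphism: $\mathrm{ch}_{\mathbb C}=\widehat{\ }\circ\chi$ on $\mathrm{Hom}(\mathcal X,\mathcal Y)$. Here $\chi$, the linear map from the complexified Grothendieck group of bundles over $\mathcal Y\otimes\overline{\mathcal X}$ to $\Gamma(\tau(\mathcal Y\otimes\overline{\mathcal X})_{\mathbb C})$ sending $[E]$ to the section whose value at each loop is $w\otimes\overline{\mathrm{Tr}\,E(w)}$, for any arrow $w$ over this loop, is a well-defined unitary isomorphism; and so is $\xi\mapsto\hat\xi$, from $\Gamma(\tau(\mathcal Y\otimes\overline{\mathcal X})_{\mathbb C})$ to $\mathrm{Hom}_{\mathrm{Hilb}_G(G)}(\mathrm{ch}(\mathcal X),\mathrm{ch}(\mathcal Y))$, where $\hat\xi$ is the unique morphism for which $\hat\xi_g\psi_{x,u}$ has value $v\otimes k_y^{-1/2}\lambda$ at each fixed point $y$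 of $g$, where $\xi((y,x),g)=v\otimes\bar u\otimes\lambda$. -/

import Mathlib

open CategoryTheory
open scoped TensorProduct ComplexConjugate

universe u v w

noncomputable section

namespace GerbeChar

/-! ### The category of finite-dimensional Hilbert spaces -/

/-- A finite-dimensional complex Hilbert space. -/
structure FinHilb : Type (u + 1) where
  carrier : Type u
  [group : NormedAddCommGroup carrier]
  [innerSpace : InnerProductSpace ℂ carrier]
  [finDim : FiniteDimensional ℂ carrier]

namespace FinHilb

instance : CoeSort FinHilb.{u} (Type u) := ⟨FinHilb.carrier⟩

instance (V : FinHilb.{u}) : NormedAddCommGroup V := V.group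
instance (V : FinHilb.{u}) : InnerProductSpace ℂ V := V.innerSpace
instance (V : FinHilb.{u}) : FiniteDimensional ℂ V := V.finDim

/-- Morphisms of `FinHilb`: arbitrary linear maps. -/
@[ext]
structure Hom (V W : FinHilb.{u}) : Type u where
  lin : V →ₗ[ℂ] W

instance : Category FinHilb.{u} where
  Hom := Hom
  id _ := ⟨LinearMap.id⟩
  comp f g := ⟨g.lin ∘ₗ f.lin⟩

/-- The linear map underlying a morphism of `FinHilb`. -/
abbrev lin {V W : FinHilb.{u}} (f : V ⟶ W) : V →ₗ[ℂ] W := Hom.lin f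

/-- The morphism of `FinHilb` given by a linear map. -/
abbrev ofLin {V W : FinHilb.{u}} (f : V →ₗ[ℂ] W) : V ⟶ W := Hom.mk f

@[ext] theorem hom_ext {V W : FinHilb.{u}} {f g : V ⟶ W} (h : lin f = lin g) : f = g :=
  Hom.ext h

@[simp] theorem lin_id (V : FinHilb.{u}) : lin (𝟙 V) = LinearMap.id := rfl
@[simp] theorem lin_comp {V W Z : FinHilb.{u}} (f : V ⟶ W) (g : W ⟶ Z) :
    lin (f ≫ g) = lin g ∘ₗ lin f := rfl

/-- Morphisms of `FinHilb` are the same as linear maps. -/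
def homEquiv (V W : FinHilb.{u}) : (V ⟶ W) ≃ (V →ₗ[ℂ] W) where
  toFun := lin
  invFun := ofLin
  left_inv _ := rfl
  right_inv _ := rfl

instance : Preadditive FinHilb.{u} where
  homGroup V W := (homEquiv V W).addCommGroup
  add_comp _ _ _ _ _ h := hom_ext (LinearMap.comp_add _ _ (lin h))
  comp_add _ _ _ f _ _ := hom_ext (LinearMap.add_comp (lin f) _ _)

@[simp] theorem lin_add {V W : FinHilb.{u}} (f g : V ⟶ W) : lin (f + g) = lin f + lin g := rfl
@[simp] theorem lin_zero {V W : FinHilb.{u}} : lin (0 : V ⟶ W) = 0 := rfl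

instance : Linear ℂ FinHilb.{u} where
  homModule V W := (homEquiv V W).module ℂ
  smul_comp _ _ _ r f g := hom_ext (LinearMap.comp_smul (lin g) r (lin f))
  comp_smul _ _ _ f r g := hom_ext (LinearMap.smul_comp r (lin g) (lin f))

@[simp] theorem lin_smul {V W : FinHilb.{u}} (c : ℂ) (f : V ⟶ W) : lin (c • f) = c • lin f := rfl

/-- A morphism of Hilbert spaces is unitary if it is an inner product preserving bijection. -/
structure IsUnitary {V W : FinHilb.{u}} (f : V ⟶ W) : Prop where
  inner_map : ∀ a b : V, inner ℂ (lin f a) (lin f b) = inner ℂ a b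
  bijective : Function.Bijective (lin f)

end FinHilb

/-! ### Weighted direct sums -/

/-- A positive real number. -/
abbrev PosReal : Type := {r : ℝ // 0 < r}

/-- The space of sections of a finite family `V` of Hilbert spaces, i.e. their (unordered) direct
sum, with the inner product `⟨φ, ψ⟩ = ∑ i, w i * ⟨φ i, ψ i⟩` weighted by positive reals `w i`. -/
def WSum {ι : Type v} (_ : ι → PosReal) (V : ι → Type w) : Type (max v w) := ∀ i, V i

namespace WSum

section

variable {ι : Type v} {wt : ι → PosReal} {V : ι → Type w}
  [∀ i, NormedAddCommGroup (V i)] [∀ i, InnerProductSpace ℂ (V i)]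

instance : AddCommGroup (WSum wt V) := inferInstanceAs (AddCommGroup (∀ i, V i))
instance : Module ℂ (WSum wt V) := inferInstanceAs (Module ℂ (∀ i, V i))

/-- Evaluation of a section at an index. -/
def proj (i : ι) : WSum wt V →ₗ[ℂ] V i := LinearMap.proj i

/-- The section which is `a` at `i` and zero elsewhere. -/
def single (i : ι) : V i →ₗ[ℂ] WSum wt V :=
  letI := Classical.decEq ι
  LinearMap.single ℂ V i

@[ext] theorem ext {a b : WSum wt V} (h : ∀ i, proj i a = proj i b) : a = b := funext h

@[simp] theorem proj_single_same (i : ι) (a : V i) :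
    proj i (single i a : WSum wt V) = a := by
  classical
  exact (congrArg (fun d => @Pi.single ι V _ d i a i) (Subsingleton.elim _ _)).trans
    (Pi.single_eq_same i a)

theorem proj_single_ne {i j : ι} (h : i ≠ j) (a : V i) :
    proj j (single i a : WSum wt V) = 0 := by
  classical
  exact (congrArg (fun d => @Pi.single ι V _ d i a j) (Subsingleton.elim _ _)).trans
    (Pi.single_eq_of_ne h.symm a)

theorem sum_single_proj [Fintype ι] (a : WSum wt V) : ∑ i, single i (proj i a) = a := by
  classical
  ext j
  rw [map_sum, Finset.sum_eq_single j (fun i _ h => proj_single_ne h _) (by simp)]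
  simp

instance instInner : Inner ℂ (WSum wt V) where
  inner a b := ∑ᶠ i, ((wt i : ℝ) : ℂ) * inner ℂ (proj i a) (proj i b)

theorem inner_def (a b : WSum wt V) :
    inner ℂ a b = ∑ᶠ i, ((wt i : ℝ) : ℂ) * inner ℂ (proj i a) (proj i b) := rfl

theorem inner_eq_sum [Fintype ι] (a b : WSum wt V) :
    inner ℂ a b = ∑ i, ((wt i : ℝ) : ℂ) * inner ℂ (proj i a) (proj i b) :=
  finsum_eq_sum_of_fintype _

/-- The weighted inner product is positive definite. -/
theorem core_aux [Fintype ι] (a : WSum wt V) :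
    (inner ℂ a a : ℂ) = ((∑ i, (wt i : ℝ) * ‖proj i a‖ ^ 2 : ℝ) : ℂ) := by
  rw [inner_eq_sum]
  push_cast
  refine Finset.sum_congr rfl fun i _ => ?_
  rw [inner_self_eq_norm_sq_to_K]
  rfl

variable [Finite ι]

instance instNormedAddCommGroup : NormedAddCommGroup (WSum wt V) :=
  letI := Fintype.ofFinite ι
  letI : InnerProductSpace.Core ℂ (WSum wt V) :=
    { conj_inner_symm := fun a b => by
        simp [inner_eq_sum, map_sum]
      add_left := fun a b c => by
        simp [inner_eq_sum, mul_add, Finset.sum_add_distrib]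
      smul_left := fun a b c => by
        simp only [inner_eq_sum, map_smul, inner_smul_left, Finset.mul_sum]
        exact Finset.sum_congr rfl fun i _ => by ring
      definite := fun a h => by
        rw [core_aux, Complex.ofReal_eq_zero, Finset.sum_eq_zero_iff_of_nonneg
          fun i _ => mul_nonneg (wt i).2.le (sq_nonneg _)] at h
        ext i
        have h1 := h i (Finset.mem_univ i)
        have h2 := (wt i).2.ne'
        simpa [h2] using h1
      re_inner_nonneg := fun a => by
        rw [core_aux]
        exact Finset.sum_nonneg fun i _ => mul_nonneg (wt i).2.le (sq_nonneg _) }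
  this.toNormedAddCommGroup

instance instInnerProductSpace : InnerProductSpace ℂ (WSum wt V) := .ofCore _

instance [∀ i, FiniteDimensional ℂ (V i)] : FiniteDimensional ℂ (WSum wt V) :=
  inferInstanceAs (FiniteDimensional ℂ (∀ i, V i))

/-- The linear map out of a direct sum with given components. -/
def lift {M : Type*} [AddCommGroup M] [Module ℂ M] (f : ∀ i, V i →ₗ[ℂ] M) : WSum wt V →ₗ[ℂ] M :=
  letI := Fintype.ofFinite ι
  ∑ i, f i ∘ₗ proj i

@[simp] theorem lift_single {M : Type*} [AddCommGroup M] [Module ℂ M] (f : ∀ i, V i →ₗ[ℂ] M)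
    (i : ι) (a : V i) : lift f (single i a : WSum wt V) = f i a := by
  let _ := Fintype.ofFinite ι
  simp only [lift, LinearMap.sum_apply, LinearMap.comp_apply]
  rw [Finset.sum_eq_single i (fun j _ h => by rw [proj_single_ne h.symm, map_zero]) (by simp)]
  simp

@[ext] theorem hom_ext {M : Type*} [AddCommGroup M] [Module ℂ M] {f g : WSum wt V →ₗ[ℂ] M}
    (h : ∀ i, f ∘ₗ single i = g ∘ₗ single i) : f = g := by
  let _ := Fintype.ofFinite ι
  refine LinearMap.ext fun a => ?_
  rw [← sum_single_proj a, map_sum, map_sum]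
  exact Finset.sum_congr rfl fun i _ => LinearMap.congr_fun (h i) _

@[simp] theorem lift_comp_single {M : Type*} [AddCommGroup M] [Module ℂ M]
    (f : ∀ i, V i →ₗ[ℂ] M) (i : ι) : lift f ∘ₗ (single i : V i →ₗ[ℂ] WSum wt V) = f i :=
  LinearMap.ext fun a => lift_single f i a

end

end WSum

namespace FinHilb

/-- The weighted direct sum of a finite family of Hilbert spaces. -/
abbrev wsum {ι : Type u} [Finite ι] (wt : ι → PosReal) (V : ι → FinHilb.{w}) :
    FinHilb.{max u w} :=
  ⟨WSum wt fun i => V i⟩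

/-- The tensor product of Hilbert spaces. -/
abbrev tensor (V : FinHilb.{u}) (W : FinHilb.{u}) : FinHilb.{u} := ⟨V ⊗[ℂ] W⟩

end FinHilb

/-! ### `U(1)`-torsors and their hermitian lines -/

/-- A `U(1)`-torsor: a nonempty set with a free and transitive action of `U(1)`. -/
class CircleTorsor (P : Type u) extends MulAction Circle P where
  nonempty : Nonempty P
  existsUnique : ∀ p q : P, ∃! z : Circle, z • p = q

namespace CircleTorsor

variable {P : Type u} [CircleTorsor P]

/-- The ratio `q / p` of two elements of a torsor: the unique `z` with `z • p = q`. -/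
def ratio (q p : P) : Circle := (existsUnique p q).choose

theorem ratio_smul (q p : P) : ratio q p • p = q := (existsUnique p q).choose_spec.1

theorem ratio_eq {q p : P} {z : Circle} (h : z • p = q) : ratio q p = z :=
  (existsUnique p q).unique (ratio_smul q p) h

@[simp] theorem ratio_self (p : P) : ratio p p = 1 := ratio_eq (one_smul _ p)

theorem ratio_mul_ratio (r q p : P) : ratio r q * ratio q p = ratio r p :=
  (ratio_eq (by rw [mul_smul, ratio_smul, ratio_smul])).symm

theorem ratio_smul_left (z : Circle) (q p : P) : ratio (z • q) p = z * ratio q p :=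
  ratio_eq (by rw [mul_smul, ratio_smul])

theorem ratio_smul_right (z : Circle) (q p : P) : ratio q (z • p) = z⁻¹ * ratio q p := by
  refine ratio_eq ?_
  rw [mul_comm, mul_smul, inv_smul_smul, ratio_smul]

/-- The identifications `(z • p, a) ∼ (p, z * a)` on `P × ℂ`. -/
def lineSetoid (P : Type u) [CircleTorsor P] : Setoid (P × ℂ) where
  r s t := ∃ z : Circle, s.1 = z • t.1 ∧ t.2 = (z : ℂ) * s.2
  iseqv :=
    { refl := fun s => ⟨1, by simp⟩
      symm := by
        rintro s t ⟨z, h1, h2⟩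
        exact ⟨z⁻¹, by rw [h1, inv_smul_smul], by rw [h2]; simp⟩
      trans := by
        rintro s t r ⟨z, h1, h2⟩ ⟨z', h3, h4⟩
        exact ⟨z * z', by rw [h1, h3, mul_smul], by rw [h4, h2, Circle.coe_mul]; ring⟩ }

end CircleTorsor

open CircleTorsor

/-- The hermitian line `P ×_{U(1)} ℂ` associated to a `U(1)`-torsor `P`. -/
def TorsorLine (P : Type u) [CircleTorsor P] : Type u := Quotient (lineSetoid P)

namespace TorsorLine

variable {P : Type u} [CircleTorsor P]

/-- The element `p ⊗ a` of the line associated to a torsor. -/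
def tmul (p : P) (a : ℂ) : TorsorLine P := Quotient.mk (lineSetoid P) (p, a)

theorem smul_tmul (z : Circle) (p : P) (a : ℂ) : tmul (z • p) a = tmul p ((z : ℂ) * a) :=
  Quotient.sound (s := lineSetoid P) ⟨z, rfl, rfl⟩

/-- The coordinate with respect to `p`: the element `p ⊗ a` has coordinate `a`. -/
def coordFun (p : P) : TorsorLine P → ℂ :=
  Quotient.lift (fun s => ((ratio s.1 p : Circle) : ℂ) * s.2) (by
    rintro s t ⟨z, h1, h2⟩
    simp only [h1, h2, ratio_smul_left, Circle.coe_mul]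
    ring)

theorem coordFun_tmul (p q : P) (a : ℂ) : coordFun p (tmul q a) = (ratio q p : ℂ) * a := rfl

theorem tmul_coordFun (p : P) (x : TorsorLine P) : tmul p (coordFun p x) = x := by
  obtain ⟨⟨q, a⟩, rfl⟩ := Quotient.exists_rep x
  change tmul p (coordFun p (tmul q a)) = tmul q a
  rw [coordFun_tmul, ← smul_tmul, ratio_smul]

theorem coordFun_eq (p q : P) (x : TorsorLine P) :
    coordFun p x = (ratio q p : ℂ) * coordFun q x := by
  conv_lhs => rw [← tmul_coordFun q x, coordFun_tmul]

/-- The bijection with `ℂ` given by an element of the torsor. -/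
def coordEquiv (p : P) : TorsorLine P ≃ ℂ where
  toFun := coordFun p
  invFun := tmul p
  left_inv := tmul_coordFun p
  right_inv a := by rw [coordFun_tmul]; simp

/-- A reference element of the torsor; all structures below are independent of it. -/
def base (P : Type u) [CircleTorsor P] : P := Classical.choice CircleTorsor.nonempty

instance : AddCommGroup (TorsorLine P) := (coordEquiv (base P)).addCommGroup
instance : Module ℂ (TorsorLine P) := (coordEquiv (base P)).module ℂ

/-- The coordinate with respect to `p` as a linear isomorphism. -/
def coord (p : P) : TorsorLine P ≃ₗ[ℂ] ℂ :=
  { coordEquiv p with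
    map_add' := fun x y => by
      have h : coordFun (base P) (x + y) = coordFun (base P) x + coordFun (base P) y :=
        (coordEquiv (base P)).apply_symm_apply _
      change coordFun p (x + y) = coordFun p x + coordFun p y
      rw [coordFun_eq p (base P) (x + y), coordFun_eq p (base P) x, coordFun_eq p (base P) y, h,
        mul_add]
    map_smul' := fun c x => by
      have h : coordFun (base P) (c • x) = c * coordFun (base P) x :=
        (coordEquiv (base P)).apply_symm_apply _
      change coordFun p (c • x) = c * coordFun p x
      rw [coordFun_eq p (base P) (c • x), coordFun_eq p (base P) x, h]
      ring }

theorem coord_tmul (p q : P) (a : ℂ) : coord p (tmul q a) = (ratio q p : ℂ) * a := rfl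
@[simp] theorem coord_tmul_self (p : P) (a : ℂ) : coord p (tmul p a) = a := by
  rw [coord_tmul]; simp
@[simp] theorem coord_symm (p : P) (a : ℂ) : (coord p).symm a = tmul p a := rfl
@[simp] theorem tmul_coord (p : P) (x : TorsorLine P) : tmul p (coord p x) = x :=
  tmul_coordFun p x
theorem coord_eq (p q : P) (x : TorsorLine P) : coord p x = (ratio q p : ℂ) * coord q x :=
  coordFun_eq p q x

/-- The inner product `⟨p ⊗ a, q ⊗ b⟩ = (q / p) * conj a * b`. -/
instance : Inner ℂ (TorsorLine P) where
  inner x y := conj (coord (base P) x) * coord (base P) y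

theorem inner_eq (p : P) (x y : TorsorLine P) : inner ℂ x y = conj (coord p x) * coord p y := by
  change conj (coord (base P) x) * coord (base P) y = _
  have h : conj (ratio p (base P) : ℂ) * (ratio p (base P) : ℂ) = 1 := by
    rw [← Circle.coe_inv_eq_conj, ← Circle.coe_mul]
    simp
  rw [coord_eq (base P) p x, coord_eq (base P) p y, map_mul]
  linear_combination (conj (coord p x) * coord p y) * h

theorem inner_tmul (p q : P) (a b : ℂ) :
    inner ℂ (tmul p a) (tmul q b) = (ratio q p : ℂ) * conj a * b := by
  rw [inner_eq p, coord_tmul, coord_tmul]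
  simp
  ring

instance : NormedAddCommGroup (TorsorLine P) :=
  letI : InnerProductSpace.Core ℂ (TorsorLine P) :=
    { conj_inner_symm := fun x y => by simp [inner_eq (base P), mul_comm]
      add_left := fun x y z => by simp [inner_eq (base P), add_mul]
      smul_left := fun x y r => by simp [inner_eq (base P), mul_assoc]
      definite := fun x h => by simpa [inner_eq (base P)] using h
      re_inner_nonneg := fun x => by
        rw [inner_eq (base P), mul_comm, Complex.mul_conj]
        exact Complex.normSq_nonneg _ }
  this.toNormedAddCommGroup

instance : InnerProductSpace ℂ (TorsorLine P) := .ofCore _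

instance : FiniteDimensional ℂ (TorsorLine P) := (coord (base P)).symm.finiteDimensional

/-- The linear map of lines induced by an equivariant map of torsors, `p ⊗ a ↦ f p ⊗ a`. -/
def map {Q : Type u} [CircleTorsor Q] (f : P → Q) : TorsorLine P →ₗ[ℂ] TorsorLine Q :=
  (coord (f (base P))).symm.toLinearMap ∘ₗ (coord (base P)).toLinearMap

theorem map_tmul {Q : Type u} [CircleTorsor Q] (f : P → Q)
    (hf : ∀ (z : Circle) p, f (z • p) = z • f p) (p : P) (a : ℂ) :
    map f (tmul p a) = tmul (f p) a := by
  change tmul (f (base P)) (coord (base P) (tmul p a)) = _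
  rw [coord_tmul, ← smul_tmul, ← hf, ratio_smul]

end TorsorLine

/-! ### Equivariant gerbes -/

/-- A discrete `G`-equivariant gerbe: a `U(1)`-central extension of the action groupoid of a
`G`-set `pt`. The groupoid has the points of the `G`-set as objects; `deg` is the projection to the
action groupoid (an arrow `f : x ⟶ y` lies over the arrow `deg f` from `x` to `deg f • x = y`),
which is full; and `u1` identifies `U(1)` with the arrows lying over identities, centrally. -/
structure EqGerbe (G : Type v) [Group G] : Type (max v (u + 1)) where
  pt : Type u
  [act : MulAction G pt]
  [groupoid : SmallGroupoid pt]
  deg : ∀ {x y : pt}, (x ⟶ y) → G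
  deg_smul : ∀ {x y : pt} (f : x ⟶ y), deg f • x = y
  deg_id : ∀ x : pt, deg (𝟙 x) = 1
  deg_comp : ∀ {x y z : pt} (f : x ⟶ y) (f' : y ⟶ z), deg (f ≫ f') = deg f' * deg f
  exists_deg : ∀ (g : G) (x : pt), ∃ f : x ⟶ g • x, deg f = g
  u1 : ∀ x : pt, Circle → (x ⟶ x)
  u1_one : ∀ x, u1 x 1 = 𝟙 x
  u1_mul : ∀ x z z', u1 x (z * z') = u1 x z ≫ u1 x z'
  u1_injective : ∀ x, Function.Injective (u1 x)
  deg_u1 : ∀ x z, deg (u1 x z) = 1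
  exists_u1 : ∀ {x : pt} (f : x ⟶ x), deg f = 1 → ∃ z, u1 x z = f
  u1_central : ∀ {x y : pt} (z : Circle) (f : x ⟶ y), u1 x z ≫ f = f ≫ u1 y z

namespace EqGerbe

variable {G : Type v} [Group G]

instance (X : EqGerbe.{u} G) : MulAction G X.pt := X.act
instance (X : EqGerbe.{u} G) : SmallGroupoid X.pt := X.groupoid

section

variable (X : EqGerbe.{u} G)

/-- The action of `U(1)` on the arrows of a gerbe. -/
def rot {x y : X.pt} (z : Circle) (f : x ⟶ y) : x ⟶ y := X.u1 x z ≫ f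

variable {X}

@[simp] theorem one_rot {x y : X.pt} (f : x ⟶ y) : X.rot 1 f = f := by
  simp [rot, u1_one]

theorem mul_rot {x y : X.pt} (z z' : Circle) (f : x ⟶ y) :
    X.rot (z * z') f = X.rot z (X.rot z' f) := by
  simp [rot, u1_mul]

theorem rot_comp {x y y' : X.pt} (z : Circle) (f : x ⟶ y) (f' : y ⟶ y') :
    X.rot z f ≫ f' = X.rot z (f ≫ f') := by
  simp [rot]

theorem comp_rot {x y y' : X.pt} (z : Circle) (f : x ⟶ y) (f' : y ⟶ y') :
    f ≫ X.rot z f' = X.rot z (f ≫ f') := by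
  simp only [rot]
  rw [← Category.assoc, ← u1_central, Category.assoc]

@[simp] theorem deg_rot {x y : X.pt} (z : Circle) (f : x ⟶ y) : X.deg (X.rot z f) = X.deg f := by
  simp [rot, deg_comp, deg_u1]

theorem deg_inv {x y : X.pt} (f : x ⟶ y) : X.deg (Groupoid.inv f) = (X.deg f)⁻¹ := by
  have h := X.deg_comp f (Groupoid.inv f)
  rw [Groupoid.comp_inv, deg_id] at h
  exact eq_inv_of_mul_eq_one_left h.symm

theorem rot_right_cancel {x y : X.pt} {z z' : Circle} {f : x ⟶ y}
    (h : X.rot z f = X.rot z' f) : z = z' :=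
  X.u1_injective x ((cancel_mono f).1 h)

/-- Two arrows lying over the same arrow of the action groupoid differ by an element of `U(1)`. -/
theorem exists_rot {x y : X.pt} (f f' : x ⟶ y) (h : X.deg f = X.deg f') :
    ∃ z, X.rot z f = f' := by
  obtain ⟨z, hz⟩ := X.exists_u1 (f' ≫ Groupoid.inv f) (by
    rw [deg_comp, deg_inv, h, inv_mul_cancel])
  exact ⟨z, by simp [rot, hz]⟩

theorem exists_arrow (X : EqGerbe.{u} G) (g : G) (x y : X.pt) (h : g • x = y) :
    ∃ f : x ⟶ y, X.deg f = g := by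
  subst h
  exact X.exists_deg g x

end

/-- The torsor of arrows of a gerbe lying over a given arrow `x ⟶ g • x = y`. -/
def Over (X : EqGerbe.{u} G) (g : G) (x y : X.pt) : Type u := {f : x ⟶ y // X.deg f = g}

/-- The torsor of arrows lying over a loop in the action groupoid, i.e. over a fixed point `x`
of `g`. -/
@[reducible] def loopTorsor (X : EqGerbe.{u} G) (g : G) (x : X.pt) (h : g • x = x) :
    CircleTorsor (X.Over g x x) where
  smul z f := ⟨X.rot z f.1, by rw [deg_rot, f.2]⟩
  one_smul f := Subtype.ext (one_rot f.1)
  mul_smul z z' f := Subtype.ext (mul_rot z z' f.1)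
  nonempty := by
    obtain ⟨f, hf⟩ := X.exists_arrow g x x h
    exact ⟨⟨f, hf⟩⟩
  existsUnique p q := by
    obtain ⟨z, hz⟩ := exists_rot p.1 q.1 (p.2.trans q.2.symm)
    exact ⟨z, Subtype.ext hz, fun z' hz' =>
      rot_right_cancel ((congrArg Subtype.val hz').trans hz.symm)⟩

/-- The conjugate gerbe: the same groupoid, with the conjugate `U(1)`-action on arrows. -/
@[reducible] def conjugate (X : EqGerbe.{u} G) : EqGerbe.{u} G where
  pt := X.pt
  deg := X.deg
  deg_smul := X.deg_smul
  deg_id := X.deg_id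
  deg_comp := X.deg_comp
  exists_deg := X.exists_deg
  u1 x z := X.u1 x z⁻¹
  u1_one x := by rw [inv_one, X.u1_one]
  u1_mul x z z' := by rw [mul_inv, X.u1_mul]
  u1_injective x z z' h := inv_injective (X.u1_injective x h)
  deg_u1 x z := X.deg_u1 x _
  exists_u1 f h := by
    obtain ⟨z, hz⟩ := X.exists_u1 f h
    exact ⟨z⁻¹, by rw [inv_inv, hz]⟩
  u1_central z f := X.u1_central _ f

section Tensor

variable (Y X : EqGerbe.{u} G)

/-- Pairs of arrows of the same degree. -/
def ArrowPair (p q : Y.pt × X.pt) : Type u :=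
  {s : (p.1 ⟶ q.1) × (p.2 ⟶ q.2) // Y.deg s.1 = X.deg s.2}

/-- The identifications `(z • v, u) ∼ (v, z • u)` defining the tensor product of torsors. -/
def pairSetoid (p q : Y.pt × X.pt) : Setoid (ArrowPair Y X p q) where
  r s t := ∃ z : Circle, s.1.1 = Y.rot z t.1.1 ∧ t.1.2 = X.rot z s.1.2
  iseqv :=
    { refl := fun s => ⟨1, by simp⟩
      symm := by
        rintro s t ⟨z, h1, h2⟩
        exact ⟨z⁻¹, by rw [h1, ← mul_rot]; simp, by rw [h2, ← mul_rot]; simp⟩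
      trans := by
        rintro s t r ⟨z, h1, h2⟩ ⟨z', h3, h4⟩
        exact ⟨z * z', by rw [h1, h3, mul_rot], by rw [h4, h2, mul_comm, mul_rot]⟩ }

/-- The objects of the tensor product of two gerbes: pairs of objects. -/
structure TensorPt : Type u where
  fst : Y.pt
  snd : X.pt

variable {Y X}

namespace TensorPt

/-- The underlying pair. -/
abbrev toProd (p : TensorPt Y X) : Y.pt × X.pt := (p.fst, p.snd)

@[ext] theorem ext' {p q : TensorPt Y X} (h : p.fst = q.fst) (h' : p.snd = q.snd) : p = q := by
  cases p; cases q; simp_all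

instance : MulAction G (TensorPt Y X) where
  smul g p := ⟨g • p.fst, g • p.snd⟩
  one_smul p := TensorPt.ext' (one_smul G p.fst) (one_smul G p.snd)
  mul_smul g h p := TensorPt.ext' (mul_smul g h p.fst) (mul_smul g h p.snd)

@[simp] theorem smul_fst (g : G) (p : TensorPt Y X) : (g • p).fst = g • p.fst := rfl
@[simp] theorem smul_snd (g : G) (p : TensorPt Y X) : (g • p).snd = g • p.snd := rfl

instance [Finite Y.pt] [Finite X.pt] : Finite (TensorPt Y X) :=
  Finite.of_injective (fun p => p.toProd) fun _ _ h =>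
    TensorPt.ext' (congrArg Prod.fst h) (congrArg Prod.snd h)

end TensorPt

/-- Arrows of the tensor product gerbe. -/
def TensorHom (p q : TensorPt Y X) : Type u := Quotient (pairSetoid Y X p.toProd q.toProd)

/-- The arrow `v ⊗ u` of the tensor product gerbe. -/
def homTmul {p q : TensorPt Y X} (v : p.fst ⟶ q.fst) (u : p.snd ⟶ q.snd)
    (h : Y.deg v = X.deg u) : TensorHom p q :=
  Quotient.mk (pairSetoid Y X p.toProd q.toProd) ⟨(v, u), h⟩

theorem tensorHom_ind {p q : TensorPt Y X} {motive : TensorHom p q → Prop}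
    (H : ∀ v u h, motive (homTmul v u h)) (f : TensorHom p q) : motive f := by
  obtain ⟨⟨⟨v, u⟩, h⟩, rfl⟩ := Quotient.exists_rep f
  exact H v u h

theorem homTmul_eq_iff {p q : TensorPt Y X} {v v' : p.fst ⟶ q.fst} {u u' : p.snd ⟶ q.snd}
    {h : Y.deg v = X.deg u} {h' : Y.deg v' = X.deg u'} :
    homTmul v u h = homTmul v' u' h' ↔ ∃ z, v = Y.rot z v' ∧ u' = X.rot z u :=
  ⟨fun e => Quotient.exact e,
    fun e => Quotient.sound (s := pairSetoid Y X p.toProd q.toProd) e⟩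

/-- Degree of an arrow of the tensor product gerbe. -/
def tensorDeg {p q : TensorPt Y X} : TensorHom p q → G :=
  Quotient.lift (fun s => Y.deg s.1.1) (by rintro s t ⟨z, h, -⟩; simp [h])

@[simp] theorem tensorDeg_homTmul {p q : TensorPt Y X} (v : p.fst ⟶ q.fst) (u : p.snd ⟶ q.snd)
    (h : Y.deg v = X.deg u) : tensorDeg (homTmul v u h) = Y.deg v := rfl

/-- Composition in the tensor product gerbe, `(v ⊗ u) ≫ (v' ⊗ u') = (v ≫ v') ⊗ (u ≫ u')`. -/
def tensorComp {p q r : TensorPt Y X} : TensorHom p q → TensorHom q r → TensorHom p r :=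
  Quotient.lift₂ (fun s t => homTmul (s.1.1 ≫ t.1.1) (s.1.2 ≫ t.1.2)
      (by rw [Y.deg_comp, X.deg_comp, s.2, t.2])) (by
    rintro ⟨⟨a, b⟩, h1⟩ ⟨⟨c, d⟩, h2⟩ ⟨⟨a', b'⟩, h1'⟩ ⟨⟨c', d'⟩, h2'⟩ ⟨z, hz1, hz2⟩ ⟨w, hw1, hw2⟩
    dsimp only at hz1 hz2 hw1 hw2
    subst hz1 hz2 hw1 hw2
    refine homTmul_eq_iff.2 ⟨z * w, ?_, ?_⟩
    · rw [rot_comp, comp_rot, mul_rot]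
    · rw [rot_comp, comp_rot, mul_rot])

theorem tensorComp_homTmul {p q r : TensorPt Y X} (v : p.fst ⟶ q.fst) (u : p.snd ⟶ q.snd)
    (h : Y.deg v = X.deg u) (v' : q.fst ⟶ r.fst) (u' : q.snd ⟶ r.snd)
    (h' : Y.deg v' = X.deg u') :
    tensorComp (homTmul v u h) (homTmul v' u' h') =
      homTmul (v ≫ v') (u ≫ u') (by rw [Y.deg_comp, X.deg_comp, h, h']) := rfl

/-- Inverses in the tensor product gerbe. -/
def tensorInv {p q : TensorPt Y X} : TensorHom p q → TensorHom q p :=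
  Quotient.lift (fun s => homTmul (Groupoid.inv s.1.1) (Groupoid.inv s.1.2)
      (by rw [deg_inv, deg_inv, s.2])) (by
    rintro ⟨⟨a, b⟩, h1⟩ ⟨⟨c, d⟩, h2⟩ ⟨z, hz1, hz2⟩
    dsimp only at hz1 hz2
    subst hz1 hz2
    refine homTmul_eq_iff.2 ⟨z⁻¹, ?_, ?_⟩
    · rw [← cancel_epi (Y.rot z c)]
      simp [rot_comp, comp_rot, ← mul_rot]
    · rw [← cancel_epi (X.rot z b)]
      simp [rot_comp, comp_rot, ← mul_rot])

instance tensorGroupoid : SmallGroupoid (TensorPt Y X) where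
  Hom := TensorHom
  id p := homTmul (𝟙 p.fst) (𝟙 p.snd) (by rw [Y.deg_id, X.deg_id])
  comp := tensorComp
  inv := tensorInv
  id_comp f := by
    induction f using tensorHom_ind with | H v u h => simp [tensorComp_homTmul]
  comp_id f := by
    induction f using tensorHom_ind with | H v u h => simp [tensorComp_homTmul]
  assoc f f' f'' := by
    induction f using tensorHom_ind with | H v u h =>
    induction f' using tensorHom_ind with | H v' u' h' =>
    induction f'' using tensorHom_ind with | H v'' u'' h'' =>
    simp [tensorComp_homTmul]
  inv_comp f := by
    induction f using tensorHom_ind with | H v u h =>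
    change tensorComp (homTmul _ _ _) (homTmul _ _ _) = _
    simp [tensorComp_homTmul]
  comp_inv f := by
    induction f using tensorHom_ind with | H v u h =>
    change tensorComp (homTmul _ _ _) (homTmul _ _ _) = _
    simp [tensorComp_homTmul]

end Tensor

/-- The tensor product of two equivariant gerbes. -/
@[reducible] def tensor (Y X : EqGerbe.{u} G) : EqGerbe.{u} G where
  pt := TensorPt Y X
  deg f := tensorDeg f
  deg_smul {p q} f := by
    induction f using tensorHom_ind with | H v u h =>
    exact TensorPt.ext' (Y.deg_smul v) ((congrArg (· • p.snd) h).trans (X.deg_smul u))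
  deg_id p := Y.deg_id p.fst
  deg_comp f f' := by
    induction f using tensorHom_ind with | H v u h =>
    induction f' using tensorHom_ind with | H v' u' h' =>
    exact Y.deg_comp v v'
  exists_deg g p := by
    obtain ⟨v, hv⟩ := Y.exists_deg g p.fst
    obtain ⟨u, hu⟩ := X.exists_deg g p.snd
    exact ⟨homTmul (p := p) (q := g • p) v u (hv.trans hu.symm), hv⟩
  u1 p z := homTmul (Y.u1 p.fst z) (𝟙 p.snd) (by rw [Y.deg_u1, X.deg_id])
  u1_one p := by simp only [Y.u1_one]; rfl
  u1_mul p z z' := by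
    change _ = tensorComp (homTmul _ _ _) (homTmul _ _ _)
    simp [tensorComp_homTmul, Y.u1_mul]
  u1_injective p z z' h := by
    obtain ⟨w, h1, h2⟩ := homTmul_eq_iff.1 h
    have h3 : X.rot 1 (𝟙 p.snd) = X.rot w (𝟙 p.snd) := by rw [one_rot]; exact h2
    obtain rfl := rot_right_cancel h3
    rw [one_rot] at h1
    exact Y.u1_injective _ h1
  deg_u1 p z := Y.deg_u1 _ _
  exists_u1 {p} f hf := by
    induction f using tensorHom_ind with | H v u h =>
    obtain ⟨a, ha⟩ := Y.exists_u1 v hf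
    obtain ⟨b, hb⟩ := X.exists_u1 u (h.symm.trans hf)
    refine ⟨a * b, homTmul_eq_iff.2 ⟨b, ?_, ?_⟩⟩
    · rw [← ha, mul_comm, Y.u1_mul]; rfl
    · rw [← hb]; simp [rot]
  u1_central z f := by
    induction f using tensorHom_ind with | H v u h =>
    change tensorComp (homTmul _ _ _) (homTmul _ _ _) = tensorComp (homTmul _ _ _) (homTmul _ _ _)
    simp [tensorComp_homTmul, Y.u1_central]

/-- The gerbe `Y ⊗ X̄`, over which kernels from `X` to `Y` live. -/
abbrev ker (Y X : EqGerbe.{u} G) : EqGerbe.{u} G := Y.tensor X.conjugate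

/-- The object `(y, x)` of `Y ⊗ X̄`. -/
abbrev kpt {Y X : EqGerbe.{u} G} (y : Y.pt) (x : X.pt) : (Y.ker X).pt :=
  (⟨y, x⟩ : TensorPt Y X.conjugate)

/-- The arrow `v ⊗ ū` of `Y ⊗ X̄`. -/
def kArr {Y X : EqGerbe.{u} G} {y y' : Y.pt} {x x' : X.pt} (v : y ⟶ y') (u : x ⟶ x')
    (h : Y.deg v = X.deg u) : kpt (Y := Y) (X := X) y x ⟶ kpt y' x' :=
  homTmul (Y := Y) (X := X.conjugate) (p := ⟨y, x⟩) (q := ⟨y', x'⟩) v u h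

section Ker

variable {Y X : EqGerbe.{u} G}

theorem kArr_ind {p q : (Y.ker X).pt} {motive : (p ⟶ q) → Prop}
    (H : ∀ (v : p.fst ⟶ q.fst) (u : @Quiver.Hom X.pt _ p.snd q.snd) h, motive (kArr v u h))
    (f : p ⟶ q) : motive f := tensorHom_ind H f

theorem kArr_comp {y y' y'' : Y.pt} {x x' x'' : X.pt} (v : y ⟶ y') (u : x ⟶ x')
    (h : Y.deg v = X.deg u) (v' : y' ⟶ y'') (u' : x' ⟶ x'') (h' : Y.deg v' = X.deg u') :
    kArr v u h ≫ kArr v' u' h' =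
      kArr (v ≫ v') (u ≫ u') (by rw [Y.deg_comp, X.deg_comp, h, h']) := rfl

theorem kArr_id (y : Y.pt) (x : X.pt) :
    kArr (𝟙 y) (𝟙 x) (by rw [Y.deg_id, X.deg_id]) = 𝟙 (kpt y x : (Y.ker X).pt) := rfl

theorem deg_kArr {y y' : Y.pt} {x x' : X.pt} (v : y ⟶ y') (u : x ⟶ x')
    (h : Y.deg v = X.deg u) : (Y.ker X).deg (kArr v u h) = Y.deg v := rfl

theorem kArr_rot_left {y y' : Y.pt} {x x' : X.pt} (v : y ⟶ y') (u : x ⟶ x')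
    (h : Y.deg v = X.deg u) (z : Circle) :
    kArr (Y.rot z v) u (by rw [deg_rot, h]) = (Y.ker X).rot z (kArr v u h) := by
  change _ = tensorComp (homTmul _ _ _) (homTmul _ _ _)
  rw [tensorComp_homTmul]
  simp only [Category.id_comp]
  rfl

theorem kArr_rot_right {y y' : Y.pt} {x x' : X.pt} (v : y ⟶ y') (u : x ⟶ x')
    (h : Y.deg v = X.deg u) (z : Circle) :
    kArr v (X.rot z u) (by rw [deg_rot, h]) = (Y.ker X).rot z⁻¹ (kArr v u h) := by
  rw [← kArr_rot_left]
  refine homTmul_eq_iff.2 ⟨z, ?_, ?_⟩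
  · rw [← mul_rot]; simp
  · change u = X.rot z⁻¹ (X.rot z u)
    rw [← mul_rot]; simp

end Ker

end EqGerbe

/-- A finite `G`-equivariant gerbe with a metric: a `G`-invariant assignment of a positive real
number to each object. These are the objects of the 2-category of gerbes. -/
structure MGerbe (G : Type v) [Group G] : Type (max v (u + 1)) extends EqGerbe.{u} G where
  [finite : Finite pt]
  k : pt → PosReal
  k_smul : ∀ (g : G) (x : pt), k (g • x) = k x

instance {G : Type v} [Group G] (X : MGerbe.{u} G) : Finite X.pt := X.finite

/-! ### Unitary equivariant vector bundles -/

section Bundles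

variable {G : Type v} [Group G]

/-- The functors from a gerbe to Hilbert spaces which are unitary and compatible with the
`U(1)`-action on arrows. -/
structure IsBundle (X : EqGerbe.{u} G) (E : X.pt ⥤ FinHilb.{u}) : Prop where
  unitary : ∀ {x y : X.pt} (f : x ⟶ y), FinHilb.IsUnitary (E.map f)
  map_rot : ∀ {x y : X.pt} (z : Circle) (f : x ⟶ y), E.map (X.rot z f) = (z : ℂ) • E.map f

/-- The category of unitary equivariant vector bundles over a gerbe, with all natural
transformations as morphisms. -/
abbrev Bundle (X : EqGerbe.{u} G) : Type (u + 1) :=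
  ObjectProperty.FullSubcategory (C := X.pt ⥤ FinHilb.{u}) (IsBundle X)

open EqGerbe

/-- Bundles over `Y ⊗ X̄`, i.e. equivariant kernels from `X` to `Y`. -/
abbrev Kernel (X Y : EqGerbe.{u} G) : Type (u + 1) := Bundle (Y.ker X)

namespace Kernel

variable {X Y Z : EqGerbe.{u} G}

/-- The amplitude `⟨y | E | x⟩`. -/
abbrev fib (E : Kernel X Y) (y : Y.pt) (x : X.pt) : FinHilb.{u} := E.obj.obj (kpt y x)

/-- The action `⟨y | E | x⟩ → ⟨y' | E | x'⟩` of the arrow `v ⊗ ū`. -/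
def act (E : Kernel X Y) {y y' : Y.pt} {x x' : X.pt} (v : y ⟶ y') (u : x ⟶ x')
    (h : Y.deg v = X.deg u) : E.fib y x →ₗ[ℂ] E.fib y' x' :=
  FinHilb.lin (E.obj.map (kArr v u h))

theorem act_id (E : Kernel X Y) (y : Y.pt) (x : X.pt) (h) :
    E.act (𝟙 y) (𝟙 x) h = LinearMap.id := by
  have := E.obj.map_id (kpt y x)
  exact congrArg FinHilb.lin this

theorem act_comp (E : Kernel X Y) {y y' y'' : Y.pt} {x x' x'' : X.pt} (v : y ⟶ y') (u : x ⟶ x')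
    (h) (v' : y' ⟶ y'') (u' : x' ⟶ x'') (h') (h'') :
    E.act (v ≫ v') (u ≫ u') h'' = E.act v' u' h' ∘ₗ E.act v u h := by
  have := E.obj.map_comp (kArr v u h) (kArr v' u' h')
  exact congrArg FinHilb.lin this

theorem act_rot_left (E : Kernel X Y) {y y' : Y.pt} {x x' : X.pt} (v : y ⟶ y') (u : x ⟶ x')
    (h) (z : Circle) (h') : E.act (Y.rot z v) u h' = (z : ℂ) • E.act v u h := by
  have := E.property.map_rot z (kArr v u h)
  rw [← kArr_rot_left] at this
  exact congrArg FinHilb.lin this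

theorem act_rot_right (E : Kernel X Y) {y y' : Y.pt} {x x' : X.pt} (v : y ⟶ y') (u : x ⟶ x')
    (h) (z : Circle) (h') : E.act v (X.rot z u) h' = ((z⁻¹ : Circle) : ℂ) • E.act v u h := by
  have := E.property.map_rot z⁻¹ (kArr v u h)
  rw [← kArr_rot_right] at this
  exact congrArg FinHilb.lin this

theorem act_inner (E : Kernel X Y) {y y' : Y.pt} {x x' : X.pt} (v : y ⟶ y') (u : x ⟶ x')
    (h) (a b : E.fib y x) : inner ℂ (E.act v u h a) (E.act v u h b) = inner ℂ a b :=
  (E.property.unitary (kArr v u h)).inner_map a b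

/-- The data from which a kernel is built. -/
structure Data (X Y : EqGerbe.{u} G) : Type (max v (u + 1)) where
  fib : Y.pt → X.pt → FinHilb.{u}
  act : ∀ {y y' : Y.pt} {x x' : X.pt} (v : y ⟶ y') (u : x ⟶ x'), Y.deg v = X.deg u →
    (fib y x →ₗ[ℂ] fib y' x')
  act_id : ∀ y x h, act (𝟙 y) (𝟙 x) h = LinearMap.id
  act_comp : ∀ {y y' y'' : Y.pt} {x x' x'' : X.pt} (v : y ⟶ y') (u : x ⟶ x') (h)
    (v' : y' ⟶ y'') (u' : x' ⟶ x'') (h') (h''),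
    act (v ≫ v') (u ≫ u') h'' = act v' u' h' ∘ₗ act v u h
  act_rot_left : ∀ {y y' : Y.pt} {x x' : X.pt} (v : y ⟶ y') (u : x ⟶ x') (h) (z : Circle) (h'),
    act (Y.rot z v) u h' = (z : ℂ) • act v u h
  act_rot_right : ∀ {y y' : Y.pt} {x x' : X.pt} (v : y ⟶ y') (u : x ⟶ x') (h) (z : Circle) (h'),
    act v (X.rot z u) h' = ((z⁻¹ : Circle) : ℂ) • act v u h
  inner_act : ∀ {y y' : Y.pt} {x x' : X.pt} (v : y ⟶ y') (u : x ⟶ x') (h) (a b : fib y x),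
    inner ℂ (act v u h a) (act v u h b) = inner ℂ a b

/-- The functor underlying a kernel. -/
def ofDataFunctor (D : Data X Y) : (Y.ker X).pt ⥤ FinHilb.{u} where
  obj p := D.fib p.fst p.snd
  map {p q} f := Quotient.lift
    (fun s : ArrowPair Y X.conjugate p.toProd q.toProd =>
      (FinHilb.ofLin (D.act s.1.1 s.1.2 s.2) : D.fib p.fst p.snd ⟶ D.fib q.fst q.snd)) (by
    rintro ⟨⟨a, b⟩, h1⟩ ⟨⟨c, d⟩, h2⟩ ⟨z, hz1, hz2⟩
    dsimp only at hz1 hz2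
    subst hz1 hz2
    refine FinHilb.hom_ext ?_
    change D.act (Y.rot z c) b h1 = D.act c (X.rot z⁻¹ b) h2
    have h0 : Y.deg c = X.deg b := (deg_rot z c).symm.trans h1
    exact (D.act_rot_left c b h0 z h1).trans
      ((D.act_rot_right c b h0 z⁻¹ h2).trans (by rw [inv_inv])).symm)
    f
  map_id p := FinHilb.hom_ext (D.act_id p.fst p.snd _)
  map_comp f f' := by
    induction f using kArr_ind with | H v u h =>
    induction f' using kArr_ind with | H v' u' h' =>
    exact FinHilb.hom_ext (D.act_comp v u h v' u' h' _)

/-- Build a kernel from its amplitudes and the action of the arrows `v ⊗ ū`. -/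
def ofData (D : Data X Y) : Kernel X Y where
  obj := ofDataFunctor D
  property :=
    { unitary := fun {p q} f => by
        refine ⟨?_, ?_⟩
        · induction f using kArr_ind with | H v u h =>
          exact D.inner_act v u h
        · have h1 := congrArg FinHilb.lin ((ofDataFunctor D).map_comp f (Groupoid.inv f))
          have h2 := congrArg FinHilb.lin ((ofDataFunctor D).map_comp (Groupoid.inv f) f)
          rw [Groupoid.comp_inv, CategoryTheory.Functor.map_id] at h1
          rw [Groupoid.inv_comp, CategoryTheory.Functor.map_id] at h2
          exact Function.bijective_iff_has_inverse.2
            ⟨_, fun a => (LinearMap.congr_fun h1 a).symm, fun a => (LinearMap.congr_fun h2 a).symm⟩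
      map_rot := fun z f => by
        induction f using kArr_ind with | H v u h =>
        rw [← kArr_rot_left]
        exact FinHilb.hom_ext (D.act_rot_left v u h z _) }

theorem ofData_act (D : Data X Y) {y y' : Y.pt} {x x' : X.pt} (v : y ⟶ y') (u : x ⟶ x')
    (h : Y.deg v = X.deg u) : (ofData D).act v u h = D.act v u h := rfl

/-- The component at `(y, x)` of a morphism of kernels. -/
def app {E E' : Kernel X Y} (η : E ⟶ E') (y : Y.pt) (x : X.pt) : E.fib y x →ₗ[ℂ] E'.fib y x :=
  FinHilb.lin (η.hom.app (kpt y x))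

theorem app_act {E E' : Kernel X Y} (η : E ⟶ E') {y y' : Y.pt} {x x' : X.pt} (v : y ⟶ y')
    (u : x ⟶ x') (h) : app η y' x' ∘ₗ E.act v u h = E'.act v u h ∘ₗ app η y x :=
  congrArg FinHilb.lin (η.hom.naturality (kArr v u h))

theorem hom_ext {E E' : Kernel X Y} {η θ : E ⟶ E'} (h : ∀ y x, app η y x = app θ y x) :
    η = θ := by
  refine ObjectProperty.hom_ext _ (NatTrans.ext (funext fun p => FinHilb.hom_ext ?_))
  exact h p.fst p.snd

/-- Build a morphism of kernels from its components. -/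
def mkHom {E E' : Kernel X Y} (f : ∀ y x, E.fib y x →ₗ[ℂ] E'.fib y x)
    (hf : ∀ {y y' : Y.pt} {x x' : X.pt} (v : y ⟶ y') (u : x ⟶ x') (h),
      f y' x' ∘ₗ E.act v u h = E'.act v u h ∘ₗ f y x) : E ⟶ E' :=
  ObjectProperty.homMk
    { app := fun p => FinHilb.ofLin (f p.fst p.snd)
      naturality := fun p q g => by
        induction g using kArr_ind with | H v u h =>
        exact FinHilb.hom_ext (hf v u h) }

@[simp] theorem app_mkHom {E E' : Kernel X Y} (f : ∀ y x, E.fib y x →ₗ[ℂ] E'.fib y x) (hf)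
    (y : Y.pt) (x : X.pt) : app (mkHom f hf) y x = f y x := rfl

@[simp] theorem app_id (E : Kernel X Y) (y : Y.pt) (x : X.pt) :
    app (𝟙 E) y x = LinearMap.id := rfl

@[simp] theorem app_comp {E E' E'' : Kernel X Y} (η : E ⟶ E') (θ : E' ⟶ E'') (y : Y.pt)
    (x : X.pt) : app (η ≫ θ) y x = app θ y x ∘ₗ app η y x := rfl

@[simp] theorem app_add {E E' : Kernel X Y} (η θ : E ⟶ E') (y : Y.pt)
    (x : X.pt) : app (η + θ) y x = app η y x + app θ y x := rfl

/-- Build an isomorphism of kernels from mutually inverse families of linear maps. -/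
def mkIso {E E' : Kernel X Y} (f : ∀ y x, E.fib y x →ₗ[ℂ] E'.fib y x)
    (f' : ∀ y x, E'.fib y x →ₗ[ℂ] E.fib y x)
    (h1 : ∀ y x, f' y x ∘ₗ f y x = LinearMap.id) (h2 : ∀ y x, f y x ∘ₗ f' y x = LinearMap.id)
    (hf : ∀ {y y' : Y.pt} {x x' : X.pt} (v : y ⟶ y') (u : x ⟶ x') (h),
      f' y' x' ∘ₗ E'.act v u h = E.act v u h ∘ₗ f' y x) : E ≅ E' where
  hom := mkHom f (fun {y y' x x'} v u h => by
    have h3 := congrArg (fun l => f y' x' ∘ₗ l ∘ₗ f y x) (hf v u h)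
    simp only [LinearMap.comp_assoc, h1, LinearMap.comp_id] at h3
    rw [← h3, ← LinearMap.comp_assoc, h2, LinearMap.id_comp])
  inv := mkHom f' hf
  hom_inv_id := hom_ext fun y x => h1 y x
  inv_hom_id := hom_ext fun y x => h2 y x

end Kernel

end Bundles

/-! ### Composition of kernels -/

namespace WSum

/-- The inner product of two homogeneous elements of a weighted direct sum. -/
theorem inner_single {ι : Type v} [Finite ι] {wt : ι → PosReal} {V : ι → Type w}
    [∀ i, NormedAddCommGroup (V i)] [∀ i, InnerProductSpace ℂ (V i)] (i : ι) (a : V i)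
    (b : WSum wt V) : inner ℂ (single i a : WSum wt V) b =
      ((wt i : ℝ) : ℂ) * inner ℂ a (proj i b) := by
  let _ := Fintype.ofFinite ι
  rw [inner_eq_sum, Finset.sum_eq_single i]
  · rw [proj_single_same]
  · intro l _ hl
    rw [proj_single_ne hl.symm, inner_zero_left, mul_zero]
  · simp

/-- A map permuting the summands isometrically preserves inner products. -/
theorem inner_of_single {ι : Type v} [Finite ι] {wt : ι → PosReal} {V : ι → Type w}
    [∀ i, NormedAddCommGroup (V i)] [∀ i, InnerProductSpace ℂ (V i)]
    {ι' : Type v} [Finite ι'] {wt' : ι' → PosReal} {V' : ι' → Type w}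
    [∀ i, NormedAddCommGroup (V' i)] [∀ i, InnerProductSpace ℂ (V' i)]
    (T : WSum wt V →ₗ[ℂ] WSum wt' V') (σ : ι → ι') (hσ : Function.Injective σ)
    (hw : ∀ i, wt' (σ i) = wt i) (U : ∀ i, V i →ₗ[ℂ] V' (σ i))
    (hU : ∀ i a b, inner ℂ (U i a) (U i b) = inner ℂ a b)
    (hT : ∀ i a, T (single i a) = single (σ i) (U i a)) (a b : WSum wt V) :
    inner ℂ (T a) (T b) = inner ℂ a b := by
  let _ := Fintype.ofFinite ι
  rw [← sum_single_proj a, ← sum_single_proj b]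
  simp only [map_sum, sum_inner, inner_sum]
  refine Finset.sum_congr rfl fun i _ => Finset.sum_congr rfl fun j _ => ?_
  rw [hT, hT, inner_single, inner_single, hw]
  by_cases e : j = i
  · subst e
    rw [proj_single_same, proj_single_same, hU]
  · rw [proj_single_ne (Ne.symm e), proj_single_ne (fun e' => e (hσ e'.symm)), inner_zero_right, inner_zero_right]

end WSum

section Composition

variable {G : Type v} [Group G]

open EqGerbe

namespace Kernel

variable {X Y Z W : MGerbe.{u} G}

/-- `⟨z | F ∘ E | x⟩ = ⨁_y (1 / k y) ⟨z | F | y⟩ ⊗ ⟨y | E | x⟩`. -/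
abbrev CompSum (E : Kernel X.toEqGerbe Y.toEqGerbe) (F : Kernel Y.toEqGerbe Z.toEqGerbe)
    (z : Z.pt) (x : X.pt) : Type u :=
  WSum (fun y : Y.pt => (Y.k y)⁻¹) fun y => F.fib z y ⊗[ℂ] E.fib y x

/-- The element `a ⊗ b` of the summand of `y`. -/
def ten {E : Kernel X.toEqGerbe Y.toEqGerbe} {F : Kernel Y.toEqGerbe Z.toEqGerbe}
    {z : Z.pt} {x : X.pt} (y : Y.pt) (a : F.fib z y) (b : E.fib y x) : CompSum E F z x :=
  WSum.single y (a ⊗ₜ b)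

section Ten

variable {E : Kernel X.toEqGerbe Y.toEqGerbe} {F : Kernel Y.toEqGerbe Z.toEqGerbe}
    {z : Z.pt} {x : X.pt}

theorem comp_ext {M : Type*} [AddCommGroup M] [Module ℂ M] {f g : CompSum E F z x →ₗ[ℂ] M}
    (h : ∀ y a b, f (ten y a b) = g (ten y a b)) : f = g :=
  WSum.hom_ext fun i => TensorProduct.ext' fun a b => h i a b

theorem ten_smul_left (c : ℂ) (y : Y.pt) (a : F.fib z y) (b : E.fib y x) :
    ten y (c • a) b = c • ten y a b := by
  rw [ten, ← TensorProduct.smul_tmul', map_smul, ten]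

theorem ten_smul_right (c : ℂ) (y : Y.pt) (a : F.fib z y) (b : E.fib y x) :
    ten y a (c • b) = c • ten y a b := by
  rw [ten, TensorProduct.tmul_smul, map_smul, ten]

theorem ten_add_left (y : Y.pt) (a a' : F.fib z y) (b : E.fib y x) :
    ten y (a + a') b = ten y a b + ten y a' b := by
  rw [ten, TensorProduct.add_tmul, map_add, ten, ten]

theorem ten_add_right (y : Y.pt) (a : F.fib z y) (b b' : E.fib y x) :
    ten y a (b + b') = ten y a b + ten y a b' := by
  rw [ten, TensorProduct.tmul_add, map_add, ten, ten]

/-- `ten` as a bilinear map. -/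
def tenB (y : Y.pt) : F.fib z y →ₗ[ℂ] E.fib y x →ₗ[ℂ] CompSum E F z x :=
  LinearMap.mk₂ ℂ (ten y) (fun a a' b => ten_add_left y a a' b) (fun c a b => ten_smul_left c y a b)
    (fun a b b' => ten_add_right y a b b') (fun c a b => ten_smul_right c y a b)

@[simp] theorem tenB_apply (y : Y.pt) (a : F.fib z y) (b : E.fib y x) :
    tenB y a b = ten y a b := rfl

/-- Linear maps out of a composite are families of bilinear maps. -/
def clift {M : Type*} [AddCommGroup M] [Module ℂ M]
    (f : ∀ y, F.fib z y →ₗ[ℂ] E.fib y x →ₗ[ℂ] M) : CompSum E F z x →ₗ[ℂ] M :=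
  WSum.lift fun y => TensorProduct.lift (f y)

@[simp] theorem clift_ten {M : Type*} [AddCommGroup M] [Module ℂ M]
    (f : ∀ y, F.fib z y →ₗ[ℂ] E.fib y x →ₗ[ℂ] M) (y : Y.pt) (a : F.fib z y) (b : E.fib y x) :
    clift f (ten y a b) = f y a b := by
  rw [clift, ten, WSum.lift_single, TensorProduct.lift.tmul]

end Ten

/-- The action of `w ⊗ ū` on a composite, `F(w ⊗ v̄) ⊗ E(v ⊗ ū)` on the summand of `y`, where
`v` is any arrow out of `y` of the same degree. -/
def compAct (E : Kernel X.toEqGerbe Y.toEqGerbe) (F : Kernel Y.toEqGerbe Z.toEqGerbe)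
    {z z' : Z.pt} {x x' : X.pt} (w : z ⟶ z') (u : x ⟶ x') (h : Z.deg w = X.deg u) :
    CompSum E F z x →ₗ[ℂ] CompSum E F z' x' :=
  WSum.lift fun y => WSum.single (Z.deg w • y) ∘ₗ
    TensorProduct.map
      (F.act w (Y.exists_deg (Z.deg w) y).choose (Y.exists_deg (Z.deg w) y).choose_spec.symm)
      (E.act (Y.exists_deg (Z.deg w) y).choose u ((Y.exists_deg (Z.deg w) y).choose_spec.trans h))

/-- The action on a composite does not depend on the choice of `v`. -/
theorem compAct_ten (E : Kernel X.toEqGerbe Y.toEqGerbe) (F : Kernel Y.toEqGerbe Z.toEqGerbe)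
    {z z' : Z.pt} {x x' : X.pt} (w : z ⟶ z') (u : x ⟶ x') (h : Z.deg w = X.deg u)
    {y y' : Y.pt} (v : y ⟶ y') (hv : Z.deg w = Y.deg v) (hv' : Y.deg v = X.deg u)
    (a : F.fib z y) (b : E.fib y x) :
    compAct E F w u h (ten y a b) = ten y' (F.act w v hv a) (E.act v u hv' b) := by
  obtain rfl : Z.deg w • y = y' := by rw [hv]; exact Y.deg_smul v
  have h0 := (Y.exists_deg (Z.deg w) y).choose_spec
  obtain ⟨t, rfl⟩ := exists_rot (Y.exists_deg (Z.deg w) y).choose v (h0.trans hv)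
  rw [act_rot_right F w _ h0.symm t, act_rot_left E _ u (h0.trans h) t, LinearMap.smul_apply,
    LinearMap.smul_apply, ten_smul_left, ten_smul_right, smul_smul, ← Circle.coe_mul,
    inv_mul_cancel, Circle.coe_one, one_smul, compAct, ten, WSum.lift_single]
  rfl

/-- The action of an arrow as an isometry. -/
def actIsom (E : Kernel X.toEqGerbe Y.toEqGerbe) {y y' : Y.pt} {x x' : X.pt} (v : y ⟶ y')
    (u : x ⟶ x') (h : Y.deg v = X.deg u) : E.fib y x →ₗᵢ[ℂ] E.fib y' x' :=
  (E.act v u h).isometryOfInner (E.act_inner v u h)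

/-- The composite `F ∘ E` of two kernels. -/
def compData (E : Kernel X.toEqGerbe Y.toEqGerbe) (F : Kernel Y.toEqGerbe Z.toEqGerbe) :
    Data X.toEqGerbe Z.toEqGerbe where
  fib z x := ⟨CompSum E F z x⟩
  act := compAct E F
  act_id z x h := comp_ext fun y a b => by
    rw [compAct_ten E F _ _ h (𝟙 y) (by rw [Z.deg_id, Y.deg_id]) (by rw [Y.deg_id, X.deg_id]),
      act_id, act_id]
    rfl
  act_comp w u h w' u' h' h'' := comp_ext fun y a b => by
    obtain ⟨v, hv⟩ := Y.exists_deg (Z.deg w) y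
    obtain ⟨v', hv'⟩ := Y.exists_deg (Z.deg w') (Z.deg w • y)
    have e : Z.deg w' = X.deg u' := h'
    have e1 : Z.deg (w ≫ w') = Y.deg (v ≫ v') := by rw [Z.deg_comp, Y.deg_comp, hv, hv']
    have e2 : Y.deg (v ≫ v') = X.deg (u ≫ u') := by rw [X.deg_comp, Y.deg_comp, hv, hv', h, e]
    rw [LinearMap.comp_apply, compAct_ten E F w u h v hv.symm (hv.trans h),
      compAct_ten E F w' u' h' v' hv'.symm (hv'.trans e),
      compAct_ten E F _ _ h'' (v ≫ v') e1 e2,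
      act_comp F w v hv.symm w' v' hv'.symm, act_comp E v u (hv.trans h) v' u' (hv'.trans e)]
    rfl
  act_rot_left w u h t h' := comp_ext fun y a b => by
    obtain ⟨v, hv⟩ := Y.exists_deg (Z.deg w) y
    rw [LinearMap.smul_apply, compAct_ten E F w u h v hv.symm (hv.trans h),
      compAct_ten E F _ u h' v (by rw [deg_rot, hv]) (hv.trans h),
      act_rot_left F _ _ hv.symm, LinearMap.smul_apply, ten_smul_left]
  act_rot_right w u h t h' := comp_ext fun y a b => by
    obtain ⟨v, hv⟩ := Y.exists_deg (Z.deg w) y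
    rw [LinearMap.smul_apply, compAct_ten E F w u h v hv.symm (hv.trans h),
      compAct_ten E F w _ h' v hv.symm (by rw [deg_rot, hv, h]),
      act_rot_right E _ _ (hv.trans h), LinearMap.smul_apply, ten_smul_right]
  inner_act w u h a b := by
    have h0 := fun y => (Y.exists_deg (Z.deg w) y).choose_spec
    refine WSum.inner_of_single (compAct E F w u h) (fun y => Z.deg w • y)
      (MulAction.injective _) (fun y => by rw [Y.k_smul])
      (fun y => TensorProduct.map (F.act w (Y.exists_deg (Z.deg w) y).choose (h0 y).symm)
        (E.act (Y.exists_deg (Z.deg w) y).choose u ((h0 y).trans h)))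
      (fun y a b => TensorProduct.inner_map_map (actIsom F w _ (h0 y).symm)
        (actIsom E _ u ((h0 y).trans h)) a b)
      (fun y a => by simp only [compAct, WSum.lift_single, LinearMap.comp_apply]) a b

/-- The composite `F ∘ E` of two kernels. -/
def comp (E : Kernel X.toEqGerbe Y.toEqGerbe) (F : Kernel Y.toEqGerbe Z.toEqGerbe) :
    Kernel X.toEqGerbe Z.toEqGerbe := ofData (compData E F)

/-! The elements `a ⊗ b` of a composite, and linear maps out of it. -/

section Tn

variable {E : Kernel X.toEqGerbe Y.toEqGerbe} {F : Kernel Y.toEqGerbe Z.toEqGerbe}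
    {z : Z.pt} {x : X.pt}

/-- The element `a ⊗ b` of the summand of `y`, as a bilinear map. -/
def tn (y : Y.pt) : F.fib z y →ₗ[ℂ] E.fib y x →ₗ[ℂ] (comp E F).fib z x := tenB y

/-- Linear maps out of a composite are families of bilinear maps. -/
def tlift {M : Type*} [AddCommGroup M] [Module ℂ M]
    (f : ∀ y, F.fib z y →ₗ[ℂ] E.fib y x →ₗ[ℂ] M) : (comp E F).fib z x →ₗ[ℂ] M := clift f

@[simp] theorem tlift_tn {M : Type*} [AddCommGroup M] [Module ℂ M]
    (f : ∀ y, F.fib z y →ₗ[ℂ] E.fib y x →ₗ[ℂ] M) (y : Y.pt) (a : F.fib z y) (b : E.fib y x) :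
    tlift f (tn y a b) = f y a b := clift_ten f y a b

theorem tn_ext {M : Type*} [AddCommGroup M] [Module ℂ M] {f g : (comp E F).fib z x →ₗ[ℂ] M}
    (h : ∀ y a b, f (tn y a b) = g (tn y a b)) : f = g := comp_ext h

/-- Bilinear maps out of a composite agree if they agree on generators. -/
theorem tn_ext_left {M : Type*} [AddCommGroup M] [Module ℂ M] {N : Type*} [AddCommGroup N]
    [Module ℂ N] {f g : (comp E F).fib z x →ₗ[ℂ] N →ₗ[ℂ] M}
    (h : ∀ y a b n, f (tn y a b) n = g (tn y a b) n) (c) (n) : f c n = g c n :=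
  LinearMap.congr_fun (LinearMap.congr_fun (tn_ext fun y a b => LinearMap.ext (h y a b)) c) n

theorem comp_act_tn {z' : Z.pt} {x' : X.pt} (w : z ⟶ z') (u : x ⟶ x') (h : Z.deg w = X.deg u)
    {y y' : Y.pt} (v : y ⟶ y') (hv : Z.deg w = Y.deg v) (hv' : Y.deg v = X.deg u)
    (a : F.fib z y) (b : E.fib y x) :
    (comp E F).act w u h (tn y a b) = tn y' (F.act w v hv a) (E.act v u hv' b) :=
  compAct_ten E F w u h v hv hv' a b

end Tn

/-! ### Identity kernels -/

/-- `⟨y | id | x⟩`, a copy of `ℂ` weighted by `k x` if `y = x`, and zero otherwise. -/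
abbrev IdSum (X : MGerbe.{u} G) (y x : X.pt) : Type u :=
  WSum (ι := ULift.{u} (PLift (y = x))) (fun _ => X.k x) fun _ => ℂ

theorem exists_phase {y y' x x' : X.pt} (v : y ⟶ y') (u : x ⟶ x') (e : y = x)
    (h : X.deg v = X.deg u) : ∃ (e' : y' = x') (z : Circle),
      X.rot z (eqToHom e ≫ u ≫ eqToHom e'.symm) = v := by
  subst e
  obtain rfl : y' = x' := by rw [← X.deg_smul v, ← X.deg_smul u, h]
  obtain ⟨z, hz⟩ := exists_rot u v h.symm
  exact ⟨rfl, z, by simpa using hz⟩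

/-- The ratio `v / u` of parallel arrows. -/
def phase {y y' x x' : X.pt} (v : y ⟶ y') (u : x ⟶ x') (e : y = x)
    (h : X.deg v = X.deg u) : Circle := (exists_phase v u e h).choose_spec.choose

theorem rot_phase {y y' x x' : X.pt} (v : y ⟶ y') (u : x ⟶ x') (e : y = x)
    (h : X.deg v = X.deg u) : X.rot (phase v u e h)
      (eqToHom e ≫ u ≫ eqToHom (exists_phase v u e h).choose.symm) = v :=
  (exists_phase v u e h).choose_spec.choose_spec

/-- The action of `v ⊗ ū` on the identity kernel: multiplication by `v / u` on the diagonal. -/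
def idAct {y y' x x' : X.pt} (v : y ⟶ y') (u : x ⟶ x') (h : X.deg v = X.deg u) :
    IdSum X y x →ₗ[ℂ] IdSum X y' x' :=
  WSum.lift fun e => (phase v u e.down.down h : ℂ) •
    WSum.single (wt := fun _ => X.k x') (V := fun _ => ℂ)
      (ULift.up (PLift.up (exists_phase v u e.down.down h).choose) :
        ULift.{u} (PLift (y' = x')))

/-- The element `c` of the diagonal fiber of the identity kernel. -/
def idEl (x : X.pt) (c : ℂ) : IdSum X x x :=
  WSum.single (ULift.up (PLift.up rfl) : ULift.{u} (PLift (x = x))) c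

theorem idAct_idEl {x x' : X.pt} (u : x ⟶ x') (z : Circle) (h) (c : ℂ) :
    idAct (X.rot z u) u h (idEl x c) = idEl x' (z * c) := by
  have h1 := rot_phase (X.rot z u) u rfl h
  simp only [eqToHom_refl, Category.comp_id, Category.id_comp] at h1
  have h2 : phase (X.rot z u) u rfl h = z := rot_right_cancel h1
  rw [idAct, idEl, WSum.lift_single, h2, LinearMap.smul_apply, ← map_smul]
  rfl

theorem id_ext {M : Type*} [AddCommGroup M] [Module ℂ M] {y x : X.pt} {f g : IdSum X y x →ₗ[ℂ] M}
    (h : ∀ e : y = x, ∀ c, f (e ▸ idEl y c) = g (e ▸ idEl y c)) : f = g := by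
  refine WSum.hom_ext fun e => ?_
  obtain ⟨⟨rfl⟩⟩ := e
  exact LinearMap.ext fun c => h rfl c

/-- The identity kernel. -/
def idData (X : MGerbe.{u} G) : Data X.toEqGerbe X.toEqGerbe where
  fib y x := ⟨IdSum X y x⟩
  act v u h := idAct v u h
  act_id y x h := id_ext fun e c => by
    subst e
    have := idAct_idEl (𝟙 y) 1 (by rw [one_rot]) c
    simp only [one_rot] at this
    simp [this]
  act_comp {y y' y'' x x' x''} v u h v' u' h' h'' := id_ext fun e c => by
    subst e
    obtain rfl : y' = x' := by rw [← X.deg_smul v, ← X.deg_smul u, h]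
    obtain rfl : y'' = x'' := by rw [← X.deg_smul v', ← X.deg_smul u', h']
    obtain ⟨a, rfl⟩ := exists_rot u v h.symm
    obtain ⟨b, rfl⟩ := exists_rot u' v' h'.symm
    have e3 : X.rot a u ≫ X.rot b u' = X.rot (b * a) (u ≫ u') := by
      rw [rot_comp, comp_rot, ← mul_rot, mul_comm]
    simp only [e3, LinearMap.comp_apply, idAct_idEl, Circle.coe_mul, mul_assoc]
  act_rot_left {y y' x x'} v u h z h' := id_ext fun e c => by
    subst e
    obtain rfl : y' = x' := by rw [← X.deg_smul v, ← X.deg_smul u, h]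
    obtain ⟨a, rfl⟩ := exists_rot u v h.symm
    simp only [LinearMap.smul_apply, ← mul_rot, idAct_idEl, Circle.coe_mul, mul_assoc]
    rw [idEl, idEl, ← map_smul]
    rfl
  act_rot_right {y y' x x'} v u h z h' := id_ext fun e c => by
    subst e
    obtain rfl : y' = x' := by rw [← X.deg_smul v, ← X.deg_smul u, h]
    obtain ⟨a, rfl⟩ := exists_rot u v h.symm
    have e3 : X.rot a u = X.rot (a * z⁻¹) (X.rot z u) := by
      rw [← mul_rot]; simp
    have h4 : idAct (X.rot a u) (X.rot z u) h' (idEl y c) =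
        idEl y' (((a * z⁻¹ : Circle) : ℂ) * c) := by
      simp only [e3]
      exact idAct_idEl (X.rot z u) (a * z⁻¹) _ c
    simp only [LinearMap.smul_apply, h4, idAct_idEl]
    rw [idEl, idEl, ← map_smul]
    congr 1
    simp only [Circle.coe_mul, smul_eq_mul]
    ring
  inner_act {y y' x x'} v u h a b := by
    refine WSum.inner_of_single (idAct v u h)
      (fun e => ⟨⟨(exists_phase v u e.down.down h).choose⟩⟩)
      (fun e e' _ => Subsingleton.elim _ _)
      (fun e => by rw [← X.deg_smul u, X.k_smul])
      (fun e => (phase v u e.down.down h : ℂ) • LinearMap.id)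
      (fun e a b => ?_)
      (fun e a => by simp only [idAct, WSum.lift_single, LinearMap.smul_apply, map_smul,
        LinearMap.id_apply]) a b
    rw [LinearMap.smul_apply, LinearMap.smul_apply, inner_smul_left, inner_smul_right,
      ← mul_assoc, ← Circle.coe_inv_eq_conj, ← Circle.coe_mul, inv_mul_cancel, Circle.coe_one,
      one_mul]
    rfl

/-- The identity kernel. -/
def idK (X : MGerbe.{u} G) : Kernel X.toEqGerbe X.toEqGerbe := ofData (idData X)

/-- The element `1` of the diagonal fiber of the identity kernel. -/
def idOne (x : X.pt) : (idK X).fib x x := idEl x 1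

theorem idK_act_idOne {x x' : X.pt} (u : x ⟶ x') :
    (idK X).act u u rfl (idOne x) = idOne x' := by
  have := idAct_idEl u 1 (by rw [one_rot]) 1
  simp only [one_rot, Circle.coe_one, mul_one] at this
  exact this

/-- The linear map out of the identity kernel with a given value at `1`. -/
def idLift {M : Type*} [AddCommGroup M] [Module ℂ M] {y x : X.pt} (f : y = x → M) :
    (idK X).fib y x →ₗ[ℂ] M :=
  WSum.lift (ι := ULift.{u} (PLift (y = x))) (wt := fun _ => X.k x) (V := fun _ => ℂ)
    fun e => LinearMap.toSpanSingleton ℂ M (f e.down.down)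

@[simp] theorem idLift_idOne {M : Type*} [AddCommGroup M] [Module ℂ M] {x : X.pt}
    (f : x = x → M) : idLift f (idOne x) = f rfl := by
  refine (WSum.lift_single (wt := fun _ => X.k x) (V := fun _ => ℂ) _ _ _).trans ?_
  simp

theorem idK_ext {M : Type*} [AddCommGroup M] [Module ℂ M] {y x : X.pt}
    {f g : (idK X).fib y x →ₗ[ℂ] M}
    (h : ∀ e : y = x, f (e ▸ idOne y) = g (e ▸ idOne y)) : f = g := by
  refine id_ext (y := y) (x := x) fun e c => ?_
  subst e
  have h1 : idEl y c = c • (idOne y : (idK X).fib y y) := by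
    refine Eq.trans ?_ (map_smul (WSum.single (wt := fun _ => X.k y) (V := fun _ => ℂ)
      (ULift.up (PLift.up rfl) : ULift.{u} (PLift (y = y)))) c (1 : ℂ))
    rw [smul_eq_mul, mul_one]
    rfl
  have h2 := congrArg (c • ·) (h rfl)
  dsimp only at h2
  rw [← map_smul, ← map_smul] at h2
  dsimp only
  rw [h1]
  exact h2


/-! ### Coherence of composition up to isomorphism -/

/-- The horizontal composite of morphisms of kernels. -/
def hcomp {E E' : Kernel X.toEqGerbe Y.toEqGerbe} {F F' : Kernel Y.toEqGerbe Z.toEqGerbe}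
    (η : E ⟶ E') (θ : F ⟶ F') : comp E F ⟶ comp E' F' :=
  mkHom (fun z x => tlift fun y => (tn y).compl₁₂ (app θ z y) (app η y x))
    (fun {z z' x x'} w u h => tn_ext fun y a b => by
      obtain ⟨v, hv⟩ := Y.exists_deg (Z.deg w) y
      have h1 := LinearMap.congr_fun (app_act θ w v hv.symm) a
      have h2 := LinearMap.congr_fun (app_act η v u (hv.trans h)) b
      simp only [LinearMap.comp_apply] at h1 h2
      simp only [LinearMap.comp_apply, tlift_tn, LinearMap.compl₁₂_apply]
      rw [comp_act_tn w u h v hv.symm (hv.trans h), tlift_tn, LinearMap.compl₁₂_apply, h1, h2,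
        comp_act_tn w u h v hv.symm (hv.trans h)])

@[simp] theorem app_hcomp_tn {E E' : Kernel X.toEqGerbe Y.toEqGerbe}
    {F F' : Kernel Y.toEqGerbe Z.toEqGerbe} (η : E ⟶ E') (θ : F ⟶ F') (z : Z.pt) (x : X.pt)
    (y : Y.pt) (a : F.fib z y) (b : E.fib y x) :
    app (hcomp η θ) z x (tn y a b) = tn y (app θ z y a) (app η y x b) :=
  tlift_tn _ y a b

theorem hcomp_id (E : Kernel X.toEqGerbe Y.toEqGerbe) (F : Kernel Y.toEqGerbe Z.toEqGerbe) :
    hcomp (𝟙 E) (𝟙 F) = 𝟙 (comp E F) :=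
  hom_ext fun z x => tn_ext fun y a b => app_hcomp_tn _ _ z x y a b

theorem hcomp_comp {E E' E'' : Kernel X.toEqGerbe Y.toEqGerbe}
    {F F' F'' : Kernel Y.toEqGerbe Z.toEqGerbe} (η : E ⟶ E') (η' : E' ⟶ E'') (θ : F ⟶ F')
    (θ' : F' ⟶ F'') : hcomp (η ≫ η') (θ ≫ θ') = hcomp η θ ≫ hcomp η' θ' :=
  hom_ext fun z x => tn_ext fun y a b => by simp

theorem hcomp_add_left {E E' : Kernel X.toEqGerbe Y.toEqGerbe}
    {F F' : Kernel Y.toEqGerbe Z.toEqGerbe} (η η' : E ⟶ E') (θ : F ⟶ F') :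
    hcomp (η + η') θ = hcomp η θ + hcomp η' θ :=
  hom_ext fun z x => tn_ext fun y a b => by simp

theorem hcomp_add_right {E E' : Kernel X.toEqGerbe Y.toEqGerbe}
    {F F' : Kernel Y.toEqGerbe Z.toEqGerbe} (η : E ⟶ E') (θ θ' : F ⟶ F') :
    hcomp η (θ + θ') = hcomp η θ + hcomp η θ' :=
  hom_ext fun z x => tn_ext fun y a b => by simp

theorem hcomp_zero_left {E E' : Kernel X.toEqGerbe Y.toEqGerbe}
    {F F' : Kernel Y.toEqGerbe Z.toEqGerbe} (θ : F ⟶ F') :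
    hcomp (0 : E ⟶ E') θ = 0 := by
  have := hcomp_add_left (0 : E ⟶ E') 0 θ
  rwa [add_zero, left_eq_add] at this

theorem hcomp_zero_right {E E' : Kernel X.toEqGerbe Y.toEqGerbe}
    {F F' : Kernel Y.toEqGerbe Z.toEqGerbe} (η : E ⟶ E') :
    hcomp η (0 : F ⟶ F') = 0 := by
  have := hcomp_add_right η (0 : F ⟶ F') 0
  rwa [add_zero, left_eq_add] at this

/-- Horizontal composites of isomorphisms. -/
def hcompIso {E E' : Kernel X.toEqGerbe Y.toEqGerbe} {F F' : Kernel Y.toEqGerbe Z.toEqGerbe}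
    (η : E ≅ E') (θ : F ≅ F') : comp E F ≅ comp E' F' where
  hom := hcomp η.hom θ.hom
  inv := hcomp η.inv θ.inv
  hom_inv_id := by rw [← hcomp_comp, η.hom_inv_id, θ.hom_inv_id, hcomp_id]
  inv_hom_id := by rw [← hcomp_comp, η.inv_hom_id, θ.inv_hom_id, hcomp_id]

theorem idK_ext' {M : Type*} [AddCommGroup M] [Module ℂ M] {y x : X.pt}
    (f g : (idK X).fib y x →ₗ[ℂ] M) (h : ∀ e : y = x, f (e ▸ idOne y) = g (e ▸ idOne y)) (b) :
    f b = g b := LinearMap.congr_fun (idK_ext h) b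

theorem tn_ext' {E : Kernel X.toEqGerbe Y.toEqGerbe} {F : Kernel Y.toEqGerbe Z.toEqGerbe}
    {z : Z.pt} {x : X.pt} {M : Type*} [AddCommGroup M] [Module ℂ M]
    (f g : (comp E F).fib z x →ₗ[ℂ] M) (h : ∀ y a b, f (tn y a b) = g (tn y a b)) (c) :
    f c = g c := LinearMap.congr_fun (tn_ext h) c

/-- The map `e ⊗ 1 ↦ e` on the diagonal summand. -/
def unitL (E : Kernel X.toEqGerbe Y.toEqGerbe) (y : Y.pt) (x' x : X.pt) :
    E.fib y x' →ₗ[ℂ] (idK X).fib x' x →ₗ[ℂ] E.fib y x :=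
  (idLift fun e : x' = x => (e ▸ LinearMap.id : E.fib y x' →ₗ[ℂ] E.fib y x)).flip

@[simp] theorem unitL_apply (E : Kernel X.toEqGerbe Y.toEqGerbe) (y : Y.pt) (x : X.pt) (a) :
    unitL E y x x a (idOne x) = a := by
  rw [unitL, LinearMap.flip_apply, idLift_idOne]
  rfl

/-- The map `1 ⊗ e ↦ e` on the diagonal summand. -/
def unitR (E : Kernel X.toEqGerbe Y.toEqGerbe) (y y' : Y.pt) (x : X.pt) :
    (idK Y).fib y y' →ₗ[ℂ] E.fib y' x →ₗ[ℂ] E.fib y x :=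
  idLift fun e : y = y' => (e ▸ LinearMap.id : E.fib y' x →ₗ[ℂ] E.fib y x)

@[simp] theorem unitR_apply (E : Kernel X.toEqGerbe Y.toEqGerbe) (y : Y.pt) (x : X.pt) (a) :
    unitR E y y x (idOne y) a = a := by
  rw [unitR, idLift_idOne]
  rfl

/-- Composing with the identity of the source. -/
def unitLeft (E : Kernel X.toEqGerbe Y.toEqGerbe) : comp (idK X) E ≅ E :=
  mkIso
    (fun y x => tlift fun x' => unitL E y x' x)
    (fun y x => (tn x).flip (idOne x))
    (fun y x => tn_ext fun x' a b => by
      simp only [LinearMap.comp_apply, tlift_tn, LinearMap.id_apply]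
      refine idK_ext' ((tn x).flip (idOne x) ∘ₗ unitL E y x' x a) (tn x' a) (fun e => ?_) b
      subst e
      simp)
    (fun y x => LinearMap.ext fun a => by simp)
    (fun {y y' x x'} v u h => LinearMap.ext fun a => by
      simp only [LinearMap.comp_apply, LinearMap.flip_apply]
      rw [comp_act_tn v u h u h rfl, idK_act_idOne])

/-- Composing with the identity of the target. -/
def unitRight (E : Kernel X.toEqGerbe Y.toEqGerbe) : comp E (idK Y) ≅ E :=
  mkIso
    (fun y x => tlift fun y' => unitR E y y' x)
    (fun y x => tn y (idOne y))
    (fun y x => tn_ext fun y' a b => by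
      simp only [LinearMap.comp_apply, tlift_tn, LinearMap.id_apply]
      refine idK_ext' (tn (E := E) y (idOne y) ∘ₗ (unitR E y y' x).flip b) ((tn y').flip b)
        (fun e => ?_) a
      subst e
      simp)
    (fun y x => LinearMap.ext fun a => by simp)
    (fun {y y' x x'} v u h => LinearMap.ext fun a => by
      simp only [LinearMap.comp_apply]
      rw [comp_act_tn v u h v rfl h, idK_act_idOne])

section Assoc

variable (E : Kernel X.toEqGerbe Y.toEqGerbe) (F : Kernel Y.toEqGerbe Z.toEqGerbe)
    (H : Kernel Z.toEqGerbe W.toEqGerbe)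

/-- The map `h ⊗ (f ⊗ e) ↦ (h ⊗ f) ⊗ e`. -/
def assocF (w : W.pt) (z : Z.pt) (x : X.pt) :
    H.fib w z →ₗ[ℂ] (comp E F).fib z x →ₗ[ℂ] (comp E (comp F H)).fib w x :=
  LinearMap.flip (tlift fun y =>
    LinearMap.mk₂ ℂ (fun f e => (tn (E := E) (F := comp F H) y).flip e ∘ₗ (tn z).flip f)
      (fun a a' b => by ext; simp) (fun c a b => by ext; simp)
      (fun a b b' => by ext; simp) (fun c a b => by ext; simp))

@[simp] theorem assocF_apply (w : W.pt) (z : Z.pt) (y : Y.pt) (x : X.pt) (k : H.fib w z)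
    (f : F.fib z y) (e : E.fib y x) :
    assocF E F H w z x k (tn y f e) = tn y (tn z k f) e := by
  simp [assocF]

/-- The map `(h ⊗ f) ⊗ e ↦ h ⊗ (f ⊗ e)`. -/
def assocB (w : W.pt) (y : Y.pt) (x : X.pt) :
    (comp F H).fib w y →ₗ[ℂ] E.fib y x →ₗ[ℂ] (comp (comp E F) H).fib w x :=
  tlift fun z =>
    LinearMap.mk₂ ℂ (fun k f => tn (E := comp E F) (F := H) z k ∘ₗ tn y f)
      (fun a a' b => by ext; simp) (fun c a b => by ext; simp)
      (fun a b b' => by ext; simp) (fun c a b => by ext; simp)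

@[simp] theorem assocB_apply (w : W.pt) (z : Z.pt) (y : Y.pt) (x : X.pt) (k : H.fib w z)
    (f : F.fib z y) (e : E.fib y x) :
    assocB E F H w y x (tn z k f) e = tn z k (tn y f e) := by
  simp [assocB]

/-- Associativity of composition. -/
def associ : comp (comp E F) H ≅ comp E (comp F H) :=
  mkIso
    (fun w x => tlift fun z => assocF E F H w z x)
    (fun w x => tlift fun y => assocB E F H w y x)
    (fun w x => tn_ext fun z k c => by
      simp only [LinearMap.comp_apply, tlift_tn, LinearMap.id_apply]
      refine tn_ext' ((tlift fun y => assocB E F H w y x) ∘ₗ assocF E F H w z x k) (tn z k)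
        (fun y f e => ?_) c
      simp)
    (fun w x => tn_ext fun y c e => by
      simp only [LinearMap.comp_apply, tlift_tn, LinearMap.id_apply]
      refine tn_ext' ((tlift fun z => assocF E F H w z x) ∘ₗ (assocB E F H w y x).flip e)
        ((tn y).flip e) (fun z k f => ?_) c
      simp)
    (fun {w w' x x'} a b h => tn_ext fun y c e => by
      obtain ⟨v, hv⟩ := Y.exists_deg (W.deg a) y
      simp only [LinearMap.comp_apply, tlift_tn]
      rw [comp_act_tn a b h v hv.symm (hv.trans h), tlift_tn]
      refine tn_ext' ((assocB E F H w' _ x').flip (E.act v b (hv.trans h) e) ∘ₗ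
        (comp F H).act a v hv.symm)
        ((comp (comp E F) H).act a b h ∘ₗ (assocB E F H w y x).flip e) (fun z k f => ?_) c
      obtain ⟨t, ht⟩ := Z.exists_deg (W.deg a) z
      simp only [LinearMap.comp_apply, LinearMap.flip_apply]
      rw [comp_act_tn a v hv.symm t ht.symm (ht.trans hv.symm), assocB_apply, assocB_apply,
        comp_act_tn a b h t ht.symm (ht.trans h),
        comp_act_tn t b (ht.trans h) v (ht.trans hv.symm) (hv.trans h)])

end Assoc

end Kernel
end Composition

/-! ### Grothendieck groups -/

section Grothendieck

universe u₁ v₁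

section K0

variable (C : Type u₁) [Category.{v₁} C]

/-- The set of isomorphism classes of objects. -/
def IsoClass : Type u₁ := Quotient (isIsomorphicSetoid C)

variable {C}

/-- The isomorphism class of an object. -/
def isoClass (E : C) : IsoClass C := Quotient.mk (isIsomorphicSetoid C) E

theorem isoClass_eq {E F : C} (e : E ≅ F) : isoClass E = isoClass F :=
  Quotient.sound (s := isIsomorphicSetoid C) ⟨e⟩

/-- Isomorphism invariants factor through isomorphism classes. -/
def isoLift {A : Type*} (f : C → A) (h1 : ∀ {E F : C}, (E ≅ F) → f E = f F) : IsoClass C → A :=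
  Quotient.lift f fun _ _ (h : Nonempty _) => h1 h.some

@[simp] theorem isoLift_isoClass {A : Type*} (f : C → A) (h1 : ∀ {E F : C}, (E ≅ F) → f E = f F)
    (E : C) : isoLift f h1 (isoClass E) = f E := rfl

variable [Preadditive C]

/-- `W` is a direct sum of `E` and `F`. -/
def IsDirectSum (W E F : C) : Prop :=
  ∃ (i₁ : E ⟶ W) (i₂ : F ⟶ W) (p₁ : W ⟶ E) (p₂ : W ⟶ F), i₁ ≫ p₁ = 𝟙 E ∧ i₂ ≫ p₂ = 𝟙 F ∧
    i₁ ≫ p₂ = 0 ∧ i₂ ≫ p₁ = 0 ∧ p₁ ≫ i₁ + p₂ ≫ i₂ = 𝟙 W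

variable (C)

/-- The relations `[E ⊕ F] = [E] + [F]`. -/
def k0Rel : AddSubgroup (FreeAbelianGroup (IsoClass C)) :=
  AddSubgroup.closure {r | ∃ W E F : C, IsDirectSum W E F ∧ r = .of (isoClass W) -
    (.of (isoClass E) + .of (isoClass F))}

/-- The Grothendieck group: the abelian group generated by the isomorphism classes of objects,
subject to the relations `[E ⊕ F] = [E] + [F]`. -/
def K0 : Type u₁ := FreeAbelianGroup (IsoClass C) ⧸ k0Rel C

instance : AddCommGroup (K0 C) := inferInstanceAs (AddCommGroup (_ ⧸ k0Rel C))

variable {C}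

namespace K0

/-- The quotient map. -/
def quot : FreeAbelianGroup (IsoClass C) →+ K0 C := QuotientAddGroup.mk' (k0Rel C)

/-- The class of an object in the Grothendieck group. -/
def mk (E : C) : K0 C := quot (.of (isoClass E))

theorem mk_eq {E F : C} (e : E ≅ F) : mk E = mk F := by rw [mk, isoClass_eq e, mk]

theorem mk_add {W E F : C} (h : IsDirectSum W E F) : mk W = mk E + mk F := by
  rw [mk, mk, mk, ← map_add, ← sub_eq_zero, ← map_sub]
  exact (QuotientAddGroup.eq_zero_iff _).2 (AddSubgroup.subset_closure ⟨W, E, F, h, rfl⟩)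

/-- Additive invariants factor through the Grothendieck group. -/
def lift {A : Type*} [AddCommGroup A] (f : C → A) (h1 : ∀ {E F : C}, (E ≅ F) → f E = f F)
    (h2 : ∀ {W E F : C}, IsDirectSum W E F → f W = f E + f F) : K0 C →+ A :=
  QuotientAddGroup.lift (k0Rel C)
    (FreeAbelianGroup.lift (isoLift f h1))
    ((AddSubgroup.closure_le _).2 (by
      rintro _ ⟨W, E, F, h, rfl⟩
      change FreeAbelianGroup.lift (isoLift f h1) _ = 0
      rw [map_sub, map_add, FreeAbelianGroup.lift_apply_of, FreeAbelianGroup.lift_apply_of,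
        FreeAbelianGroup.lift_apply_of, sub_eq_zero, isoLift_isoClass, isoLift_isoClass,
        isoLift_isoClass]
      exact h2 h))

@[simp] theorem lift_mk {A : Type*} [AddCommGroup A] (f : C → A) (h1) (h2) (E : C) :
    lift f h1 h2 (mk E) = f E :=
  FreeAbelianGroup.lift_apply_of _ _

theorem hom_ext {A : Type*} [AddCommGroup A] {f g : K0 C →+ A} (h : ∀ E, f (mk E) = g (mk E)) :
    f = g := by
  refine QuotientAddGroup.addMonoidHom_ext _ (FreeAbelianGroup.lift_ext _ _ fun q => ?_)
  obtain ⟨E, rfl⟩ := Quotient.exists_rep q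
  exact h E

/-- Biadditive invariants factor through the Grothendieck groups. -/
def lift₂ {D : Type*} [Category D] [Preadditive D] {A : Type*} [AddCommGroup A] (f : C → D → A)
    (h1 : ∀ {E E' : C} (F : D), (E ≅ E') → f E F = f E' F)
    (h2 : ∀ {W E E' : C} (F : D), IsDirectSum W E E' → f W F = f E F + f E' F)
    (h3 : ∀ (E : C) {F F' : D}, (F ≅ F') → f E F = f E F')
    (h4 : ∀ (E : C) {W F F' : D}, IsDirectSum W F F' → f E W = f E F + f E F') :
    K0 C →+ K0 D →+ A :=
  lift (fun E => lift (f E) (h3 E) (h4 E)) (fun e => hom_ext fun F => by simp [h1 F e])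
    (fun h => hom_ext fun F => by simp [h2 F h])

@[simp] theorem lift₂_mk {D : Type*} [Category D] [Preadditive D] {A : Type*} [AddCommGroup A]
    (f : C → D → A) (h1) (h2) (h3) (h4) (E : C) (F : D) :
    lift₂ f h1 h2 h3 h4 (mk E) (mk F) = f E F := by
  simp [lift₂]

end K0

/-- The extension of a biadditive map to complexifications. -/
def extC {A B D : Type*} [AddCommGroup A] [AddCommGroup B] [AddCommGroup D] (f : A →+ B →+ D) :
    ℂ ⊗[ℤ] A →ₗ[ℤ] ℂ ⊗[ℤ] B →ₗ[ℤ] ℂ ⊗[ℤ] D :=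
  TensorProduct.map₂ (LinearMap.mul ℤ ℂ) (LinearMap.mk₂ ℤ (fun a b => f a b) (by simp)
    (by simp) (by simp) (by simp))

@[simp] theorem extC_tmul {A B D : Type*} [AddCommGroup A] [AddCommGroup B] [AddCommGroup D]
    (f : A →+ B →+ D) (c d : ℂ) (a : A) (b : B) :
    extC f (c ⊗ₜ a) (d ⊗ₜ b) = (c * d) ⊗ₜ f a b := rfl

/-- The extension of a biadditive map to a sesquilinear one on complexifications. -/
def sesqC {A B : Type*} [AddCommGroup A] [AddCommGroup B] (f : A →+ B →+ ℂ) :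
    ℂ ⊗[ℤ] A →ₗ[ℤ] ℂ ⊗[ℤ] B →ₗ[ℤ] ℂ :=
  (TensorProduct.map₂ (LinearMap.mk₂ ℤ (fun a b : ℂ => conj a * b) (by simp [add_mul])
    (by simp [mul_assoc]) (by simp [mul_add]) (by simp [mul_left_comm]))
    (LinearMap.mk₂ ℤ (fun a b => f a b) (by simp) (by simp) (by simp) (by simp))).compr₂
      (LinearMap.mul' ℤ ℂ)

@[simp] theorem sesqC_tmul {A B : Type*} [AddCommGroup A] [AddCommGroup B]
    (f : A →+ B →+ ℂ) (c d : ℂ) (a : A) (b : B) :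
    sesqC f (c ⊗ₜ a) (d ⊗ₜ b) = conj c * d * f a b := rfl

section HomDim

variable [Linear ℂ C]

theorem finrank_hom_congr {E E' F F' : C} (e : E ≅ E') (f : F ≅ F') :
    Module.finrank ℂ (E ⟶ F) = Module.finrank ℂ (E' ⟶ F') :=
  LinearEquiv.finrank_eq (Linear.homCongr ℂ e f)

variable [∀ E F : C, FiniteDimensional ℂ (E ⟶ F)]

theorem finrank_hom_left {W E E' : C} (F : C) (h : IsDirectSum W E E') :
    Module.finrank ℂ (W ⟶ F) = Module.finrank ℂ (E ⟶ F) + Module.finrank ℂ (E' ⟶ F) := by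
  obtain ⟨i₁, i₂, p₁, p₂, h1, h2, h3, h4, h5⟩ := h
  rw [← Module.finrank_prod]
  refine LinearEquiv.finrank_eq (LinearEquiv.ofLinearMap
    ((Linear.leftComp ℂ F i₁).prod (Linear.leftComp ℂ F i₂))
    ((Linear.leftComp ℂ F p₁).coprod (Linear.leftComp ℂ F p₂)) ?_ ?_)
  · refine LinearMap.ext fun s => Prod.ext ?_ ?_ <;>
      simp [← Category.assoc, h1, h2, h3, h4]
  · refine LinearMap.ext fun s => ?_
    simp [← Category.assoc, ← Preadditive.add_comp, h5]

theorem finrank_hom_right {W F F' : C} (E : C) (h : IsDirectSum W F F') :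
    Module.finrank ℂ (E ⟶ W) = Module.finrank ℂ (E ⟶ F) + Module.finrank ℂ (E ⟶ F') := by
  obtain ⟨i₁, i₂, p₁, p₂, h1, h2, h3, h4, h5⟩ := h
  rw [← Module.finrank_prod]
  refine LinearEquiv.finrank_eq (LinearEquiv.ofLinearMap
    ((Linear.rightComp ℂ E p₁).prod (Linear.rightComp ℂ E p₂))
    ((Linear.rightComp ℂ E i₁).coprod (Linear.rightComp ℂ E i₂)) ?_ ?_)
  · refine LinearMap.ext fun s => Prod.ext ?_ ?_ <;>
      simp [h1, h2, h3, h4]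
  · refine LinearMap.ext fun s => ?_
    simp [← Preadditive.comp_add, h5]

/-- The biadditive pairing `([E], [F]) = dim Hom(E, F)`. -/
def homDim : K0 C →+ K0 C →+ ℂ :=
  K0.lift₂ (fun E F => (Module.finrank ℂ (E ⟶ F) : ℂ))
    (fun F e => by rw [finrank_hom_congr e (Iso.refl F)])
    (fun F h => by rw [finrank_hom_left F h, Nat.cast_add])
    (fun E _ _ f => by rw [finrank_hom_congr (Iso.refl E) f])
    (fun E _ _ _ h => by rw [finrank_hom_right E h, Nat.cast_add])

end HomDim

variable (C)

/-- The complexified Grothendieck group. -/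
abbrev K0C : Type u₁ := ℂ ⊗[ℤ] K0 C

variable {C}

/-- The class of an object in the complexified Grothendieck group. -/
def K0C.mk (E : C) : K0C C := (1 : ℂ) ⊗ₜ[ℤ] K0.mk E

/-- The inner product on the complexified Grothendieck group: the sesquilinear extension of
`⟨[E], [F]⟩ = dim Hom(E, F)`. -/
def K0C.form [Linear ℂ C] [∀ E F : C, FiniteDimensional ℂ (E ⟶ F)] (a b : K0C C) : ℂ :=
  sesqC homDim a b

end K0

end Grothendieck

/-! ### The Grothendieck category of gerbes -/

section GrothCat

variable {G : Type v} [Group G]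

instance {C : Type*} [SmallCategory C] [Finite C] (E F : C ⥤ FinHilb.{u}) :
    FiniteDimensional ℂ (E ⟶ F) :=
  Module.Finite.of_injective
    ({ toFun := fun η c => FinHilb.lin (η.app c)
       map_add' := fun _ _ => rfl
       map_smul' := fun _ _ => rfl } : (E ⟶ F) →ₗ[ℂ] ∀ c : C, E.obj c →ₗ[ℂ] F.obj c)
    fun _ _ h => NatTrans.ext (funext fun c => FinHilb.hom_ext (congrFun h c))

instance {C : Type*} [SmallCategory C] [Finite C] (P : ObjectProperty (C ⥤ FinHilb.{u}))
    (E F : P.FullSubcategory) : FiniteDimensional ℂ (E ⟶ F) :=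
  Module.Finite.of_injective
    ({ toFun := fun η => η.hom
       map_add' := fun _ _ => rfl
       map_smul' := fun _ _ => rfl } : (E ⟶ F) →ₗ[ℂ] (E.obj ⟶ F.obj))
    fun _ _ h => ObjectProperty.hom_ext _ h

namespace Kernel

variable {X Y Z W : MGerbe.{u} G}

theorem comp_isDirectSum_left {E E₁ E₂ : Kernel X.toEqGerbe Y.toEqGerbe}
    (F : Kernel Y.toEqGerbe Z.toEqGerbe) (h : IsDirectSum E E₁ E₂) :
    IsDirectSum (comp E F) (comp E₁ F) (comp E₂ F) := by
  obtain ⟨i₁, i₂, p₁, p₂, h1, h2, h3, h4, h5⟩ := h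
  refine ⟨hcomp i₁ (𝟙 F), hcomp i₂ (𝟙 F), hcomp p₁ (𝟙 F), hcomp p₂ (𝟙 F), ?_⟩
  simp [← hcomp_comp, ← hcomp_add_left, h1, h2, h3, h4, h5, hcomp_id, hcomp_zero_left]

theorem comp_isDirectSum_right {F F₁ F₂ : Kernel Y.toEqGerbe Z.toEqGerbe}
    (E : Kernel X.toEqGerbe Y.toEqGerbe) (h : IsDirectSum F F₁ F₂) :
    IsDirectSum (comp E F) (comp E F₁) (comp E F₂) := by
  obtain ⟨i₁, i₂, p₁, p₂, h1, h2, h3, h4, h5⟩ := h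
  refine ⟨hcomp (𝟙 E) i₁, hcomp (𝟙 E) i₂, hcomp (𝟙 E) p₁, hcomp (𝟙 E) p₂, ?_⟩
  simp [← hcomp_comp, ← hcomp_add_right, h1, h2, h3, h4, h5, hcomp_id, hcomp_zero_right]

/-- Composition on Grothendieck groups. -/
def compK : K0 (Kernel X.toEqGerbe Y.toEqGerbe) →+ K0 (Kernel Y.toEqGerbe Z.toEqGerbe) →+
    K0 (Kernel X.toEqGerbe Z.toEqGerbe) :=
  K0.lift₂ (fun E F => K0.mk (comp E F))
    (fun F e => K0.mk_eq (hcompIso e (Iso.refl F)))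
    (fun F h => K0.mk_add (comp_isDirectSum_left F h))
    (fun E _ _ f => K0.mk_eq (hcompIso (Iso.refl E) f))
    (fun E _ _ _ h => K0.mk_add (comp_isDirectSum_right E h))

@[simp] theorem compK_mk (E : Kernel X.toEqGerbe Y.toEqGerbe)
    (F : Kernel Y.toEqGerbe Z.toEqGerbe) : compK (K0.mk E) (K0.mk F) = K0.mk (comp E F) :=
  K0.lift₂_mk _ _ _ _ _ E F

theorem compK_id_left (a : K0 (Kernel X.toEqGerbe Y.toEqGerbe)) :
    compK (K0.mk (idK X)) a = a := by
  refine DFunLike.congr_fun (f := compK (K0.mk (idK X))) (g := AddMonoidHom.id _)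
    (K0.hom_ext fun E => ?_) a
  rw [compK_mk, AddMonoidHom.id_apply, K0.mk_eq (unitLeft E)]

theorem compK_id_right (a : K0 (Kernel X.toEqGerbe Y.toEqGerbe)) :
    compK a (K0.mk (idK Y)) = a := by
  refine DFunLike.congr_fun (f := compK.flip (K0.mk (idK Y))) (g := AddMonoidHom.id _)
    (K0.hom_ext fun E => ?_) a
  rw [AddMonoidHom.flip_apply, compK_mk, AddMonoidHom.id_apply, K0.mk_eq (unitRight E)]

theorem compK_assoc (a : K0 (Kernel X.toEqGerbe Y.toEqGerbe))
    (b : K0 (Kernel Y.toEqGerbe Z.toEqGerbe)) (c : K0 (Kernel Z.toEqGerbe W.toEqGerbe)) :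
    compK (compK a b) c = compK a (compK b c) := by
  have h3 : ∀ (E : Kernel X.toEqGerbe Y.toEqGerbe) (F : Kernel Y.toEqGerbe Z.toEqGerbe)
      (c : K0 (Kernel Z.toEqGerbe W.toEqGerbe)), compK (compK (K0.mk E) (K0.mk F)) c = compK (K0.mk E) (compK (K0.mk F) c) := by
    intro E F c
    refine DFunLike.congr_fun (f := compK (compK (K0.mk E) (K0.mk F)))
      (g := (compK (K0.mk E)).comp (compK (K0.mk F))) (K0.hom_ext fun H => ?_) c
    simp [K0.mk_eq (associ E F H)]
  have h2 : ∀ (E : Kernel X.toEqGerbe Y.toEqGerbe)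
      (b : K0 (Kernel Y.toEqGerbe Z.toEqGerbe)), compK (compK (K0.mk E) b) c = compK (K0.mk E) (compK b c) := by
    intro E b
    exact DFunLike.congr_fun (f := (compK.flip c).comp (compK (K0.mk E)))
      (g := (compK (K0.mk E)).comp (compK.flip c)) (K0.hom_ext fun F => h3 E F c) b
  exact DFunLike.congr_fun (f := (compK.flip c).comp (compK.flip b))
      (g := compK.flip (compK b c)) (K0.hom_ext fun E => h2 E b) a

end Kernel

open Kernel

/-- The Grothendieck category of gerbes: its objects are finite equivariant gerbes with metrics,
and its morphisms are isomorphism classes of kernels. -/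
structure GrothCat (G : Type v) [Group G] : Type (max v (u + 1)) where
  of : MGerbe.{u} G

instance : Category (GrothCat.{u} G) where
  Hom X Y := IsoClass (Kernel X.of.toEqGerbe Y.of.toEqGerbe)
  id X := isoClass (idK X.of)
  comp := Quotient.map₂ comp (by
    rintro _ _ ⟨e⟩ _ _ ⟨f⟩
    exact ⟨hcompIso e f⟩)
  id_comp := by
    rintro _ _ ⟨E⟩
    exact isoClass_eq (unitLeft E)
  comp_id := by
    rintro _ _ ⟨E⟩
    exact isoClass_eq (unitRight E)
  assoc := by
    rintro _ _ _ _ ⟨E⟩ ⟨F⟩ ⟨H⟩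
    exact isoClass_eq (associ E F H)

/-- The morphism of the Grothendieck category given by a kernel. -/
def GrothCat.cls {X Y : MGerbe.{u} G} (E : Kernel X.toEqGerbe Y.toEqGerbe) :
    (⟨X⟩ : GrothCat.{u} G) ⟶ ⟨Y⟩ := isoClass E

/-- The complexified Grothendieck category of gerbes: its objects are finite equivariant gerbes
with metrics, and its morphisms are elements of complexified Grothendieck groups of kernels. -/
structure GrothCatC (G : Type v) [Group G] : Type (max v (u + 1)) where
  of : MGerbe.{u} G

theorem extC_smul_left {A B D : Type*} [AddCommGroup A] [AddCommGroup B] [AddCommGroup D]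
    (f : A →+ B →+ D) (r : ℂ) (a : ℂ ⊗[ℤ] A) (b : ℂ ⊗[ℤ] B) :
    extC f (r • a) b = r • extC f a b := by
  induction a with
  | zero => simp
  | add a a' h h' => simp only [smul_add, map_add, LinearMap.add_apply, h, h']
  | tmul c a =>
    induction b with
    | zero => simp
    | add b b' h h' => simp only [smul_add, map_add, h, h']
    | tmul d b => simp [TensorProduct.smul_tmul', mul_assoc]

theorem extC_smul_right {A B D : Type*} [AddCommGroup A] [AddCommGroup B] [AddCommGroup D]
    (f : A →+ B →+ D) (r : ℂ) (a : ℂ ⊗[ℤ] A) (b : ℂ ⊗[ℤ] B) :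
    extC f a (r • b) = r • extC f a b := by
  induction a with
  | zero => simp
  | add a a' h h' => simp only [smul_add, map_add, LinearMap.add_apply, h, h']
  | tmul c a =>
    induction b with
    | zero => simp
    | add b b' h h' => simp only [smul_add, map_add, h, h']
    | tmul d b => simp [TensorProduct.smul_tmul', mul_left_comm]

theorem extC_add_left {A B D : Type*} [AddCommGroup A] [AddCommGroup B] [AddCommGroup D]
    (f : A →+ B →+ D) (a a' : ℂ ⊗[ℤ] A) (b : ℂ ⊗[ℤ] B) :
    extC f (a + a') b = extC f a b + extC f a' b := by
  rw [map_add, LinearMap.add_apply]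

theorem extC_add_right {A B D : Type*} [AddCommGroup A] [AddCommGroup B] [AddCommGroup D]
    (f : A →+ B →+ D) (a : ℂ ⊗[ℤ] A) (b b' : ℂ ⊗[ℤ] B) :
    extC f a (b + b') = extC f a b + extC f a b' := map_add _ _ _

section

variable {X Y Z W : MGerbe.{u} G}

theorem compKC_id_left (f : K0C (Kernel X.toEqGerbe Y.toEqGerbe)) :
    extC compK (K0C.mk (idK X)) f = f := by
  induction f using TensorProduct.induction_on with
  | zero => simp
  | add a b h h' => rw [map_add, h, h']
  | tmul c a => rw [K0C.mk, extC_tmul, one_mul, compK_id_left]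

theorem compKC_id_right (f : K0C (Kernel X.toEqGerbe Y.toEqGerbe)) :
    extC compK f (K0C.mk (idK Y)) = f := by
  induction f using TensorProduct.induction_on with
  | zero => simp
  | add a b h h' => rw [map_add, LinearMap.add_apply, h, h']
  | tmul c a => rw [K0C.mk, extC_tmul, mul_one, compK_id_right]

theorem compKC_assoc (f : K0C (Kernel X.toEqGerbe Y.toEqGerbe))
    (g : K0C (Kernel Y.toEqGerbe Z.toEqGerbe)) (k : K0C (Kernel Z.toEqGerbe W.toEqGerbe)) :
    extC compK (extC compK f g) k = extC compK f (extC compK g k) := by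
  induction f using TensorProduct.induction_on with
  | zero => simp
  | add a b h h' => simp only [map_add, LinearMap.add_apply, h, h']
  | tmul c a =>
    induction g using TensorProduct.induction_on with
    | zero => simp
    | add a b h h' => simp only [map_add, LinearMap.add_apply, h, h']
    | tmul d b =>
      induction k using TensorProduct.induction_on with
      | zero => simp
      | add a b h h' => simp only [map_add, h, h']
      | tmul e b => simp [compK_assoc, mul_assoc]

end

instance : Category (GrothCatC.{u} G) where
  Hom X Y := K0C (Kernel X.of.toEqGerbe Y.of.toEqGerbe)
  id X := K0C.mk (idK X.of)
  comp f g := extC compK f g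
  id_comp f := compKC_id_left f
  comp_id f := compKC_id_right f
  assoc f g k := compKC_assoc f g k

instance : Preadditive (GrothCatC.{u} G) where
  homGroup X Y := inferInstanceAs (AddCommGroup (K0C (Kernel X.of.toEqGerbe Y.of.toEqGerbe)))
  add_comp _ _ _ f f' g := extC_add_left compK f f' g
  comp_add _ _ _ f g g' := extC_add_right compK f g g'

instance : Linear ℂ (GrothCatC.{u} G) where
  homModule X Y := inferInstanceAs (Module ℂ (K0C (Kernel X.of.toEqGerbe Y.of.toEqGerbe)))
  smul_comp _ _ _ r f g := extC_smul_left compK r f g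
  comp_smul _ _ _ f r g := extC_smul_right compK r f g

/-- The morphism of the complexified Grothendieck category given by a kernel. -/
def GrothCatC.cls {X Y : MGerbe.{u} G} (E : Kernel X.toEqGerbe Y.toEqGerbe) :
    (⟨X⟩ : GrothCatC.{u} G) ⟶ ⟨Y⟩ := K0C.mk E

end GrothCat

/-! ### Loop groupoids and their unitary representations -/

/-- The loop groupoid of the action groupoid of a `G`-set `S`: its objects are pairs of an element
`g` of `G` and a fixed point of `g`, and an arrow `(x, g) ⟶ (x', g')` is an element `h` of `G`
with `h • x = x'` and `h * g * h⁻¹ = g'`. -/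
structure LoopPt (G : Type v) [Group G] (S : Type w) [MulAction G S] : Type (max v w) where
  pt : S
  elt : G
  fix : elt • pt = pt

/-- The loop groupoid of `BG`: its objects are the elements of `G`, and an arrow `g ⟶ g'` is an
element `h` of `G` with `h * g * h⁻¹ = g'`. -/
structure LoopBG (G : Type v) : Type v where
  elt : G

section Loop

variable {G : Type v} [Group G]

theorem conj_comp {a b c h h' : G} (e : h * a * h⁻¹ = b) (e' : h' * b * h'⁻¹ = c) :
    h' * h * a * (h' * h)⁻¹ = c := by
  rw [← e', ← e]
  group

theorem conj_inv {a b h : G} (e : h * a * h⁻¹ = b) : h⁻¹ * b * h⁻¹⁻¹ = a := by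
  rw [← e]
  group

instance (S : Type w) [MulAction G S] : Groupoid (LoopPt G S) where
  Hom p q := {h : G // h • p.pt = q.pt ∧ h * p.elt * h⁻¹ = q.elt}
  id p := ⟨1, by simp⟩
  comp f f' := ⟨f'.1 * f.1, by rw [mul_smul, f.2.1, f'.2.1],
    conj_comp f.2.2 f'.2.2⟩
  inv f := ⟨f.1⁻¹, inv_smul_eq_iff.2 f.2.1.symm, conj_inv f.2.2⟩
  id_comp f := Subtype.ext (mul_one f.1)
  comp_id f := Subtype.ext (one_mul f.1)
  assoc f f' f'' := Subtype.ext (mul_assoc f''.1 f'.1 f.1).symm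
  inv_comp f := Subtype.ext (mul_inv_cancel f.1)
  comp_inv f := Subtype.ext (inv_mul_cancel f.1)

instance : Groupoid (LoopBG G) where
  Hom p q := {h : G // h * p.elt * h⁻¹ = q.elt}
  id p := ⟨1, by simp⟩
  comp f f' := ⟨f'.1 * f.1, conj_comp f.2 f'.2⟩
  inv f := ⟨f.1⁻¹, conj_inv f.2⟩
  id_comp f := Subtype.ext (mul_one f.1)
  comp_id f := Subtype.ext (one_mul f.1)
  assoc f f' f'' := Subtype.ext (mul_assoc f''.1 f'.1 f.1).symm
  inv_comp f := Subtype.ext (mul_inv_cancel f.1)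
  comp_inv f := Subtype.ext (inv_mul_cancel f.1)

/-- The category of unitary vector bundles over a groupoid, i.e. of functors to Hilbert spaces which
send all arrows to unitary maps, with all natural transformations as morphisms. -/
abbrev UnitaryRep (C : Type w) [Category.{v} C] : Type (max (max (max v (u + 1)) w) u) :=
  ObjectProperty.FullSubcategory (C := C ⥤ FinHilb.{u})
    (fun E => ∀ {c d : C} (f : c ⟶ d), FinHilb.IsUnitary (E.map f))

namespace UnitaryRep

/-- Functors out of a groupoid which preserve inner products are unitary. -/
theorem isUnitary_of_inner {C : Type w} [Groupoid.{v} C] (E : C ⥤ FinHilb.{u})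
    (h : ∀ {c d : C} (f : c ⟶ d) (a b : E.obj c),
      inner ℂ (FinHilb.lin (E.map f) a) (FinHilb.lin (E.map f) b) = inner ℂ a b)
    {c d : C} (f : c ⟶ d) : FinHilb.IsUnitary (E.map f) := by
  refine ⟨h f, ?_⟩
  have h1 := congrArg FinHilb.lin (E.map_comp f (Groupoid.inv f))
  have h2 := congrArg FinHilb.lin (E.map_comp (Groupoid.inv f) f)
  rw [Groupoid.comp_inv, CategoryTheory.Functor.map_id] at h1
  rw [Groupoid.inv_comp, CategoryTheory.Functor.map_id] at h2
  exact Function.bijective_iff_has_inverse.2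
    ⟨_, fun a => (LinearMap.congr_fun h1 a).symm, fun a => (LinearMap.congr_fun h2 a).symm⟩

variable {C : Type w} [Category.{v} C]

/-- The fiber of a bundle. -/
abbrev fiber (L : UnitaryRep.{u} C) (c : C) : FinHilb.{u} := L.obj.obj c

/-- Parallel transport along an arrow. -/
abbrev tr (L : UnitaryRep.{u} C) {c d : C} (f : c ⟶ d) : L.fiber c →ₗ[ℂ] L.fiber d :=
  FinHilb.lin (L.obj.map f)

/-- The component of a morphism of bundles. -/
abbrev component {L M : UnitaryRep.{u} C} (f : L ⟶ M) (c : C) : L.fiber c →ₗ[ℂ] M.fiber c :=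
  FinHilb.lin (f.hom.app c)

/-- The space of flat sections of a bundle. -/
def Flat (L : UnitaryRep.{u} C) : Submodule ℂ (∀ c, L.fiber c) where
  carrier := {s | ∀ {c d : C} (f : c ⟶ d), L.tr f (s c) = s d}
  add_mem' hs ht _ _ f := by
    rw [Pi.add_apply, Pi.add_apply, map_add, hs f, ht f]
  zero_mem' {_ _} f := map_zero _
  smul_mem' r _ hs _ _ f := by
    rw [Pi.smul_apply, Pi.smul_apply, map_smul, hs f]

/-- The number of arrows out of an object. -/
def numArrows (c : C) : ℕ := Nat.card (Σ d, c ⟶ d)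

/-- The inner product `∑ c, ⟨s c, t c⟩ / |c →|` of sections over a finite groupoid. -/
def flatInner (L : UnitaryRep.{u} C) (s t : L.Flat) : ℂ :=
  ∑ᶠ c : C, inner ℂ (s.1 c) (t.1 c) / (numArrows c : ℂ)

/-- The inner product `∑ c, Tr (f_c† ∘ f'_c) / |c →|` of morphisms of bundles over a finite
groupoid. -/
def homInner {L M : UnitaryRep.{u} C} (f f' : L ⟶ M) : ℂ :=
  ∑ᶠ c : C, LinearMap.trace ℂ (L.fiber c)
    (LinearMap.adjoint (component f c) ∘ₗ component f' c) / (numArrows c : ℂ)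

end UnitaryRep

/-! ### Push-forward to `ΛBG` -/

/-- The category of unitary conjugation equivariant vector bundles over `G`. -/
abbrev HilbG (G : Type v) [Group G] : Type (max v (u + 1)) := UnitaryRep.{u} (LoopBG G)

section Push

variable {S : Type u} [MulAction G S]

/-- The fixed points of `g`. -/
abbrev Fix (S : Type u) [MulAction G S] (g : G) : Type u := {x : S // g • x = x}

/-- A fixed point of `g` as an object of the loop groupoid. -/
abbrev Fix.loop {g : G} (x : Fix S g) : LoopPt G S := ⟨x.1, g, x.2⟩

/-- The image of a fixed point of `g` under `h`, a fixed point of `h * g * h⁻¹`. -/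
def Fix.move {p q : LoopBG G} (h : p ⟶ q) (x : Fix S p.elt) : Fix S q.elt :=
  ⟨h.1 • x.1, by
    have e : q.elt = h.1 * p.elt * h.1⁻¹ := h.2.symm
    refine (congrArg (· • h.1 • x.1) e).trans ?_
    rw [mul_smul, mul_smul, inv_smul_smul, x.2]⟩

/-- The arrow `h : (x, g) ⟶ (h • x, h * g * h⁻¹)`. -/
def Fix.arrow {p q : LoopBG G} (h : p ⟶ q) (x : Fix S p.elt) : x.loop ⟶ (x.move h).loop :=
  ⟨h.1, rfl, h.2⟩

variable [Finite S] (k : S → PosReal) (L : UnitaryRep.{u} (LoopPt G S))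

/-- The fiber of the push-forward: the space of sections of `L` over the fixed points of `g`,
weighted by the metric. -/
abbrev PushFib (g : G) : Type u :=
  WSum (fun x : Fix S g => k x.1) fun x => L.fiber x.loop

/-- The action `(h ψ) (h x) = L(h) (ψ x)` on the push-forward. -/
def pushMap {p q : LoopBG G} (h : p ⟶ q) : PushFib k L p.elt →ₗ[ℂ] PushFib k L q.elt :=
  WSum.lift fun x => WSum.single (x.move h) ∘ₗ L.tr (x.arrow h)

theorem pushMap_single {p q : LoopBG G} (h : p ⟶ q) (x : Fix S p.elt) (y : Fix S q.elt)
    (f : x.loop ⟶ y.loop) (hf : f.1 = h.1) (a : L.fiber x.loop) :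
    pushMap k L h (WSum.single x a) = WSum.single y (L.tr f a) := by
  obtain rfl : x.move h = y := Subtype.ext ((congrArg (· • x.1) hf.symm).trans f.2.1)
  obtain rfl : f = x.arrow h := Subtype.ext hf
  rw [pushMap, WSum.lift_single, LinearMap.comp_apply]

/-- The functor underlying the push-forward. -/
def pushFunctor : LoopBG G ⥤ FinHilb.{u} where
  obj p := ⟨PushFib k L p.elt⟩
  map h := FinHilb.ofLin (pushMap k L h)
  map_id p := FinHilb.hom_ext (WSum.hom_ext fun x => LinearMap.ext fun a => by
    refine (pushMap_single k L (𝟙 p) x x (𝟙 _) rfl a).trans ?_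
    rw [UnitaryRep.tr, CategoryTheory.Functor.map_id]
    rfl)
  map_comp {p q r} h h' := FinHilb.hom_ext (WSum.hom_ext fun x => LinearMap.ext fun a => by
    refine (pushMap_single k L (h ≫ h') x ((x.move h).move h')
      (x.arrow h ≫ (x.move h).arrow h') rfl a).trans ?_
    refine Eq.trans ?_ (congrArg (pushMap k L h') (pushMap_single k L h x (x.move h)
      (x.arrow h) rfl a)).symm
    rw [pushMap_single k L h' (x.move h) ((x.move h).move h') ((x.move h).arrow h') rfl,
      UnitaryRep.tr, CategoryTheory.Functor.map_comp]
    rfl)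

/-- The push-forward `π_* L` of a unitary bundle over the loop groupoid of a finite `G`-set with an
invariant metric `k`. -/
def pushforward (hk : ∀ (g : G) (x : S), k (g • x) = k x) : HilbG.{u} G where
  obj := pushFunctor k L
  property := UnitaryRep.isUnitary_of_inner _ fun h a b =>
    WSum.inner_of_single (pushMap k L h) (fun x => x.move h)
      (fun _ _ e => Subtype.ext (MulAction.injective h.1 (congrArg Subtype.val e)))
      (fun x => hk h.1 x.1) (fun x => L.tr (x.arrow h))
      (fun x a b => (L.property (x.arrow h)).inner_map a b)
      (fun x a => pushMap_single k L h x _ (x.arrow h) rfl a) a b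

end Push

/-! ### Transgression -/

namespace EqGerbe

variable (X : EqGerbe.{u} G)

/-- The torsor of arrows of a gerbe lying over a loop. -/
def Loops (p : LoopPt G X.pt) : Type u := X.Over p.elt p.pt p.pt

instance (p : LoopPt G X.pt) : CircleTorsor (X.Loops p) := X.loopTorsor p.elt p.pt p.fix

variable {X}

/-- Conjugation `u ↦ v u v⁻¹` by an arrow `v`. -/
def conjBy {p q : LoopPt G X.pt} (h : p ⟶ q) (v : p.pt ⟶ q.pt) (hv : X.deg v = h.1)
    (u : X.Loops p) : X.Loops q :=
  ⟨Groupoid.inv v ≫ u.1 ≫ v, by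
    rw [X.deg_comp, X.deg_comp, deg_inv, u.2, hv, h.2.2]⟩

/-- Parallel transport of the transgressed torsor: `u ↦ v u v⁻¹` for any arrow `v` over `h`. -/
def conjLoop {p q : LoopPt G X.pt} (h : p ⟶ q) (u : X.Loops p) : X.Loops q :=
  conjBy h (X.exists_arrow h.1 p.pt q.pt h.2.1).choose
    (X.exists_arrow h.1 p.pt q.pt h.2.1).choose_spec u

theorem smul_val {p : LoopPt G X.pt} (z : Circle) (u : X.Loops p) :
    (z • u).1 = X.rot z u.1 := rfl

/-- Parallel transport does not depend on the choice of `v`. -/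
theorem conjLoop_eq {p q : LoopPt G X.pt} (h : p ⟶ q) (v : p.pt ⟶ q.pt) (hv : X.deg v = h.1)
    (u : X.Loops p) : conjLoop h u = conjBy h v hv u := by
  obtain ⟨z, hz⟩ := exists_rot v (X.exists_arrow h.1 p.pt q.pt h.2.1).choose
    (hv.trans (X.exists_arrow h.1 p.pt q.pt h.2.1).choose_spec.symm)
  refine Subtype.ext ?_
  change Groupoid.inv _ ≫ u.1 ≫ _ = Groupoid.inv v ≫ u.1 ≫ v
  rw [← cancel_epi (X.exists_arrow h.1 p.pt q.pt h.2.1).choose, ← Category.assoc,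
    Groupoid.comp_inv, Category.id_comp, ← hz, comp_rot, rot_comp, ← Category.assoc v,
    Groupoid.comp_inv, Category.id_comp]

theorem conjLoop_smul {p q : LoopPt G X.pt} (h : p ⟶ q) (z : Circle) (u : X.Loops p) :
    conjLoop h (z • u) = z • conjLoop h u := by
  refine Subtype.ext ?_
  change Groupoid.inv _ ≫ X.rot z u.1 ≫ _ = X.rot z (Groupoid.inv _ ≫ u.1 ≫ _)
  rw [rot_comp, comp_rot]

variable (X)

/-- The functor underlying the transgressed line bundle. -/
def transgressionFunctor : LoopPt G X.pt ⥤ FinHilb.{u} where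
  obj p := ⟨TorsorLine (X.Loops p)⟩
  map h := FinHilb.ofLin (TorsorLine.map (conjLoop h))
  map_id p := FinHilb.hom_ext (LinearMap.ext fun a => by
    rw [← TorsorLine.tmul_coord (TorsorLine.base _) a]
    refine (TorsorLine.map_tmul _ (conjLoop_smul _) _ _).trans ?_
    rw [conjLoop_eq (𝟙 p) (𝟙 p.pt) (X.deg_id p.pt)]
    refine congrArg (fun u => TorsorLine.tmul u _) (Subtype.ext ?_)
    change Groupoid.inv (𝟙 _) ≫ _ ≫ 𝟙 _ = _
    simp)
  map_comp {p q r} h h' := FinHilb.hom_ext (LinearMap.ext fun a => by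
    rw [← TorsorLine.tmul_coord (TorsorLine.base _) a]
    refine (TorsorLine.map_tmul _ (conjLoop_smul _) _ _).trans ?_
    refine Eq.trans ?_ (congrArg (TorsorLine.map (conjLoop h'))
      (TorsorLine.map_tmul _ (conjLoop_smul h) _ _)).symm
    rw [TorsorLine.map_tmul _ (conjLoop_smul h')]
    obtain ⟨v, hv⟩ := X.exists_arrow h.1 p.pt q.pt h.2.1
    obtain ⟨v', hv'⟩ := X.exists_arrow h'.1 q.pt r.pt h'.2.1
    rw [conjLoop_eq (h ≫ h') (v ≫ v') (by rw [X.deg_comp, hv, hv']; rfl), conjLoop_eq h v hv,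
      conjLoop_eq h' v' hv']
    refine congrArg (fun u => TorsorLine.tmul u _) (Subtype.ext ?_)
    change Groupoid.inv (v ≫ v') ≫ _ ≫ v ≫ v' = Groupoid.inv v' ≫ (Groupoid.inv v ≫ _ ≫ v) ≫ v'
    simp)

/-- The transgressed line bundle of an equivariant gerbe. -/
def transgression : UnitaryRep.{u} (LoopPt G X.pt) where
  obj := X.transgressionFunctor
  property := UnitaryRep.isUnitary_of_inner _ fun {p q} h a b => by
    rw [← TorsorLine.tmul_coord (TorsorLine.base _) a,
      ← TorsorLine.tmul_coord (TorsorLine.base _) b]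
    change inner ℂ (TorsorLine.map (conjLoop h) _) (TorsorLine.map (conjLoop h) _) = _
    rw [TorsorLine.map_tmul _ (conjLoop_smul h), TorsorLine.map_tmul _ (conjLoop_smul h),
      TorsorLine.inner_tmul]
    refine Eq.trans ?_ (TorsorLine.inner_tmul _ _ _ _).symm
    simp

end EqGerbe

/-- The geometric character of a finite equivariant gerbe with a metric: the push-forward of its
transgressed line bundle. -/
def chObj (X : MGerbe.{u} G) : HilbG.{u} G := pushforward X.k X.transgression X.k_smul

end Loop

/-! ### Characters -/

section Characters

variable {G : Type v} [Group G]

namespace EqGerbe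

variable {X : EqGerbe.{u} G}

/-- The vector `u ⊗ a` of the transgressed line at a loop. -/
def loopVec {p : LoopPt G X.pt} (u : X.Loops p) (a : ℂ) : X.transgression.fiber p :=
  TorsorLine.tmul u a

/-- The coordinate with respect to `u` on the transgressed line at a loop: it sends `u ⊗ a`
to `a`. -/
def loopCoord {p : LoopPt G X.pt} (u : X.Loops p) : X.transgression.fiber p →ₗ[ℂ] ℂ :=
  (TorsorLine.coord u).toLinearMap

/-- The section `s` is the twisted character of the bundle `E`: it sends a loop to
`u ⊗ conj (Tr E(u))`, for any arrow `u` over the loop. -/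
def IsTwistedChar (E : Bundle X) (s : X.transgression.Flat) : Prop :=
  ∀ (p : LoopPt G X.pt) (u : X.Loops p),
    s.1 p = loopVec u (conj (LinearMap.trace ℂ _ (FinHilb.lin (E.obj.map u.1))))

/-- A simultaneous fixed point as a loop in `Y ⊗ X̄`. -/
abbrev pairLoop {Y X : EqGerbe.{u} G} {g : G} (y : Fix Y.pt g) (x : Fix X.pt g) :
    LoopPt G (Y.ker X).pt :=
  ⟨kpt y.1 x.1, g, TensorPt.ext' y.2 x.2⟩

/-- The arrow `v ⊗ ū` of `Y ⊗ X̄` over a simultaneous fixed point. -/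
def pairArrow {Y X : EqGerbe.{u} G} {g : G} {y : Fix Y.pt g} {x : Fix X.pt g}
    (v : Y.Loops y.loop) (u : X.Loops x.loop) : (Y.ker X).Loops (pairLoop y x) :=
  ⟨kArr v.1 u.1 (v.2.trans u.2.symm), (deg_kArr _ _ _).trans v.2⟩

end EqGerbe

open EqGerbe

/-- The unit vector `(1 / √k x) u` of the fiber of the geometric character at `g`, localized over
the fixed point `x`. -/
def locVec {X : MGerbe.{u} G} {g : G} (x : Fix X.pt g) (u : X.Loops x.loop) :
    (chObj X).fiber ⟨g⟩ :=
  WSum.single (wt := fun x : Fix X.pt g => X.k x.1)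
    (V := fun x : Fix X.pt g => X.transgression.fiber x.loop) x
    (loopVec u (1 / (Real.sqrt (X.k x.1) : ℂ)))

/-- The value at a fixed point `x` of an element of the fiber of the geometric character. -/
def evalAt {X : MGerbe.{u} G} {g : G} (x : Fix X.pt g) :
    (chObj X).fiber ⟨g⟩ →ₗ[ℂ] X.transgression.fiber x.loop :=
  WSum.proj (wt := fun x : Fix X.pt g => X.k x.1)
    (V := fun x : Fix X.pt g => X.transgression.fiber x.loop) x

variable {X Y : MGerbe.{u} G}

/-- The morphism `f` is the geometric character of the kernel `E`: its matrix elements between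
localized unit vectors are `⟨φ_y, f_g ψ_x⟩ = conj (Tr E(v ⊗ ū))`. -/
def IsGeometricChar (E : Kernel X.toEqGerbe Y.toEqGerbe) (f : chObj X ⟶ chObj Y) : Prop :=
  ∀ (g : G) (x : Fix X.pt g) (y : Fix Y.pt g) (u : X.Loops x.loop) (v : Y.Loops y.loop),
    inner ℂ (locVec y v) (UnitaryRep.component f ⟨g⟩ (locVec x u)) =
      conj (LinearMap.trace ℂ _ (FinHilb.lin (E.obj.map (pairArrow v u).1)))

/-- The morphism `f` is the rearrangement of the flat section `ξ`: if the value of `ξ` at the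
simultaneous fixed point `(y, x)` of `g` is `v ⊗ ū ⊗ c`, then the component of `f_g` from `x` to
`y` sends `(1 / √k x) u` to `(1 / √k y) v ⊗ c`. -/
def IsRearrangement (ξ : (Y.ker X.toEqGerbe).transgression.Flat) (f : chObj X ⟶ chObj Y) : Prop :=
  ∀ (g : G) (x : Fix X.pt g) (y : Fix Y.pt g) (u : X.Loops x.loop) (v : Y.Loops y.loop),
    evalAt y (UnitaryRep.component f ⟨g⟩ (locVec x u)) =
      loopVec v (1 / (Real.sqrt (Y.k y.1) : ℂ) * loopCoord (pairArrow v u) (ξ.1 (pairLoop y x)))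

end Characters

end GerbeChar

end

open GerbeChar

noncomputable section

namespace GerbeChar

/-! ### Traces -/

section Trace

/-! The proof writes morphisms as matrices and then does character theory for gerbes.

Matrices. Over each `g` the vectors `locVec x u`, with one arrow `u` chosen for each fixed point
`x`, form an orthonormal basis of the fibre of `chObj X`; their factor `1 / √k` compensates for the
weight `k`. A morphism `chObj X ⟶ chObj Y` is thus determined by its matrix elements `matEl`. These
are numbers attached to a loop `((y, x), g)` of `Y ⊗ X̄` and to arrows `v`, `u` over it. They change
under phases of `v` and `u` exactly as the coordinates of a section of the transgressed line do, and
equivariance under `G` is exactly flatness. Hence the rearrangement `hatEquiv` of flat sections into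
morphisms is bijective. It is isometric (`homInner_hat`) because all objects of both loop groupoids
have `|G|` outgoing arrows. The character of a kernel is the rearrangement of its twisted character,
so existence and uniqueness of `ch(E)` follow.

Functoriality. An arrow acts on `⨁_y F ⊗ E` by permuting the summands, and only the fixed points `y`
contribute to the trace, each by a product of traces (`trace_comp_act`). This is matrix
multiplication in the orthonormal basis of `chObj Y` (`matEl_comp`). Traces do not see the weights
`1 / k`.

The twisted character is isometric: averaging over `G` projects all families of maps `E_x → F_x`
onto the natural ones, and the trace of this projection is both `dim Hom(E, F)` and the inner
product of the characters (`flatInner_twChar`). It is injective: unitarity makes bundles semisimple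
(`Bundle.induction`), so irreducible classes span the complexified Grothendieck group (`span_irr`),
and by Schur's lemma their characters are orthonormal. It is surjective: a flat section `ξ` acts on
all bundles by natural endomorphisms (`flatOp`), whose total trace on `E` is a multiple of its inner
product with the character of `E`. If `ξ` is orthogonal to all characters, it acts by zero on
irreducible bundles and hence on all bundles (`flatOp_eq_zero`). The regular bundle recovers `ξ`
from its action (`regEval_flatOp`), so `ξ = 0`.

The complexified functor is the composite of the two isometric isomorphisms on hom-sets, which makes
it unitarily fully faithful. -/

/-- The trace of an endomorphism of a finite product is the sum of the traces of its diagonal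
blocks. -/
theorem trace_pi {ι : Type*} [Fintype ι] [DecidableEq ι] {M : ι → Type*}
    [∀ i, AddCommGroup (M i)] [∀ i, Module ℂ (M i)] [∀ i, FiniteDimensional ℂ (M i)]
    (T : (∀ i, M i) →ₗ[ℂ] ∀ i, M i) :
    LinearMap.trace ℂ _ T =
      ∑ i, LinearMap.trace ℂ (M i) (LinearMap.proj i ∘ₗ T ∘ₗ LinearMap.single ℂ M i) := by
  -- Inserting the resolution of the identity on the right lets cyclicity move each projection to
  -- the front, which leaves a diagonal block.
  have h : T = ∑ i, (T ∘ₗ LinearMap.single ℂ M i) ∘ₗ LinearMap.proj i := by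
    refine LinearMap.ext fun a => ?_
    simp only [LinearMap.sum_apply, LinearMap.comp_apply, ← map_sum]
    congr 1
    exact (Finset.univ_sum_single a).symm
  conv_lhs => rw [h]
  rw [map_sum]
  exact Finset.sum_congr rfl fun i _ => LinearMap.trace_comp_comm' _ _

/-- The weights enter the inner product only, so the trace is that of the unweighted direct sum and
the argument of `trace_pi` applies. -/
theorem WSum.trace_eq_sum {ι : Type v} [Fintype ι] {wt : ι → PosReal} {V : ι → Type w}
    [∀ i, NormedAddCommGroup (V i)] [∀ i, InnerProductSpace ℂ (V i)]
    [∀ i, FiniteDimensional ℂ (V i)] (T : WSum wt V →ₗ[ℂ] WSum wt V) :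
    LinearMap.trace ℂ _ T =
      ∑ i, LinearMap.trace ℂ (V i) (WSum.proj i ∘ₗ T ∘ₗ WSum.single i) := by
  have h : T = ∑ i, (T ∘ₗ WSum.single i) ∘ₗ WSum.proj i := by
    refine LinearMap.ext fun a => ?_
    simp only [LinearMap.sum_apply, LinearMap.comp_apply, ← map_sum, WSum.sum_single_proj]
  conv_lhs => rw [h]
  rw [map_sum]
  exact Finset.sum_congr rfl fun i _ => LinearMap.trace_comp_comm' _ _

/-- The map `f ↦ A ∘ f ∘ B` between spaces of linear maps. -/
def sandwich {V V' W W' : Type*} [AddCommGroup V] [Module ℂ V] [AddCommGroup V'] [Module ℂ V']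
    [AddCommGroup W] [Module ℂ W] [AddCommGroup W'] [Module ℂ W'] (A : W →ₗ[ℂ] W')
    (B : V' →ₗ[ℂ] V) : (V →ₗ[ℂ] W) →ₗ[ℂ] (V' →ₗ[ℂ] W') where
  toFun f := A ∘ₗ f ∘ₗ B
  map_add' f g := by rw [LinearMap.add_comp, LinearMap.comp_add]
  map_smul' c f := by rw [LinearMap.smul_comp, LinearMap.comp_smul, RingHom.id_apply]

/-- Under `Hom(V, W) ≅ V* ⊗ W` the map `f ↦ A f B` becomes `Bᵀ ⊗ A`, and the trace of a tensor
product is the product of the traces. This is the source of products of characters in the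
orthogonality relations. -/
theorem trace_sandwich {V W : Type*} [AddCommGroup V] [Module ℂ V] [FiniteDimensional ℂ V]
    [AddCommGroup W] [Module ℂ W] [FiniteDimensional ℂ W] (A : W →ₗ[ℂ] W) (B : V →ₗ[ℂ] V) :
    LinearMap.trace ℂ _ (sandwich A B) = LinearMap.trace ℂ _ A * LinearMap.trace ℂ _ B := by
  have h : sandwich A B = (dualTensorHomEquiv ℂ V W).conj
      (TensorProduct.map (Module.Dual.transpose (R := ℂ) B) A) := by
    rw [LinearEquiv.conj_apply]
    rw [LinearEquiv.eq_comp_toLinearMap_symm]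
    refine TensorProduct.ext' fun f w => LinearMap.ext fun a => ?_
    simp [sandwich, dualTensorHomEquiv]
    rfl
  rw [h, LinearMap.trace_conj', LinearMap.trace_tensorProduct', LinearMap.trace_transpose',
    mul_comm]

theorem trace_adjoint {V : Type*} [NormedAddCommGroup V] [InnerProductSpace ℂ V]
    [FiniteDimensional ℂ V] (A : V →ₗ[ℂ] V) :
    LinearMap.trace ℂ V (LinearMap.adjoint A) = conj (LinearMap.trace ℂ V A) := by
  rw [LinearMap.trace_eq_sum_inner _ (stdOrthonormalBasis ℂ V),
    LinearMap.trace_eq_sum_inner _ (stdOrthonormalBasis ℂ V), map_sum]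
  refine Finset.sum_congr rfl fun i _ => ?_
  rw [LinearMap.adjoint_inner_right, inner_conj_symm]

/-- By cyclicity `A` meets `B` on the other side, so a one-sided inverse is enough. -/
theorem trace_conj_eq {V W : Type*} [AddCommGroup V] [Module ℂ V] [FiniteDimensional ℂ V]
    [AddCommGroup W] [Module ℂ W] [FiniteDimensional ℂ W] (A : V →ₗ[ℂ] W) (B : W →ₗ[ℂ] V)
    (h : A ∘ₗ B = LinearMap.id) (f : W →ₗ[ℂ] W) :
    LinearMap.trace ℂ _ (B ∘ₗ f ∘ₗ A) = LinearMap.trace ℂ _ f := by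
  rw [LinearMap.trace_comp_comm', LinearMap.comp_assoc, h, LinearMap.comp_id]

end Trace

/-! ### The semisimplicity of the category of bundles -/

section Semisimple

variable {G : Type v} [Group G]

namespace Bundle

variable {X : EqGerbe.{u} G}

/-- The fiber of a bundle. -/
abbrev fib (E : Bundle X) (x : X.pt) : FinHilb.{u} := E.obj.obj x

/-- The action of an arrow on the fibers of a bundle. -/
def act (E : Bundle X) {x y : X.pt} (f : x ⟶ y) : fib E x →ₗ[ℂ] fib E y :=
  FinHilb.lin (E.obj.map f)

/-- The component of a morphism of bundles. -/
def app {E F : Bundle X} (η : E ⟶ F) (x : X.pt) : fib E x →ₗ[ℂ] fib F x :=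
  FinHilb.lin (η.hom.app x)

@[simp] theorem act_id (E : Bundle X) (x : X.pt) : act E (𝟙 x) = LinearMap.id :=
  congrArg FinHilb.lin (E.obj.map_id x)

theorem act_comp (E : Bundle X) {x y z : X.pt} (f : x ⟶ y) (f' : y ⟶ z) :
    act E (f ≫ f') = act E f' ∘ₗ act E f :=
  congrArg FinHilb.lin (E.obj.map_comp f f')

theorem act_rot (E : Bundle X) {x y : X.pt} (z : Circle) (f : x ⟶ y) :
    act E (X.rot z f) = (z : ℂ) • act E f :=
  congrArg FinHilb.lin (E.property.map_rot z f)

theorem act_inner (E : Bundle X) {x y : X.pt} (f : x ⟶ y) (a b : fib E x) :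
    inner ℂ (act E f a) (act E f b) = inner ℂ a b :=
  (E.property.unitary f).inner_map a b

@[simp] theorem act_inv_act (E : Bundle X) {x y : X.pt} (f : x ⟶ y) (a : fib E x) :
    act E (Groupoid.inv f) (act E f a) = a := by
  rw [← LinearMap.comp_apply, ← act_comp, Groupoid.comp_inv, act_id, LinearMap.id_apply]

@[simp] theorem act_act_inv (E : Bundle X) {x y : X.pt} (f : x ⟶ y) (a : fib E y) :
    act E f (act E (Groupoid.inv f) a) = a := by
  rw [← LinearMap.comp_apply, ← act_comp, Groupoid.inv_comp, act_id, LinearMap.id_apply]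

/-- Arrows act by unitary maps, whose inverses are their adjoints. Traces of inverse arrows are
therefore complex conjugates. -/
theorem act_inv_eq_adjoint (E : Bundle X) {x y : X.pt} (f : x ⟶ y) :
    act E (Groupoid.inv f) = LinearMap.adjoint (act E f) := by
  rw [LinearMap.eq_adjoint_iff]
  intro a b
  rw [← act_inner E f, act_act_inv]

theorem app_act {E F : Bundle X} (η : E ⟶ F) {x y : X.pt} (f : x ⟶ y) :
    app η y ∘ₗ act E f = act F f ∘ₗ app η x :=
  congrArg FinHilb.lin (η.hom.naturality f)

theorem app_act_apply {E F : Bundle X} (η : E ⟶ F) {x y : X.pt} (f : x ⟶ y) (a : fib E x) :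
    app η y (act E f a) = act F f (app η x a) := LinearMap.congr_fun (app_act η f) a

@[ext] theorem hom_ext {E F : Bundle X} {η θ : E ⟶ F} (h : ∀ x, app η x = app θ x) : η = θ :=
  ObjectProperty.hom_ext _ (NatTrans.ext (funext fun x => FinHilb.hom_ext (h x)))

@[simp] theorem app_id (E : Bundle X) (x : X.pt) : app (𝟙 E) x = LinearMap.id := rfl
@[simp] theorem app_comp {E F H : Bundle X} (η : E ⟶ F) (θ : F ⟶ H) (x : X.pt) :
    app (η ≫ θ) x = app θ x ∘ₗ app η x := rfl
@[simp] theorem app_add {E F : Bundle X} (η θ : E ⟶ F) (x : X.pt) :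
    app (η + θ) x = app η x + app θ x := rfl
@[simp] theorem app_zero {E F : Bundle X} (x : X.pt) : app (0 : E ⟶ F) x = 0 := rfl
@[simp] theorem app_smul {E F : Bundle X} (c : ℂ) (η : E ⟶ F) (x : X.pt) :
    app (c • η) x = c • app η x := rfl

/-- Build a morphism of bundles from its components. -/
def mkHom {E F : Bundle X} (f : ∀ x, fib E x →ₗ[ℂ] fib F x)
    (hf : ∀ {x y : X.pt} (u : x ⟶ y), f y ∘ₗ act E u = act F u ∘ₗ f x) : E ⟶ F :=
  ObjectProperty.homMk
    { app := fun x => FinHilb.ofLin (f x)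
      naturality := fun _ _ u => FinHilb.hom_ext (hf u) }

@[simp] theorem app_mkHom {E F : Bundle X} (f : ∀ x, fib E x →ₗ[ℂ] fib F x) (hf) (x : X.pt) :
    app (mkHom f hf) x = f x := rfl

/-- An isometric functor which is compatible with the `U(1)`-action is a bundle. -/
def mk (E : X.pt ⥤ FinHilb.{u})
    (h : ∀ {x y : X.pt} (f : x ⟶ y) (a b : E.obj x),
      inner ℂ (FinHilb.lin (E.map f) a) (FinHilb.lin (E.map f) b) = inner ℂ a b)
    (h' : ∀ {x y : X.pt} (z : Circle) (f : x ⟶ y), E.map (X.rot z f) = (z : ℂ) • E.map f) :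
    Bundle X where
  obj := E
  property := ⟨fun f => UnitaryRep.isUnitary_of_inner E h f, h'⟩

/-- A bijective morphism is an isomorphism. -/
theorem nonempty_iso {E F : Bundle X} (η : E ⟶ F) (h : ∀ x, Function.Bijective (app η x)) :
    Nonempty (E ≅ F) :=
  ⟨{ hom := η
     inv := mkHom (fun x => (LinearEquiv.ofBijective (app η x) (h x)).symm.toLinearMap)
       (fun {x y} u => LinearMap.ext fun a => by
         -- Naturality of the inverse is tested after applying the injective component of `η`, where
         -- it becomes naturality of `η`.
         apply (h y).1
         obtain ⟨b, rfl⟩ := (h x).2 a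
         have h1 := fun x => (LinearEquiv.ofBijective (app η x) (h x)).apply_symm_apply
         have h2 := (LinearEquiv.ofBijective (app η x) (h x)).symm_apply_apply b
         simp only [LinearEquiv.ofBijective_apply] at h1 h2
         simp only [LinearMap.comp_apply, LinearEquiv.coe_coe]
         rw [h1, h2, app_act_apply])
     hom_inv_id := hom_ext fun x => LinearMap.ext fun a =>
       (LinearEquiv.ofBijective (app η x) (h x)).symm_apply_apply a
     inv_hom_id := hom_ext fun x => LinearMap.ext fun a =>
       (LinearEquiv.ofBijective (app η x) (h x)).apply_symm_apply a }⟩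

/-! ### Invariant subbundles and orthogonal complements -/

/-- A family of subspaces of the fibers of a bundle which is preserved by all arrows. -/
def IsInvariant (E : Bundle X) (K : ∀ x, Submodule ℂ (fib E x)) : Prop :=
  ∀ {x y : X.pt} (f : x ⟶ y), ∀ a ∈ K x, act E f a ∈ K y

/-- By unitarity `⟨b, E(f) a⟩ = ⟨E(f⁻¹) b, a⟩`, and `E(f⁻¹) b` stays in the invariant family.
Complete reducibility rests on this. -/
theorem IsInvariant.orthogonal {E : Bundle X} {K : ∀ x, Submodule ℂ (fib E x)}
    (hK : IsInvariant E K) : IsInvariant E fun x => (K x)ᗮ := fun {x y} f a ha => by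
  rw [Submodule.mem_orthogonal] at ha ⊢
  intro b hb
  rw [← act_act_inv E f b, act_inner]
  exact ha _ (hK _ _ hb)

theorem isInvariant_ker {E F : Bundle X} (η : E ⟶ F) :
    IsInvariant E fun x => LinearMap.ker (app η x) := fun f a ha => by
  rw [LinearMap.mem_ker] at ha ⊢
  rw [app_act_apply, ha, map_zero]

theorem isInvariant_range {E F : Bundle X} (η : E ⟶ F) :
    IsInvariant F fun x => LinearMap.range (app η x) := by
  rintro x y f _ ⟨a, rfl⟩
  exact ⟨act E f a, app_act_apply η f a⟩

/-- The functor underlying an invariant subbundle. -/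
def subFunctor (E : Bundle X) (K : ∀ x, Submodule ℂ (fib E x)) (hK : IsInvariant E K) :
    X.pt ⥤ FinHilb.{u} where
  obj x := ⟨K x⟩
  map f := FinHilb.ofLin ((act E f).restrict (hK f))
  map_id x := FinHilb.hom_ext <| LinearMap.ext fun a => Subtype.ext <|
    LinearMap.congr_fun (act_id E x) a.1
  map_comp f g := FinHilb.hom_ext <| LinearMap.ext fun a => Subtype.ext <|
    LinearMap.congr_fun (act_comp E f g) a.1

/-- An invariant subbundle. -/
def sub (E : Bundle X) (K : ∀ x, Submodule ℂ (fib E x)) (hK : IsInvariant E K) : Bundle X :=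
  mk (subFunctor E K hK) (fun f a b => act_inner E f a.1 b.1)
    (fun z f => FinHilb.hom_ext <| LinearMap.ext fun a => Subtype.ext <|
      LinearMap.congr_fun (act_rot E z f) a.1)

variable {E : Bundle X} {K : ∀ x, Submodule ℂ (fib E x)}

/-- The inclusion of an invariant subbundle. -/
def subIncl (hK : IsInvariant E K) : sub E K hK ⟶ E :=
  mkHom (fun x => (K x).subtype) fun _ => rfl

/-- The orthogonal projection to an invariant subbundle. -/
def subProj (hK : IsInvariant E K) : E ⟶ sub E K hK :=
  mkHom (fun x => (K x).orthogonalProjectionOnto.toLinearMap) fun {x y} f => LinearMap.ext fun a => by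
    apply Subtype.ext
    change ((K y).orthogonalProjectionOnto (act E f a) : fib E y) =
      act E f ((K x).orthogonalProjectionOnto a)
    -- An orthogonal projection is characterized by lying in the subspace and leaving an orthogonal
    -- remainder; arrows preserve both properties.
    refine Submodule.eq_starProjection_of_mem_of_inner_eq_zero (hK f _ (Subtype.property _)) ?_
    intro w hw
    rw [← map_sub, ← act_act_inv E f w, act_inner]
    exact Submodule.starProjection_inner_eq_zero _ _ (hK _ _ hw)

theorem coe_subProj (hK : IsInvariant E K) {x : X.pt} (a : fib E x) :
    (app (subProj hK) x a).1 = (K x).starProjection a := rfl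

theorem subProj_apply_of_mem (hK : IsInvariant E K) {x : X.pt} (a : K x) :
    app (subProj hK) x a.1 = a :=
  Subtype.ext ((coe_subProj hK a.1).trans (Submodule.starProjection_eq_self_iff.2 a.2))

theorem subProj_apply_of_mem_orthogonal (hK : IsInvariant E K) {x : X.pt} (a : fib E x)
    (ha : a ∈ (K x)ᗮ) : app (subProj hK) x a = 0 :=
  Subtype.ext ((coe_subProj hK a).trans ((Submodule.starProjection_apply_eq_zero_iff _).2 ha))

theorem mem_orthogonal_orthogonal {x : X.pt} (a : K x) : (a : fib E x) ∈ (K x)ᗮᗮ :=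
  (K x).le_orthogonal_orthogonal a.2

/-- A bundle is the direct sum of an invariant subbundle and its orthogonal complement. -/
theorem isDirectSum_sub (hK : IsInvariant E K) :
    IsDirectSum E (sub E K hK) (sub E _ hK.orthogonal) := by
  refine ⟨subIncl hK, subIncl hK.orthogonal, subProj hK, subProj hK.orthogonal, ?_, ?_, ?_, ?_, ?_⟩
  all_goals refine hom_ext fun x => LinearMap.ext fun a => ?_
  · exact subProj_apply_of_mem hK a
  · exact subProj_apply_of_mem hK.orthogonal a
  · exact subProj_apply_of_mem_orthogonal hK.orthogonal _ (mem_orthogonal_orthogonal a)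
  · exact subProj_apply_of_mem_orthogonal hK _ (Subtype.property a)
  · exact ((K x).starProjection_add_starProjection_orthogonal a)

theorem id_sub_eq_zero_iff (hK : IsInvariant E K) : 𝟙 (sub E K hK) = 0 ↔ ∀ x, K x = ⊥ := by
  constructor
  · intro h x
    rw [Submodule.eq_bot_iff]
    intro a ha
    have h1 := LinearMap.congr_fun (congrArg (fun η => app η x) h) (⟨a, ha⟩ : K x)
    exact congrArg Subtype.val h1
  · intro h
    refine hom_ext fun x => LinearMap.ext fun a => Subtype.ext ?_
    exact (Submodule.eq_bot_iff _).1 (h x) a.1 a.2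

/-! ### Irreducible bundles and Schur's lemma -/

/-- A nonzero bundle with an endomorphism that is not scalar has a proper subbundle. -/
theorem exists_invariant {E : Bundle X} (h0 : 𝟙 E ≠ 0) (h : Module.finrank ℂ (E ⟶ E) ≠ 1) :
    ∃ K, IsInvariant E K ∧ (∃ x, K x ≠ ⊥) ∧ ∃ x, K x ≠ ⊤ := by
  have h1 : ∃ η : E ⟶ E, ∀ c : ℂ, c • 𝟙 E ≠ η := by
    by_contra! hc
    exact h (finrank_eq_one_iff_of_nonzero' _ h0 |>.2 hc)
  obtain ⟨η, hη⟩ := h1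
  have h2 : ∃ x, Nontrivial (fib E x) := by
    by_contra! hc
    exact h0 (hom_ext fun x => LinearMap.ext fun a => (hc x).elim _ _)
  obtain ⟨x, hx⟩ := h2
  -- An eigenvalue `c` on one nonzero fibre suffices: the kernel of `η - c` is an invariant family,
  -- nonzero at `x`, and it is not everything because `η` is not scalar.
  obtain ⟨c, hc⟩ := Module.End.exists_eigenvalue (app η x)
  refine ⟨_, isInvariant_ker (η - c • 𝟙 E), ⟨x, ?_⟩, ?_⟩
  · rw [Module.End.hasEigenvalue_iff, Module.End.eigenspace_def] at hc
    exact hc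
  · by_contra! h3
    refine hη c (sub_eq_zero.1 (hom_ext fun x => ?_)).symm
    exact LinearMap.ker_eq_top.1 (h3 x)

variable [Finite X.pt]

theorem finrank_end_pos {E : Bundle X} (h : 𝟙 E ≠ 0) : 0 < Module.finrank ℂ (E ⟶ E) :=
  Module.finrank_pos_iff_exists_ne_zero.2 ⟨_, h⟩

/-- The endomorphisms of `W` are two-by-two matrices; the off-diagonal blocks `Hom(E, F)` and
`Hom(F, E)` are discarded. -/
theorem finrank_end_add_le {W E F : Bundle X} (h : IsDirectSum W E F) :
    Module.finrank ℂ (E ⟶ E) + Module.finrank ℂ (F ⟶ F) ≤ Module.finrank ℂ (W ⟶ W) := by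
  rw [finrank_hom_left W h, finrank_hom_right E h, finrank_hom_right F h]
  omega

/-- A bundle with one-dimensional endomorphism algebra. -/
def IsIrr (E : Bundle X) : Prop := Module.finrank ℂ (E ⟶ E) = 1

theorem IsIrr.id_ne_zero {E : Bundle X} (h : IsIrr E) : 𝟙 E ≠ 0 := fun h0 => by
  have : ∀ η : E ⟶ E, η = 0 := fun η => by rw [← Category.comp_id η, h0, Limits.comp_zero]
  have h1 : Module.finrank ℂ (E ⟶ E) = 0 :=
    Module.finrank_zero_iff.2 ⟨fun a b => by rw [this a, this b]⟩
  rw [IsIrr] at h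
  omega

theorem IsIrr.eq_smul_id {E : Bundle X} (h : IsIrr E) (η : E ⟶ E) : ∃ c : ℂ, c • 𝟙 E = η :=
  (finrank_eq_one_iff_of_nonzero' _ h.id_ne_zero).1 h η

/-- A nonzero proper subbundle and its orthogonal complement would each have a nonzero identity and
so contribute at least one to the dimension of `End(E)`, making it at least two. -/
theorem IsIrr.eq_bot_or_eq_top {E : Bundle X} (h : IsIrr E) {K : ∀ x, Submodule ℂ (fib E x)}
    (hK : IsInvariant E K) : (∀ x, K x = ⊥) ∨ ∀ x, K x = ⊤ := by
  by_contra! hc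
  obtain ⟨⟨x, hx⟩, y, hy⟩ := hc
  have h1 := finrank_end_pos (mt (id_sub_eq_zero_iff hK).1 fun h' => hx (h' x))
  have h2 := finrank_end_pos (mt (id_sub_eq_zero_iff hK.orthogonal).1 fun h' =>
    hy (Submodule.orthogonal_eq_bot_iff.1 (h' y)))
  have h3 := finrank_end_add_le (isDirectSum_sub hK)
  rw [IsIrr] at h
  omega

/-- Schur's lemma. -/
theorem IsIrr.finrank_hom {E F : Bundle X} (hE : IsIrr E) (hF : IsIrr F) (h : IsEmpty (E ≅ F)) :
    Module.finrank ℂ (E ⟶ F) = 0 := by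
  refine Module.finrank_zero_iff.2 ⟨fun a b => ?_⟩
  suffices ∀ η : E ⟶ F, η = 0 by rw [this a, this b]
  intro η
  by_contra hη
  -- Kernel and range are invariant, so a nonzero `η` has zero kernel and full range and would be an
  -- isomorphism.
  rcases hE.eq_bot_or_eq_top (isInvariant_ker η) with h1 | h1
  · rcases hF.eq_bot_or_eq_top (isInvariant_range η) with h2 | h2
    · exact hη (hom_ext fun x => LinearMap.range_eq_bot.1 (h2 x))
    · exact h.false (nonempty_iso η fun x =>
        ⟨LinearMap.ker_eq_bot.1 (h1 x), LinearMap.range_eq_top.1 (h2 x)⟩).some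
  · exact hη (hom_ext fun x => LinearMap.ker_eq_top.1 (h1 x))

/-- To prove a property of all bundles, it suffices to prove it for zero bundles and irreducible
bundles and to show that it is inherited by direct sums. -/
theorem induction {P : Bundle X → Prop} (zero : ∀ E, 𝟙 E = 0 → P E) (irr : ∀ E, IsIrr E → P E)
    (sum : ∀ W E F, IsDirectSum W E F → P E → P F → P W) (E : Bundle X) : P E := by
  -- The induction is on `dim End(E)`: both summands of a proper splitting have positive dimension
  -- of endomorphisms, and these add up to at most that of `E`.
  induction hn : Module.finrank ℂ (E ⟶ E) using Nat.strong_induction_on generalizing E with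
  | _ n ih =>
    by_cases h0 : 𝟙 E = 0
    · exact zero E h0
    by_cases h1 : IsIrr E
    · exact irr E h1
    obtain ⟨K, hK, ⟨x, hx⟩, y, hy⟩ := exists_invariant h0 h1
    have h2 := finrank_end_pos (mt (id_sub_eq_zero_iff hK).1 fun h' => hx (h' x))
    have h3 := finrank_end_pos (mt (id_sub_eq_zero_iff hK.orthogonal).1 fun h' =>
      hy (Submodule.orthogonal_eq_bot_iff.1 (h' y)))
    have h4 := finrank_end_add_le (isDirectSum_sub hK)
    exact sum _ _ _ (isDirectSum_sub hK) (ih _ (by omega) _ rfl) (ih _ (by omega) _ rfl)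

end Bundle

end Semisimple

/-! ### Flat sections of the transgressed line bundle -/

section LoopSum

variable {G : Type v} [Group G]

instance finite_loopPt [Finite G] (S : Type w) [MulAction G S] [Finite S] :
    Finite (LoopPt G S) :=
  Finite.of_injective (fun p : LoopPt G S => (p.pt, p.elt)) fun p q h => by
    cases p; cases q; simp_all

instance finite_loopBG [Finite G] : Finite (LoopBG G) :=
  Finite.of_injective LoopBG.elt fun p q h => by cases p; cases q; simp_all

/-- An arrow out of a loop is determined by an arbitrary `h` in `G`, since `h` dictates its target.
The weights `1 / |a →|` on `ΛX_G` and on `ΛBG` are thus all equal to `1 / |G|`. -/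
theorem numArrows_loopPt {S : Type w} [MulAction G S] (p : LoopPt G S) :
    UnitaryRep.numArrows p = Nat.card G :=
  Nat.card_congr
    { toFun := fun f => f.2.1
      invFun := fun h => ⟨⟨h • p.pt, h * p.elt * h⁻¹, by
        rw [mul_smul, mul_smul, inv_smul_smul, p.fix]⟩, ⟨h, rfl, rfl⟩⟩
      left_inv := by
        rintro ⟨⟨x, g, e⟩, h, h1, h2⟩
        dsimp only at h1 h2
        subst h1 h2
        rfl
      right_inv := fun _ => rfl }

theorem numArrows_loopBG (p : LoopBG G) : UnitaryRep.numArrows p = Nat.card G :=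
  Nat.card_congr
    { toFun := fun f => f.2.1
      invFun := fun h => ⟨⟨h * p.elt * h⁻¹⟩, ⟨h, rfl⟩⟩
      left_inv := by
        rintro ⟨⟨g⟩, h, h2⟩
        dsimp only at h2
        subst h2
        rfl
      right_inv := fun _ => rfl }

-- The loops over a pair `(g, x)` form one point if `g` fixes `x` and none otherwise. This form of
-- the sum can be matched with sums of diagonal blocks, which also vanish unless `g` fixes `x`.
open scoped Classical in
theorem sum_loopPt [Fintype G] {S : Type w} [MulAction G S] [Fintype S] [Fintype (LoopPt G S)]
    {A : Type*} [AddCommMonoid A] (F : LoopPt G S → A) :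
    ∑ p, F p = ∑ g : G, ∑ x : S, if h : g • x = x then F ⟨x, g, h⟩ else 0 := by
  rw [← Fintype.sum_prod_type'
    (f := fun (g : G) (x : S) => if h : g • x = x then F ⟨x, g, h⟩ else 0),
    ← Finset.sum_fiberwise (g := fun p : LoopPt G S => (p.elt, p.pt))]
  refine Finset.sum_congr rfl fun ⟨g, x⟩ _ => ?_
  split_ifs with h
  · rw [Finset.sum_eq_single ⟨x, g, h⟩]
    · rintro ⟨x', g', h'⟩ h1 h2
      simp only [Finset.mem_filter, Finset.mem_univ, true_and, Prod.mk.injEq] at h1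
      obtain ⟨rfl, rfl⟩ := h1
      exact (h2 rfl).elim
    · simp
  · refine Finset.sum_eq_zero ?_
    rintro ⟨x', g', h'⟩ h1
    simp only [Finset.mem_filter, Finset.mem_univ, true_and, Prod.mk.injEq] at h1
    obtain ⟨rfl, rfl⟩ := h1
    exact (h h').elim

end LoopSum

section FlatSections

variable {G : Type v} [Group G]

namespace EqGerbe

variable {X : EqGerbe.{u} G}

@[simp] theorem loopCoord_loopVec {p : LoopPt G X.pt} (u : X.Loops p) (a : ℂ) :
    loopCoord u (loopVec u a) = a := TorsorLine.coord_tmul_self u a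

@[simp] theorem loopVec_loopCoord {p : LoopPt G X.pt} (u : X.Loops p)
    (s : X.transgression.fiber p) : loopVec u (loopCoord u s) = s := TorsorLine.tmul_coord u s

theorem loopVec_rot {p : LoopPt G X.pt} (z : Circle) (u : X.Loops p) (a : ℂ) :
    loopVec (z • u) a = loopVec u (z * a) := TorsorLine.smul_tmul z u a

theorem loopVec_smul {p : LoopPt G X.pt} (u : X.Loops p) (c a : ℂ) :
    loopVec u (c * a) = c • loopVec u a := map_smul (TorsorLine.coord u).symm c a

theorem loopVec_injective {p : LoopPt G X.pt} (u : X.Loops p) :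
    Function.Injective (loopVec u) := (TorsorLine.coord u).symm.injective

theorem loopCoord_injective {p : LoopPt G X.pt} (u : X.Loops p) :
    Function.Injective (loopCoord u) := (TorsorLine.coord u).injective

/-- Since `zu ⊗ a = u ⊗ za`, coordinates scale inversely to arrows. Products of a coordinate at `u`
with `E(u)` are therefore independent of `u`. -/
theorem loopCoord_rot {p : LoopPt G X.pt} (z : Circle) (u : X.Loops p)
    (s : X.transgression.fiber p) :
    loopCoord (z • u) s = ((z⁻¹ : Circle) : ℂ) * loopCoord u s := by
  refine loopVec_injective (z • u) ?_
  rw [loopVec_loopCoord, loopVec_rot, ← mul_assoc, ← Circle.coe_mul, mul_inv_cancel,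
    Circle.coe_one, one_mul, loopVec_loopCoord]

theorem exists_smul_eq {p : LoopPt G X.pt} (u v : X.Loops p) : ∃ z : Circle, z • u = v :=
  (CircleTorsor.existsUnique u v).exists

theorem inner_eq_loopCoord {p : LoopPt G X.pt} (u : X.Loops p) (s t : X.transgression.fiber p) :
    inner ℂ s t = conj (loopCoord u s) * loopCoord u t := TorsorLine.inner_eq u s t

theorem tr_loopVec {p q : LoopPt G X.pt} (h : p ⟶ q) (u : X.Loops p) (a : ℂ) :
    X.transgression.tr h (loopVec u a) = loopVec (conjLoop h u) a :=
  TorsorLine.map_tmul _ (conjLoop_smul h) u a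

theorem loopCoord_conjLoop (s : X.transgression.Flat) {p q : LoopPt G X.pt} (h : p ⟶ q)
    (u : X.Loops p) : loopCoord (conjLoop h u) (s.1 q) = loopCoord u (s.1 p) := by
  rw [← s.2 h]
  conv_lhs => rw [← loopVec_loopCoord u (s.1 p), tr_loopVec, loopCoord_loopVec]

/-- The coordinates of a flat section are invariant under conjugation. -/
theorem loopCoord_conj (s : X.transgression.Flat) {p q : LoopPt G X.pt} (v : p.pt ⟶ q.pt)
    (u : X.Loops p) (w : X.Loops q) (e : u.1 ≫ v = v ≫ w.1) :
    loopCoord w (s.1 q) = loopCoord u (s.1 p) := by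
  have e' : X.deg v * p.elt * (X.deg v)⁻¹ = q.elt := by
    have := congrArg X.deg e
    rw [X.deg_comp, X.deg_comp, u.2, w.2] at this
    rw [this, mul_inv_cancel_right]
  let f : p ⟶ q := ⟨X.deg v, X.deg_smul v, e'⟩
  rw [← loopCoord_conjLoop s f, conjLoop_eq f v rfl]
  congr 2
  refine Subtype.ext ?_
  change w.1 = Groupoid.inv v ≫ u.1 ≫ v
  rw [e, ← Category.assoc, Groupoid.inv_comp, Category.id_comp]

/-- The flat section with given coordinates. -/
def flatMk (c : ∀ p : LoopPt G X.pt, X.Loops p → ℂ)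
    (h1 : ∀ p (z : Circle) u, c p (z • u) = ((z⁻¹ : Circle) : ℂ) * c p u)
    (h2 : ∀ (p q : LoopPt G X.pt) (h : p ⟶ q) u, c q (conjLoop h u) = c p u) :
    X.transgression.Flat where
  val p := loopVec (TorsorLine.base (X.Loops p)) (c p (TorsorLine.base (X.Loops p)))
  property {p q} h := by
    rw [tr_loopVec]
    -- The transported reference arrow and the reference arrow at `q` differ by a phase, which `h1`
    -- absorbs.
    obtain ⟨z, hz⟩ := exists_smul_eq (TorsorLine.base (X.Loops q))
      (conjLoop h (TorsorLine.base (X.Loops p)))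
    rw [← h2 p q h, ← hz, loopVec_rot, h1, ← mul_assoc, ← Circle.coe_mul, mul_inv_cancel,
      Circle.coe_one, one_mul]

theorem loopCoord_flatMk (c : ∀ p : LoopPt G X.pt, X.Loops p → ℂ) (h1) (h2)
    (p : LoopPt G X.pt) (u : X.Loops p) : loopCoord u ((flatMk c h1 h2).1 p) = c p u := by
  obtain ⟨z, rfl⟩ := exists_smul_eq (TorsorLine.base (X.Loops p)) u
  rw [loopCoord_rot, h1]
  congr 1
  exact loopCoord_loopVec _ _

theorem flat_ext {s t : X.transgression.Flat}
    (h : ∀ p (u : X.Loops p), loopCoord u (s.1 p) = loopCoord u (t.1 p)) : s = t :=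
  Subtype.ext (funext fun p => loopCoord_injective (TorsorLine.base (X.Loops p)) (h p _))

/-- The arrows `u p` are free to choose: a phase multiplies both coordinates and cancels against its
conjugate. -/
theorem flatInner_eq_sum [Fintype (LoopPt G X.pt)] (s t : X.transgression.Flat)
    (u : ∀ p, X.Loops p) :
    UnitaryRep.flatInner _ s t = (Nat.card G : ℂ)⁻¹ *
      ∑ p, conj (loopCoord (u p) (s.1 p)) * loopCoord (u p) (t.1 p) := by
  rw [UnitaryRep.flatInner, finsum_eq_sum_of_fintype, Finset.mul_sum]
  refine Finset.sum_congr rfl fun p _ => ?_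
  rw [inner_eq_loopCoord (u p), numArrows_loopPt, div_eq_inv_mul]

theorem flatInner_self_eq_zero [Finite G] [Finite X.pt] {s : X.transgression.Flat}
    (h : UnitaryRep.flatInner _ s s = 0) : s = 0 := by
  have := Fintype.ofFinite (LoopPt G X.pt)
  have hG : (Nat.card G : ℂ) ≠ 0 := Nat.cast_ne_zero.2 Nat.card_pos.ne'
  rw [flatInner_eq_sum s s fun p => TorsorLine.base (X.Loops p), mul_eq_zero,
    or_iff_right (inv_ne_zero hG)] at h
  simp_rw [mul_comm (conj _), Complex.mul_conj] at h
  rw [← Complex.ofReal_sum, Complex.ofReal_eq_zero,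
    Finset.sum_eq_zero_iff_of_nonneg fun p _ => Complex.normSq_nonneg _] at h
  refine Subtype.ext (funext fun p => ?_)
  refine loopCoord_injective (TorsorLine.base (X.Loops p)) ?_
  have := Complex.normSq_eq_zero.1 (h p (Finset.mem_univ p))
  rw [this]
  exact (map_zero (loopCoord _)).symm

/-! ### Twisted characters -/

/-- The twisted character of a bundle. -/
def twChar (E : Bundle X) : X.transgression.Flat :=
  flatMk (fun _ u => conj (LinearMap.trace ℂ _ (Bundle.act E u.1)))
    -- The complex conjugate in the character is needed here: `Tr E(zu) = z Tr E(u)`, whereas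
    -- coordinates have to scale by `z⁻¹ = z̄`.
    (fun p z u => by
      rw [smul_val, Bundle.act_rot, map_smul, smul_eq_mul, map_mul, Circle.coe_inv_eq_conj])
    (fun p q h u => by
      obtain ⟨v, hv⟩ := X.exists_arrow h.1 p.pt q.pt h.2.1
      rw [conjLoop_eq h v hv]
      change conj (LinearMap.trace ℂ _ (Bundle.act E (Groupoid.inv v ≫ u.1 ≫ v))) = _
      rw [Bundle.act_comp, Bundle.act_comp, LinearMap.comp_assoc, LinearMap.trace_comp_comm',
        LinearMap.comp_assoc, ← Bundle.act_comp, Groupoid.comp_inv, Bundle.act_id,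
        LinearMap.comp_id])

@[simp] theorem loopCoord_twChar (E : Bundle X) (p : LoopPt G X.pt) (u : X.Loops p) :
    loopCoord u ((twChar E).1 p) = conj (LinearMap.trace ℂ _ (Bundle.act E u.1)) :=
  loopCoord_flatMk _ _ _ p u

theorem isTwistedChar_twChar (E : Bundle X) : IsTwistedChar E (twChar E) := fun p u =>
  loopCoord_injective u (by rw [loopCoord_twChar, loopCoord_loopVec]; rfl)

theorem twChar_congr {E F : Bundle X} (e : E ≅ F) : twChar E = twChar F :=
  flat_ext fun p u => by
    rw [loopCoord_twChar, loopCoord_twChar, ← trace_conj_eq (Bundle.app e.hom p.pt)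
      (Bundle.app e.inv p.pt) (by rw [← Bundle.app_comp, e.inv_hom_id, Bundle.app_id]),
      ← Bundle.app_act, ← LinearMap.comp_assoc, ← Bundle.app_comp, e.hom_inv_id, Bundle.app_id,
      LinearMap.id_comp]

theorem twChar_add {W E F : Bundle X} (h : IsDirectSum W E F) :
    twChar W = twChar E + twChar F := by
  obtain ⟨i₁, i₂, p₁, p₂, h1, h2, -, -, h5⟩ := h
  refine flat_ext fun p u => ?_
  change _ = loopCoord u ((twChar E).1 p + (twChar F).1 p)
  rw [map_add, loopCoord_twChar, loopCoord_twChar, loopCoord_twChar, ← map_add]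
  -- With the identity of `W` split as `p₁ ≫ i₁ + p₂ ≫ i₂`, naturality factors each term through a
  -- summand, and cyclicity of the trace returns the trace on this summand.
  have e1 : Bundle.act W u.1 = (Bundle.app i₁ p.pt ∘ₗ Bundle.act E u.1) ∘ₗ Bundle.app p₁ p.pt +
      (Bundle.app i₂ p.pt ∘ₗ Bundle.act F u.1) ∘ₗ Bundle.app p₂ p.pt := by
    rw [Bundle.app_act, Bundle.app_act, LinearMap.comp_assoc, LinearMap.comp_assoc,
      ← Bundle.app_comp, ← Bundle.app_comp, ← LinearMap.comp_add, ← Bundle.app_add, h5,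
      Bundle.app_id, LinearMap.comp_id]
  rw [e1, map_add, LinearMap.trace_comp_comm', LinearMap.trace_comp_comm' (Bundle.app p₂ p.pt),
    ← LinearMap.comp_assoc, ← LinearMap.comp_assoc, ← Bundle.app_comp, ← Bundle.app_comp, h1, h2,
    Bundle.app_id, Bundle.app_id, LinearMap.id_comp, LinearMap.id_comp]

end EqGerbe

end FlatSections

/-! ### Orthogonality of twisted characters -/

section Orthogonality

variable {G : Type v} [Group G]

namespace Bundle

variable {X : EqGerbe.{u} G} (E F : Bundle X)

/-! ### Averaging families of maps over the group -/

/-- Families of linear maps between the fibers of two bundles. -/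
abbrev FibHom : Type u := ∀ x : X.pt, fib E x →ₗ[ℂ] fib F x

/-- The family of components of a morphism of bundles. -/
def appLin : (E ⟶ F) →ₗ[ℂ] FibHom E F where
  toFun η x := app η x
  map_add' _ _ := rfl
  map_smul' _ _ := rfl

theorem appLin_injective : Function.Injective (appLin E F) := fun _ _ h =>
  hom_ext fun x => congrFun h x

/-- An arrow from `x` to `g • x` over `g`. -/
def arr (g : G) (x : X.pt) : x ⟶ g • x := (X.exists_deg g x).choose

theorem deg_arr (g : G) (x : X.pt) : X.deg (arr g x) = g := (X.exists_deg g x).choose_spec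

/-- The action of an element of `G` on families of linear maps. -/
def translate (g : G) : FibHom E F →ₗ[ℂ] FibHom E F :=
  LinearMap.pi fun x =>
    sandwich (act F (Groupoid.inv (arr g x))) (act E (arr g x)) ∘ₗ LinearMap.proj (g • x)

variable {E F}

@[simp] theorem appLin_apply (η : E ⟶ F) (x : X.pt) : appLin E F η x = app η x := rfl

/-- Changing `w` by a phase `z` multiplies `E(w)` by `z` and `F(w⁻¹)` by `z⁻¹`. The chosen arrow
`arr g x` may hence be replaced by any arrow over `g`. -/
theorem translate_apply (f : FibHom E F) (g : G) {x y : X.pt} (w : x ⟶ y) (hw : X.deg w = g) :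
    translate E F g f x = act F (Groupoid.inv w) ∘ₗ f y ∘ₗ act E w := by
  obtain rfl : g • x = y := by rw [← hw, X.deg_smul]
  obtain ⟨z, hz⟩ := EqGerbe.exists_rot w (arr g x) (hw.trans (deg_arr _ _).symm)
  change act F (Groupoid.inv (arr g x)) ∘ₗ f _ ∘ₗ act E (arr g x) = _
  have h : Groupoid.inv (X.rot z w) = X.rot z⁻¹ (Groupoid.inv w) := by
    rw [← cancel_epi (X.rot z w), Groupoid.comp_inv, EqGerbe.rot_comp, EqGerbe.comp_rot,
      ← EqGerbe.mul_rot, mul_inv_cancel, EqGerbe.one_rot, Groupoid.comp_inv]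
  rw [← hz, h, act_rot, act_rot, LinearMap.comp_smul, LinearMap.comp_smul, LinearMap.smul_comp,
    smul_smul, ← Circle.coe_mul, mul_inv_cancel, Circle.coe_one, one_smul]

/-- A single translate is natural only up to a shift of `g` by the degree of the arrow. The shift
disappears in the sum over `G`. -/
theorem translate_comp_act (f : FibHom E F) {x y : X.pt} (u : x ⟶ y) (g : G) :
    translate E F g f y ∘ₗ act E u = act F u ∘ₗ translate E F (g * X.deg u) f x := by
  rw [translate_apply f g (arr g y) (deg_arr g y),
    translate_apply f _ (u ≫ arr g y) (by rw [X.deg_comp, deg_arr]), act_comp]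
  have h : act F (Groupoid.inv (arr g y)) = act F u ∘ₗ act F (Groupoid.inv (u ≫ arr g y)) := by
    rw [← act_comp]
    congr 1
    rw [← cancel_epi (u ≫ arr g y), ← Category.assoc, Groupoid.comp_inv, Category.id_comp,
      Category.assoc, Groupoid.comp_inv, Category.comp_id]
  rw [h]
  rfl

theorem translate_appLin (η : E ⟶ F) (g : G) :
    translate E F g (appLin E F η) = appLin E F η := by
  refine funext fun x => ?_
  rw [translate_apply _ g (arr g x) (deg_arr g x), appLin_apply, appLin_apply, app_act,
    ← LinearMap.comp_assoc, ← act_comp, Groupoid.comp_inv, act_id, LinearMap.id_comp]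

variable (E F)

/-- The average of a family of linear maps over `G`. -/
def average [Fintype G] : FibHom E F →ₗ[ℂ] FibHom E F :=
  (Nat.card G : ℂ)⁻¹ • ∑ g : G, translate E F g

theorem average_apply [Fintype G] (f : FibHom E F) (x : X.pt) :
    average E F f x = (Nat.card G : ℂ)⁻¹ • ∑ g : G, translate E F g f x := by
  simp [average]

/-- Reindexing the sum by right multiplication with `X.deg u` shows that an average is natural, and
natural families are fixed by every translate. The trace of the average is therefore `dim Hom(E,
F)`. -/
theorem isProj_average [Fintype G] :
    LinearMap.IsProj (LinearMap.range (appLin E F)) (average E F) where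
  map_mem f := by
    refine ⟨mkHom (average E F f) (fun {x y} u => ?_), rfl⟩
    rw [average_apply, average_apply, LinearMap.smul_comp, LinearMap.comp_smul]
    congr 1
    refine LinearMap.ext fun a => ?_
    simp only [LinearMap.comp_apply, LinearMap.sum_apply, map_sum]
    refine Fintype.sum_equiv (Equiv.mulRight (X.deg u)) _ _ fun g => ?_
    exact LinearMap.congr_fun (translate_comp_act f u g) a
  map_id := by
    rintro _ ⟨η, rfl⟩
    refine funext fun x => ?_
    have hG : (Nat.card G : ℂ) ≠ 0 := Nat.cast_ne_zero.2 Nat.card_pos.ne'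
    simp only [average_apply, translate_appLin, Finset.sum_const, Finset.card_univ,
      ← Nat.card_eq_fintype_card]
    rw [← Nat.cast_smul_eq_nsmul ℂ, smul_smul, inv_mul_cancel₀ hG, one_smul]

theorem trace_act_inv (E : Bundle X) {x : X.pt} (u : x ⟶ x) :
    LinearMap.trace ℂ _ (act E (Groupoid.inv u)) = conj (LinearMap.trace ℂ _ (act E u)) := by
  rw [act_inv_eq_adjoint, trace_adjoint]

-- The block at `x` of a translate is computed from the block at `g • x`, so only fixed points
-- contribute to the trace. There the block map is `f ↦ F(u⁻¹) f E(u)`, with trace `conj (Tr F(u)) *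
-- Tr E(u)`.
open scoped Classical in
theorem trace_translate [Fintype X.pt] (g : G) :
    LinearMap.trace ℂ _ (translate E F g) = ∑ x : X.pt, if h : g • x = x then
      EqGerbe.loopCoord (TorsorLine.base _) ((EqGerbe.twChar F).1 ⟨x, g, h⟩) *
        conj (EqGerbe.loopCoord (TorsorLine.base _) ((EqGerbe.twChar E).1 ⟨x, g, h⟩)) else 0 := by
  rw [trace_pi]
  refine Finset.sum_congr rfl fun x _ => ?_
  split_ifs with h
  · rw [EqGerbe.loopCoord_twChar, EqGerbe.loopCoord_twChar, Complex.conj_conj, ← trace_act_inv,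
      ← trace_sandwich]
    congr 1
    refine LinearMap.ext fun f => ?_
    rw [LinearMap.comp_apply, LinearMap.comp_apply, LinearMap.proj_apply,
      translate_apply _ g (TorsorLine.base (X.Loops ⟨x, g, h⟩)).1 (TorsorLine.base (X.Loops ⟨x, g, h⟩)).2,
      LinearMap.single_apply, Pi.single_eq_same]
    rfl
  · rw [← map_zero (LinearMap.trace ℂ (fib E x →ₗ[ℂ] fib F x))]
    congr 1
    refine LinearMap.ext fun f => ?_
    change act F _ ∘ₗ (Pi.single x f : FibHom E F) (g • x) ∘ₗ act E _ = 0
    rw [Pi.single_eq_of_ne h, LinearMap.zero_comp, LinearMap.comp_zero]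

/-- The inner product of two twisted characters is the dimension of the space of morphisms. -/
theorem flatInner_twChar [Finite G] [Finite X.pt] :
    UnitaryRep.flatInner _ (EqGerbe.twChar E) (EqGerbe.twChar F) = (Module.finrank ℂ (E ⟶ F) : ℂ) := by
  classical
  have := Fintype.ofFinite G
  have := Fintype.ofFinite X.pt
  have := Fintype.ofFinite (LoopPt G X.pt)
  -- The dimension of `Hom(E, F)` is the trace of the averaging projection. Its factor `1 / |G|` is
  -- also the weight of every loop, so the two sides are compared for each `g` separately.
  rw [← LinearMap.finrank_range_of_inj (appLin_injective E F), ← (isProj_average E F).trace,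
    average, map_smul, map_sum, EqGerbe.flatInner_eq_sum _ _ fun p => TorsorLine.base (X.Loops p),
    sum_loopPt, smul_eq_mul]
  congr 1
  refine Finset.sum_congr rfl fun g _ => ?_
  rw [trace_translate]
  simp only [mul_comm]

end Bundle

end Orthogonality

/-! ### Completeness of twisted characters -/

section Completeness

variable {G : Type v} [Group G]

namespace Bundle

open EqGerbe

variable {X : EqGerbe.{u} G}

/-! ### Flat sections as natural endomorphisms of all bundles -/

open scoped Classical in
/-- The contribution of the loops over `g` to the action of a flat section on a bundle. -/
def loopTerm (ξ : X.transgression.Flat) (E : Bundle X) (x : X.pt) (g : G) :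
    fib E x →ₗ[ℂ] fib E x :=
  if h : g • x = x then loopCoord (TorsorLine.base (X.Loops ⟨x, g, h⟩)) (ξ.1 ⟨x, g, h⟩) •
    act E (TorsorLine.base (X.Loops ⟨x, g, h⟩)).1 else 0

/-- The factor `z⁻¹` from the coordinate cancels the factor `z` from `E(zu)`, so any arrow over the
loop computes the term. -/
theorem loopTerm_eq (ξ : X.transgression.Flat) (E : Bundle X) {p : LoopPt G X.pt}
    (u : X.Loops p) : loopTerm ξ E p.pt p.elt = loopCoord u (ξ.1 p) • act E u.1 := by
  rw [loopTerm, dif_pos p.fix]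
  obtain ⟨z, rfl⟩ := exists_smul_eq (TorsorLine.base (X.Loops p)) u
  rw [loopCoord_rot, smul_val, act_rot, smul_smul, mul_right_comm, ← Circle.coe_mul,
    inv_mul_cancel, Circle.coe_one, one_mul]

theorem loopTerm_eq_zero (ξ : X.transgression.Flat) (E : Bundle X) {x : X.pt} {g : G}
    (h : g • x ≠ x) : loopTerm ξ E x g = 0 := dif_neg h

/-- Moving `E(v)` past `E(u)` replaces `u` by its conjugate by `v`, and the coordinates of a flat
section do not change under conjugation. Summed over `g`, this makes the action of `ξ` a bundle
endomorphism. -/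
theorem act_comp_loopTerm (ξ : X.transgression.Flat) (E : Bundle X) {x y : X.pt} (v : x ⟶ y)
    (g : G) : act E v ∘ₗ loopTerm ξ E x g =
      loopTerm ξ E y (X.deg v * g * (X.deg v)⁻¹) ∘ₗ act E v := by
  have hy := X.deg_smul v
  by_cases h : g • x = x
  · have h' : (X.deg v * g * (X.deg v)⁻¹) • y = y := by
      rw [mul_smul, mul_smul, inv_smul_eq_iff.2 hy.symm, h, hy]
    let f : (⟨x, g, h⟩ : LoopPt G X.pt) ⟶ ⟨y, _, h'⟩ := ⟨X.deg v, hy, rfl⟩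
    have u := TorsorLine.base (X.Loops ⟨x, g, h⟩)
    have e1 := loopTerm_eq ξ E u
    have e2 := loopTerm_eq ξ E (conjBy f v rfl u)
    dsimp only at e1 e2
    rw [e1, e2, loopCoord_conj ξ v u (conjBy f v rfl u) (by simp [conjBy]), LinearMap.comp_smul,
      LinearMap.smul_comp, ← act_comp, ← act_comp]
    congr 2
    simp [conjBy]
  · have h' : (X.deg v * g * (X.deg v)⁻¹) • y ≠ y := fun e => h <| by
      rw [mul_smul, mul_smul, inv_smul_eq_iff.2 hy.symm] at e
      exact MulAction.injective (X.deg v) (e.trans hy.symm)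
    rw [loopTerm_eq_zero ξ E h, loopTerm_eq_zero ξ E h', LinearMap.comp_zero, LinearMap.zero_comp]

theorem app_comp_loopTerm (ξ : X.transgression.Flat) {E F : Bundle X} (η : E ⟶ F) (x : X.pt)
    (g : G) : app η x ∘ₗ loopTerm ξ E x g = loopTerm ξ F x g ∘ₗ app η x := by
  rw [loopTerm, loopTerm]
  split_ifs
  · rw [LinearMap.comp_smul, LinearMap.smul_comp, app_act]
  · rw [LinearMap.comp_zero, LinearMap.zero_comp]

/-- The action of a flat section on a bundle by an endomorphism. -/
def flatOp [Fintype G] (ξ : X.transgression.Flat) (E : Bundle X) : E ⟶ E :=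
  mkHom (fun x => ∑ g : G, loopTerm ξ E x g) fun {x y} v => LinearMap.ext fun a => by
    simp only [LinearMap.comp_apply, LinearMap.sum_apply, map_sum]
    refine (Fintype.sum_equiv (MulAut.conj (X.deg v)).toEquiv _ _ fun g => ?_).symm
    exact LinearMap.congr_fun (act_comp_loopTerm ξ E v g) a

theorem app_flatOp [Fintype G] (ξ : X.transgression.Flat) (E : Bundle X) (x : X.pt) :
    app (flatOp ξ E) x = ∑ g : G, loopTerm ξ E x g := rfl

/-- Each term is a multiple of the action of an arrow, which commutes with every morphism of
bundles. This is what carries vanishing from irreducible bundles to their sums. -/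
theorem flatOp_naturality [Fintype G] (ξ : X.transgression.Flat) {E F : Bundle X} (η : E ⟶ F) :
    flatOp ξ E ≫ η = η ≫ flatOp ξ F := hom_ext fun x => LinearMap.ext fun a => by
  simp only [app_comp, app_flatOp, LinearMap.comp_apply, LinearMap.sum_apply, map_sum]
  exact Finset.sum_congr rfl fun g _ => LinearMap.congr_fun (app_comp_loopTerm ξ η x g) a

/-- The twisted character contains conjugate traces, and its place in the conjugate-linear slot
undoes the conjugation. The inner product is thus `1 / |G|` times the sum of `Tr E(u)` weighted by
the coordinates of `ξ`. -/
theorem sum_trace_flatOp [Fintype G] [Fintype X.pt] (ξ : X.transgression.Flat) (E : Bundle X) :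
    ∑ x, LinearMap.trace ℂ _ (app (flatOp ξ E) x) =
      (Nat.card G : ℂ) * UnitaryRep.flatInner _ (twChar E) ξ := by
  classical
  have := Fintype.ofFinite (LoopPt G X.pt)
  have hG : (Nat.card G : ℂ) ≠ 0 := Nat.cast_ne_zero.2 Nat.card_pos.ne'
  rw [flatInner_eq_sum _ _ fun p => TorsorLine.base (X.Loops p), mul_inv_cancel_left₀ hG,
    sum_loopPt, Finset.sum_comm]
  refine Finset.sum_congr rfl fun x _ => ?_
  rw [app_flatOp, map_sum]
  refine Finset.sum_congr rfl fun g _ => ?_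
  rw [loopTerm]
  split_ifs with h
  · rw [loopCoord_twChar, Complex.conj_conj, map_smul, smul_eq_mul, mul_comm]
  · rw [map_zero]

/-- On an irreducible bundle `ξ` acts by a scalar, whose total trace is a multiple of an inner
product that vanishes by assumption. Naturality extends the vanishing to direct sums. -/
theorem flatOp_eq_zero [Fintype G] [Finite X.pt] {ξ : X.transgression.Flat}
    (h : ∀ E : Bundle X, UnitaryRep.flatInner _ (twChar E) ξ = 0) (E : Bundle X) :
    flatOp ξ E = 0 := by
  have := Fintype.ofFinite X.pt
  induction E using Bundle.induction with
  | zero E h0 => rw [← Category.comp_id (flatOp ξ E), h0, Limits.comp_zero]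
  | irr E hE =>
    obtain ⟨c, hc⟩ := hE.eq_smul_id (flatOp ξ E)
    have h1 := sum_trace_flatOp ξ E
    rw [h, mul_zero, ← hc] at h1
    simp only [app_smul, app_id, map_smul, LinearMap.trace_id, smul_eq_mul] at h1
    rw [← Finset.mul_sum, mul_eq_zero] at h1
    rcases h1 with rfl | h1
    · rw [← hc, zero_smul]
    -- Otherwise the total dimension of the fibres would be zero, which an irreducible bundle
    -- excludes.
    · exfalso
      rw [← Nat.cast_sum, Nat.cast_eq_zero, Finset.sum_eq_zero_iff] at h1
      refine hE.id_ne_zero (hom_ext fun x => LinearMap.ext fun a => ?_)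
      have := Module.finrank_zero_iff.1 (h1 x (Finset.mem_univ x))
      exact this.elim _ _
  | sum W E F hW hE hF =>
    obtain ⟨i₁, i₂, p₁, p₂, -, -, -, -, h5⟩ := hW
    rw [← Category.id_comp (flatOp ξ W), ← h5, Preadditive.add_comp, Category.assoc,
      Category.assoc, ← flatOp_naturality, ← flatOp_naturality, hE, hF]
    simp

/-! The regular bundle at an object `o`: functions on the arrows out of `o`. -/

/-- The space of equivariant functions on the arrows from `o` to `x`. -/
def regSubmodule (o x : X.pt) : Submodule ℂ ((o ⟶ x) → ℂ) where
  carrier := {φ | ∀ (z : Circle) f, φ (X.rot z f) = ((z⁻¹ : Circle) : ℂ) * φ f}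
  add_mem' ha hb z f := by rw [Pi.add_apply, Pi.add_apply, ha, hb, mul_add]
  zero_mem' z f := (mul_zero _).symm
  smul_mem' c a ha z f := by rw [Pi.smul_apply, Pi.smul_apply, ha, smul_eq_mul, smul_eq_mul,
    mul_left_comm]

/-- The fiber of the regular bundle. -/
def RegFib (o x : X.pt) : Type u := regSubmodule o x

instance (o x : X.pt) : AddCommGroup (RegFib o x) := inferInstanceAs (AddCommGroup (regSubmodule o x))
instance (o x : X.pt) : Module ℂ (RegFib o x) := inferInstanceAs (Module ℂ (regSubmodule o x))

namespace RegFib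

variable {o x y : X.pt}

/-- Evaluation at an arrow. -/
def eval (f : o ⟶ x) : RegFib o x →ₗ[ℂ] ℂ := LinearMap.proj f ∘ₗ (regSubmodule o x).subtype

theorem eval_rot (z : Circle) (f : o ⟶ x) (φ : RegFib o x) :
    eval (X.rot z f) φ = ((z⁻¹ : Circle) : ℂ) * eval f φ := φ.2 z f

@[ext] theorem ext {φ ψ : RegFib o x} (h : ∀ f, eval f φ = eval f ψ) : φ = ψ :=
  Subtype.ext (funext h)

open scoped Classical in
/-- The value at some arrow over `g`. -/
def coeff (g : G) : RegFib o x →ₗ[ℂ] ℂ :=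
  if h : ∃ f : o ⟶ x, X.deg f = g then eval h.choose else 0

/-- All arrows over the same `g` differ by phases, so an equivariant function is known from one
value for each element of `G`. The fibre is therefore finite-dimensional although there is a circle
of arrows over each `g`. -/
theorem exists_coeff_eq (f : o ⟶ x) : ∃ z : Circle, ∀ φ : RegFib o x,
    coeff (X.deg f) φ = z * eval f φ := by
  have h : ∃ f' : o ⟶ x, X.deg f' = X.deg f := ⟨f, rfl⟩
  obtain ⟨z, hz⟩ := exists_rot f h.choose h.choose_spec.symm
  refine ⟨z⁻¹, fun φ => ?_⟩
  rw [coeff, dif_pos h, ← hz, eval_rot]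

/-- The phase that relates the chosen arrow to `f` cancels against its conjugate, so the inner
product does not depend on the choices in `coeff`. -/
theorem conj_coeff_mul_coeff (f : o ⟶ x) (φ ψ : RegFib o x) :
    conj (coeff (X.deg f) φ) * coeff (X.deg f) ψ = conj (eval f φ) * eval f ψ := by
  obtain ⟨z, hz⟩ := exists_coeff_eq f
  have h : conj (z : ℂ) * (z : ℂ) = 1 := by
    rw [← Circle.coe_inv_eq_conj, ← Circle.coe_mul, inv_mul_cancel, Circle.coe_one]
  rw [hz, hz, map_mul]
  linear_combination conj (eval f φ) * eval f ψ * h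

theorem eq_zero_of_coeff {φ : RegFib o x} (h : ∀ g, coeff g φ = 0) : φ = 0 := by
  ext f
  obtain ⟨z, hz⟩ := exists_coeff_eq f
  have := hz φ
  rw [h, zero_eq_mul, or_iff_right (Circle.coe_ne_zero z)] at this
  rw [this, map_zero]

instance : Inner ℂ (RegFib o x) where
  inner φ ψ := ∑ᶠ g : G, conj (coeff g φ) * coeff g ψ

theorem inner_eq [Fintype G] (φ ψ : RegFib o x) :
    inner ℂ φ ψ = ∑ g : G, conj (coeff g φ) * coeff g ψ := finsum_eq_sum_of_fintype _

theorem inner_self [Fintype G] (φ : RegFib o x) :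
    inner ℂ φ φ = ((∑ g : G, Complex.normSq (coeff g φ) : ℝ) : ℂ) := by
  rw [inner_eq]
  push_cast
  exact Finset.sum_congr rfl fun g _ => by rw [mul_comm, Complex.mul_conj]

/-- The action of an arrow on the regular bundle. -/
def map (v : x ⟶ y) : RegFib o x →ₗ[ℂ] RegFib o y where
  toFun φ := ⟨fun f => eval (f ≫ Groupoid.inv v) φ, fun z f => by
    change eval (X.rot z f ≫ Groupoid.inv v) φ = _ * eval (f ≫ Groupoid.inv v) φ
    rw [rot_comp, eval_rot]⟩
  map_add' φ ψ := RegFib.ext fun f => map_add (eval _) φ ψ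
  map_smul' c φ := RegFib.ext fun f => map_smul (eval _) c φ

theorem eval_map (v : x ⟶ y) (f : o ⟶ y) (φ : RegFib o x) :
    eval f (map v φ) = eval (f ≫ Groupoid.inv v) φ := rfl

variable [Finite G]

instance : FiniteDimensional ℂ (RegFib o x) :=
  Module.Finite.of_injective (LinearMap.pi coeff : RegFib o x →ₗ[ℂ] G → ℂ)
    ((injective_iff_map_eq_zero _).2 fun _ h => eq_zero_of_coeff (congrFun h))

instance : NormedAddCommGroup (RegFib o x) :=
  letI := Fintype.ofFinite G
  letI : InnerProductSpace.Core ℂ (RegFib o x) :=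
    { conj_inner_symm := fun a b => by simp [inner_eq, map_sum, mul_comm]
      add_left := fun a b c => by simp [inner_eq, add_mul, Finset.sum_add_distrib]
      smul_left := fun a b c => by simp [inner_eq, Finset.mul_sum, mul_assoc]
      definite := fun a h => by
        rw [inner_self, Complex.ofReal_eq_zero, Finset.sum_eq_zero_iff_of_nonneg
          fun i _ => Complex.normSq_nonneg _] at h
        exact eq_zero_of_coeff fun g => Complex.normSq_eq_zero.1 (h g (Finset.mem_univ g))
      re_inner_nonneg := fun a => by
        rw [inner_self]
        exact Finset.sum_nonneg fun i _ => Complex.normSq_nonneg _ }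
  this.toNormedAddCommGroup

instance : InnerProductSpace ℂ (RegFib o x) := .ofCore _

theorem inner_map (v : x ⟶ y) (φ ψ : RegFib o x) :
    inner ℂ (map v φ) (map v ψ) = inner ℂ φ ψ := by
  let _ := Fintype.ofFinite G
  rw [inner_eq, inner_eq]
  -- Transport along `v` shifts the degrees of arrows by left multiplication with `X.deg v`.
  refine (Fintype.sum_equiv (Equiv.mulLeft (X.deg v)) _ _ fun g => ?_).symm
  rw [Equiv.coe_mulLeft]
  by_cases h : ∃ f : o ⟶ x, X.deg f = g
  · obtain ⟨f, rfl⟩ := h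
    beta_reduce
    rw [← X.deg_comp, conj_coeff_mul_coeff, conj_coeff_mul_coeff, eval_map,
      eval_map, Category.assoc, Groupoid.comp_inv, Category.comp_id]
  -- With no arrow from `o` to `x` over `g`, there is none from `o` to `y` over `X.deg v * g`
  -- either, and all coefficients take the default value zero.
  · have h' : ¬ ∃ f : o ⟶ y, X.deg f = X.deg v * g := by
      rintro ⟨f, hf⟩
      exact h ⟨f ≫ Groupoid.inv v, by rw [X.deg_comp, deg_inv, hf, inv_mul_cancel_left]⟩
    rw [coeff, dif_neg h, coeff, dif_neg h']
    simp

end RegFib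

open scoped Classical in
/-- The delta function at the identity, as a function on arrows. -/
def deltaFun (o : X.pt) (f : o ⟶ o) : ℂ :=
  if h : ∃ z : Circle, X.rot z (𝟙 o) = f then ((h.choose⁻¹ : Circle) : ℂ) else 0

theorem deltaFun_rot_id (o : X.pt) (z : Circle) :
    deltaFun o (X.rot z (𝟙 o)) = ((z⁻¹ : Circle) : ℂ) := by
  have h : ∃ z' : Circle, X.rot z' (𝟙 o) = X.rot z (𝟙 o) := ⟨z, rfl⟩
  rw [deltaFun, dif_pos h, rot_right_cancel h.choose_spec]

theorem deltaFun_eq_zero {o : X.pt} {f : o ⟶ o} (hf : X.deg f ≠ 1) : deltaFun o f = 0 := by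
  refine dif_neg ?_
  rintro ⟨z, rfl⟩
  exact hf (by rw [deg_rot, X.deg_id])

theorem deltaFun_rot (o : X.pt) (z : Circle) (f : o ⟶ o) :
    deltaFun o (X.rot z f) = ((z⁻¹ : Circle) : ℂ) * deltaFun o f := by
  by_cases h : X.deg f = 1
  · obtain ⟨z', rfl⟩ := exists_rot (𝟙 o) f ((X.deg_id o).trans h.symm)
    rw [← mul_rot, deltaFun_rot_id, deltaFun_rot_id, mul_inv, Circle.coe_mul]
  · rw [deltaFun_eq_zero h, deltaFun_eq_zero (by rwa [deg_rot]), mul_zero]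

variable [Finite G]

/-- The functor underlying the regular bundle. -/
def regFunctor (o : X.pt) : X.pt ⥤ FinHilb.{u} where
  obj x := ⟨RegFib o x⟩
  map v := FinHilb.ofLin (RegFib.map v)
  map_id x := FinHilb.hom_ext <| LinearMap.ext fun φ => RegFib.ext fun f => by
    change RegFib.eval (f ≫ Groupoid.inv (𝟙 x)) φ = RegFib.eval f φ
    simp
  map_comp v w := FinHilb.hom_ext <| LinearMap.ext fun φ => RegFib.ext fun f => by
    change RegFib.eval (f ≫ Groupoid.inv (v ≫ w)) φ =
      RegFib.eval ((f ≫ Groupoid.inv w) ≫ Groupoid.inv v) φ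
    simp

/-- The regular bundle at `o`. -/
def reg (o : X.pt) : Bundle X :=
  mk (regFunctor o) (fun v φ ψ => RegFib.inner_map v φ ψ) fun z v =>
    FinHilb.hom_ext <| LinearMap.ext fun φ => RegFib.ext fun f => by
      -- Inverting an arrow inverts its phase. The exponent in the equivariance condition of
      -- `regSubmodule` turns this back into the required factor `z`.
      have h : Groupoid.inv (X.rot z v) = X.rot z⁻¹ (Groupoid.inv v) := by
        rw [← cancel_epi (X.rot z v), Groupoid.comp_inv, rot_comp, comp_rot,
          ← mul_rot, mul_inv_cancel, one_rot, Groupoid.comp_inv]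
      refine Eq.trans ?_ (map_smul (RegFib.eval f) (z : ℂ) (RegFib.map v φ)).symm
      change RegFib.eval (f ≫ Groupoid.inv (X.rot z v)) φ = _
      rw [h, comp_rot]
      refine (RegFib.eval_rot z⁻¹ (f ≫ Groupoid.inv v) φ).trans ?_
      rw [inv_inv]
      rfl

/-- The delta function at the identity, as an element of the fiber of the regular bundle. -/
def regDelta (o : X.pt) : fib (reg o) o :=
  (⟨deltaFun o, deltaFun_rot o⟩ : regSubmodule o o)

/-- Evaluation of an element of a fiber of the regular bundle at an arrow. -/
def regEval {o x : X.pt} (f : o ⟶ x) : fib (reg o) x →ₗ[ℂ] ℂ := RegFib.eval f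

theorem regEval_regDelta {o : X.pt} (f : o ⟶ o) : regEval f (regDelta o) = deltaFun o f := rfl

theorem regEval_act {o x y : X.pt} (v : x ⟶ y) (f : o ⟶ y) (φ : fib (reg o) x) :
    regEval f (act (reg o) v φ) = regEval (f ≫ Groupoid.inv v) φ := rfl

/-- Acting by a loop on the delta function at the identity gives a function supported on arrows of
the degree of this loop. Evaluation at `u` singles out the loop of degree `p.elt` and returns the
coordinate of `ξ` there. -/
theorem regEval_flatOp [Fintype G] (ξ : X.transgression.Flat) {p : LoopPt G X.pt}
    (u : X.Loops p) : regEval u.1 (app (flatOp ξ (reg p.pt)) p.pt (regDelta p.pt)) =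
      loopCoord u (ξ.1 p) := by
  have h0 : app (flatOp ξ (reg p.pt)) p.pt (regDelta p.pt) =
      ∑ g : G, loopTerm ξ (reg p.pt) p.pt g (regDelta p.pt) := by
    rw [app_flatOp, LinearMap.sum_apply]
  rw [h0, map_sum, Finset.sum_eq_single p.elt]
  · rw [loopTerm_eq ξ (reg p.pt) u, LinearMap.smul_apply, map_smul, regEval_act,
      Groupoid.comp_inv, regEval_regDelta, ← one_rot (𝟙 p.pt), deltaFun_rot_id, inv_one,
      Circle.coe_one, smul_eq_mul, mul_one]
  -- For another loop `v` the arrow `u ≫ v⁻¹` has degree different from `1`, where the delta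
  -- function vanishes.
  · intro g _ hg
    by_cases h : g • p.pt = p.pt
    · have v := TorsorLine.base (X.Loops ⟨p.pt, g, h⟩)
      have e := loopTerm_eq ξ (reg p.pt) v
      dsimp only at e
      rw [e, LinearMap.smul_apply, map_smul, regEval_act, regEval_regDelta, deltaFun_eq_zero,
        smul_zero]
      rw [X.deg_comp, deg_inv, u.2, v.2]
      exact fun h1 => hg (inv_mul_eq_one.1 h1)
    · rw [loopTerm_eq_zero _ _ h, LinearMap.zero_apply, map_zero]
  · simp

/-- A flat section which is orthogonal to all twisted characters vanishes. -/
theorem eq_zero_of_flatInner_twChar [Finite X.pt] {ξ : X.transgression.Flat}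
    (h : ∀ E : Bundle X, UnitaryRep.flatInner _ (twChar E) ξ = 0) : ξ = 0 := by
  let _ := Fintype.ofFinite G
  refine flat_ext fun p u => ?_
  rw [← regEval_flatOp, flatOp_eq_zero h, app_zero, LinearMap.zero_apply, map_zero]
  exact (map_zero (loopCoord u)).symm

end Bundle

/-! ### The Hilbert space of flat sections -/

namespace EqGerbe

variable {X : EqGerbe.{u} G} [Finite G] [Finite X.pt]

theorem flatInner_add_left (s s' t : X.transgression.Flat) :
    UnitaryRep.flatInner _ (s + s') t =
      UnitaryRep.flatInner _ s t + UnitaryRep.flatInner _ s' t := by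
  have := Fintype.ofFinite (LoopPt G X.pt)
  simp only [UnitaryRep.flatInner, finsum_eq_sum_of_fintype, ← Finset.sum_add_distrib]
  exact Finset.sum_congr rfl fun p _ => by rw [← add_div, ← inner_add_left]; rfl

theorem flatInner_smul_left (c : ℂ) (s t : X.transgression.Flat) :
    UnitaryRep.flatInner _ (c • s) t = conj c * UnitaryRep.flatInner _ s t := by
  have := Fintype.ofFinite (LoopPt G X.pt)
  simp only [UnitaryRep.flatInner, finsum_eq_sum_of_fintype, Finset.mul_sum]
  exact Finset.sum_congr rfl fun p _ => by rw [← mul_div_assoc, ← inner_smul_left]; rfl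

theorem conj_flatInner (s t : X.transgression.Flat) :
    conj (UnitaryRep.flatInner _ s t) = UnitaryRep.flatInner _ t s := by
  have := Fintype.ofFinite (LoopPt G X.pt)
  simp only [UnitaryRep.flatInner, finsum_eq_sum_of_fintype, map_sum]
  exact Finset.sum_congr rfl fun p _ => by rw [map_div₀, inner_conj_symm, Complex.conj_natCast]

theorem flatInner_self_nonneg (s : X.transgression.Flat) :
    0 ≤ (UnitaryRep.flatInner _ s s).re := by
  have := Fintype.ofFinite (LoopPt G X.pt)
  simp only [UnitaryRep.flatInner, finsum_eq_sum_of_fintype, Complex.re_sum]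
  refine Finset.sum_nonneg fun p _ => ?_
  rw [Complex.div_natCast_re]
  exact div_nonneg (inner_self_nonneg (𝕜 := ℂ) (x := s.1 p)) (Nat.cast_nonneg _)

/-- The inner product on the space of flat sections. -/
@[reducible] def flatCore : InnerProductSpace.Core ℂ X.transgression.Flat where
  inner := UnitaryRep.flatInner _
  conj_inner_symm s t := conj_flatInner t s
  re_inner_nonneg s := flatInner_self_nonneg s
  add_left := flatInner_add_left
  smul_left s t c := flatInner_smul_left c s t
  definite _ := flatInner_self_eq_zero

/-- The twisted characters span the space of flat sections. -/
theorem span_twChar : Submodule.span ℂ (Set.range (twChar (X := X))) = ⊤ := by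
  let := (flatCore (X := X)).toNormedAddCommGroup
  let : InnerProductSpace ℂ X.transgression.Flat := .ofCore _
  have : FiniteDimensional ℂ X.transgression.Flat := inferInstance
  -- In a finite-dimensional inner product space, a subspace with zero orthogonal complement is the
  -- whole space.
  rw [← Submodule.orthogonal_eq_bot_iff, Submodule.eq_bot_iff]
  intro ξ hξ
  exact Bundle.eq_zero_of_flatInner_twChar fun E =>
    (Submodule.mem_orthogonal _ _).1 hξ _ (Submodule.subset_span ⟨E, rfl⟩)

end EqGerbe

end Completeness

/-! ### The twisted character isomorphism -/

section TwistedCharacter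

variable {G : Type v} [Group G]

theorem K0.induction {C : Type*} [Category* C] [Preadditive C] {P : K0 C → Prop} (zero : P 0)
    (mk : ∀ E, P (K0.mk E)) (neg : ∀ a, P a → P (-a)) (add : ∀ a b, P a → P b → P (a + b))
    (a : K0 C) : P a := by
  obtain ⟨a, rfl⟩ := QuotientAddGroup.mk'_surjective (k0Rel C) a
  change P (K0.quot a)
  induction a using FreeAbelianGroup.induction_on with
  | zero => rw [map_zero]; exact zero
  | of q =>
    obtain ⟨E, rfl⟩ := Quotient.exists_rep q
    exact mk E
  | neg q h => rw [map_neg]; exact neg _ h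
  | add a b ha hb => rw [map_add]; exact add _ _ ha hb

/-- A zero object is a direct sum of two copies of itself, so its class equals twice itself. -/
theorem K0.mk_eq_zero {C : Type*} [Category* C] [Preadditive C] {E : C} (h : 𝟙 E = 0) :
    K0.mk E = 0 := by
  have h1 : IsDirectSum E E E := ⟨𝟙 E, 𝟙 E, 𝟙 E, 𝟙 E, by simp, by simp, by simp [h],
    by simp [h], by simp [h]⟩
  have h2 := K0.mk_add h1
  rwa [left_eq_add] at h2

theorem isoClass_out {C : Type*} [Category* C] (E : C) : Nonempty ((isoClass E).out ≅ E) :=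
  Quotient.mk_out (s := isIsomorphicSetoid C) E

theorem Bundle.IsIrr.congr {X : EqGerbe.{u} G} {E F : Bundle X} (e : E ≅ F)
    (h : Bundle.IsIrr E) : Bundle.IsIrr F := by
  rw [Bundle.IsIrr, ← finrank_hom_congr e e]
  exact h

/-! ### The character on the complexified Grothendieck group -/

namespace EqGerbe

variable (X : EqGerbe.{u} G)

/-- The twisted character on the Grothendieck group. -/
def chiK : K0 (Bundle X) →+ X.transgression.Flat :=
  K0.lift twChar twChar_congr twChar_add

/-- The twisted character on the complexified Grothendieck group. -/
def chiC : K0C (Bundle X) →ₗ[ℂ] X.transgression.Flat :=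
  LinearMap.liftBaseChange ℂ (chiK X).toIntLinearMap

variable {X}

@[simp] theorem chiK_mk (E : Bundle X) : chiK X (K0.mk E) = twChar E := K0.lift_mk _ _ _ E

@[simp] theorem chiC_tmul (c : ℂ) (a : K0 (Bundle X)) : chiC X (c ⊗ₜ a) = c • chiK X a := rfl

@[simp] theorem chiC_mk (E : Bundle X) : chiC X (K0C.mk E) = twChar E := by
  rw [K0C.mk, chiC_tmul, chiK_mk, one_smul]

/-- The isomorphism classes of irreducible bundles. -/
abbrev IrrClass (X : EqGerbe.{u} G) [Finite X.pt] : Type (u + 1) :=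
  {q : IsoClass (Bundle X) // Bundle.IsIrr q.out}

/-- Complete reducibility: by `Bundle.induction` the class of any bundle is a sum of irreducible
classes, a zero bundle contributing zero. -/
theorem span_irr [Finite X.pt] : Submodule.span ℂ (Set.range fun q : IrrClass X => K0C.mk q.1.out) = ⊤ := by
  rw [eq_top_iff]
  rintro a -
  induction a using TensorProduct.induction_on with
  | zero => exact zero_mem _
  | add a b ha hb => exact add_mem ha hb
  | tmul c a =>
    suffices (1 : ℂ) ⊗ₜ[ℤ] a ∈
        Submodule.span ℂ (Set.range fun q : IrrClass X => K0C.mk q.1.out) by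
      have h := Submodule.smul_mem _ c this
      rwa [TensorProduct.smul_tmul', smul_eq_mul, mul_one] at h
    induction a using K0.induction with
    | zero => rw [TensorProduct.tmul_zero]; exact zero_mem _
    | neg a h => rw [TensorProduct.tmul_neg]; exact neg_mem h
    | add a b ha hb => rw [TensorProduct.tmul_add]; exact add_mem ha hb
    | mk E =>
      induction E using Bundle.induction with
      | zero E h => rw [K0.mk_eq_zero h, TensorProduct.tmul_zero]; exact zero_mem _
      | irr E h =>
        obtain ⟨e⟩ := isoClass_out E
        rw [← K0.mk_eq e]
        exact Submodule.subset_span ⟨⟨isoClass E, h.congr e.symm⟩, rfl⟩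
      | sum W E F h hE hF =>
        rw [K0.mk_add h, TensorProduct.tmul_add]
        exact add_mem hE hF

variable [Finite G] [Finite X.pt]

theorem flatInner_add_right (s t t' : X.transgression.Flat) :
    UnitaryRep.flatInner _ s (t + t') =
      UnitaryRep.flatInner _ s t + UnitaryRep.flatInner _ s t' := by
  rw [← conj_flatInner, flatInner_add_left, map_add, conj_flatInner, conj_flatInner]

theorem flatInner_smul_right (c : ℂ) (s t : X.transgression.Flat) :
    UnitaryRep.flatInner _ s (c • t) = c * UnitaryRep.flatInner _ s t := by
  rw [← conj_flatInner, flatInner_smul_left, map_mul, conj_flatInner, Complex.conj_conj]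

/-- The inner product with a fixed flat section, as a linear form. -/
def flatForm (s : X.transgression.Flat) : X.transgression.Flat →ₗ[ℂ] ℂ where
  toFun t := UnitaryRep.flatInner _ s t
  map_add' := flatInner_add_right s
  map_smul' c t := flatInner_smul_right c s t

theorem flatForm_apply (s t : X.transgression.Flat) :
    flatForm s t = UnitaryRep.flatInner _ s t := rfl

theorem flatInner_zero_left (t : X.transgression.Flat) : UnitaryRep.flatInner _ 0 t = 0 := by
  rw [← conj_flatInner, ← flatForm_apply, map_zero, map_zero]

theorem flatInner_neg_left (s t : X.transgression.Flat) :
    UnitaryRep.flatInner _ (-s) t = -UnitaryRep.flatInner _ s t := by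
  rw [← conj_flatInner, ← flatForm_apply, map_neg, map_neg, flatForm_apply, conj_flatInner]

/-- Both sides are biadditive, so the identity reduces to classes of bundles, where it is
`Bundle.flatInner_twChar`. -/
theorem flatInner_chiK (a b : K0 (Bundle X)) :
    UnitaryRep.flatInner _ (chiK X a) (chiK X b) = homDim a b := by
  induction a using K0.induction with
  | zero => rw [map_zero, flatInner_zero_left, map_zero, AddMonoidHom.zero_apply]
  | neg a h => rw [map_neg, flatInner_neg_left, map_neg, AddMonoidHom.neg_apply, h]
  | add a a' h h' => rw [map_add, flatInner_add_left, map_add, AddMonoidHom.add_apply, h, h']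
  | mk E =>
    rw [← flatForm_apply]
    induction b using K0.induction with
    | zero => rw [map_zero, map_zero, map_zero]
    | neg a h => rw [map_neg, map_neg, map_neg, h]
    | add a a' h h' => rw [map_add, map_add, map_add, h, h']
    | mk F =>
      rw [chiK_mk, chiK_mk, flatForm_apply, Bundle.flatInner_twChar, homDim, K0.lift₂_mk]

/-- The twisted character is isometric. -/
theorem flatInner_chiC (a b : K0C (Bundle X)) :
    UnitaryRep.flatInner _ (chiC X a) (chiC X b) = K0C.form a b := by
  rw [K0C.form]
  induction a using TensorProduct.induction_on with
  | zero => rw [map_zero, flatInner_zero_left, map_zero, LinearMap.zero_apply]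
  | add a a' h h' => rw [map_add, flatInner_add_left, map_add, LinearMap.add_apply, h, h']
  | tmul c a =>
    rw [← flatForm_apply]
    induction b using TensorProduct.induction_on with
    | zero => rw [map_zero, map_zero, map_zero]
    | add b b' h h' => rw [map_add, map_add, map_add, h, h']
    | tmul d b =>
      rw [chiC_tmul, chiC_tmul, flatForm_apply, flatInner_smul_left, flatInner_smul_right,
        flatInner_chiK, sesqC_tmul, mul_assoc]

theorem flatInner_irr_self (q : IrrClass X) :
    UnitaryRep.flatInner _ (twChar q.1.out) (twChar q.1.out) = 1 := by
  rw [Bundle.flatInner_twChar, q.2, Nat.cast_one]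

theorem flatInner_irr_ne {q r : IrrClass X} (h : q ≠ r) :
    UnitaryRep.flatInner _ (twChar q.1.out) (twChar r.1.out) = 0 := by
  rw [Bundle.flatInner_twChar, q.2.finrank_hom r.2, Nat.cast_zero]
  by_contra hc
  rw [not_isEmpty_iff] at hc
  refine h (Subtype.ext ?_)
  rw [← Quotient.out_eq q.1, ← Quotient.out_eq r.1]
  exact isoClass_eq hc.some

/-- An element of the kernel is a combination of irreducible classes. Pairing its image with the
character of each irreducible bundle isolates one coefficient, by orthonormality. -/
theorem chiC_injective : Function.Injective (chiC X) := by
  rw [injective_iff_map_eq_zero]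
  intro a ha
  obtain ⟨l, rfl⟩ := (Finsupp.mem_span_range_iff_exists_finsupp (R := ℂ)
    (v := fun q : IrrClass X => K0C.mk q.1.out) (x := a)).1 (by rw [span_irr]; trivial)
  suffices l = 0 by rw [this, Finsupp.sum_zero_index]
  ext q
  have h := congrArg (flatForm (twChar q.1.out)) ha
  rw [Finsupp.sum, map_sum, map_sum, map_zero, Finset.sum_eq_single q] at h
  · rwa [map_smul, map_smul, chiC_mk, flatForm_apply, flatInner_irr_self, smul_eq_mul, mul_one]
      at h
  · intro r _ hr
    rw [map_smul, map_smul, chiC_mk, flatForm_apply, flatInner_irr_ne hr.symm, smul_zero]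
  · intro hq
    rw [Finsupp.notMem_support_iff.1 hq, zero_smul, map_zero, map_zero]

/-- The range is a subspace and contains all twisted characters, which span the flat sections. -/
theorem chiC_surjective : Function.Surjective (chiC X) := by
  rw [← LinearMap.range_eq_top, eq_top_iff, ← span_twChar, Submodule.span_le]
  rintro _ ⟨E, rfl⟩
  exact ⟨K0C.mk E, chiC_mk E⟩

/-- The twisted character isomorphism. -/
def chiEquiv (X : EqGerbe.{u} G) [Finite X.pt] :
    K0C (Bundle X) ≃ₗ[ℂ] X.transgression.Flat :=
  LinearEquiv.ofBijective (chiC X) ⟨chiC_injective, chiC_surjective⟩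

end EqGerbe

end TwistedCharacter

/-! ### Matrix elements of morphisms of geometric characters -/

section MatrixElements

open EqGerbe

variable {G : Type v} [Group G]

namespace EqGerbe

variable {Y X : EqGerbe.{u} G} {g g' : G}

theorem pairArrow_rot_left {y : Fix Y.pt g} {x : Fix X.pt g} (z : Circle) (v : Y.Loops y.loop)
    (u : X.Loops x.loop) : pairArrow (z • v) u = z • pairArrow v u :=
  Subtype.ext (kArr_rot_left v.1 u.1 (v.2.trans u.2.symm) z)

theorem pairArrow_rot_right {y : Fix Y.pt g} {x : Fix X.pt g} (z : Circle) (v : Y.Loops y.loop)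
    (u : X.Loops x.loop) : pairArrow v (z • u) = z⁻¹ • pairArrow v u :=
  Subtype.ext (kArr_rot_right v.1 u.1 (v.2.trans u.2.symm) z)

/-- Transport may be computed with any arrow over `h`; the product arrow `s ⊗ t̄` conjugates the two
factors separately. -/
theorem conjLoop_pairArrow {y : Fix Y.pt g} {x : Fix X.pt g} {y' : Fix Y.pt g'}
    {x' : Fix X.pt g'} (h : pairLoop y x ⟶ pairLoop y' x') (a : y.loop ⟶ y'.loop)
    (b : x.loop ⟶ x'.loop) (ha : a.1 = h.1) (hb : b.1 = h.1) (v : Y.Loops y.loop)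
    (u : X.Loops x.loop) :
    conjLoop h (pairArrow v u) = pairArrow (conjLoop a v) (conjLoop b u) := by
  obtain ⟨s, hs⟩ := Y.exists_arrow a.1 y.1 y'.1 a.2.1
  obtain ⟨t, ht⟩ := X.exists_arrow b.1 x.1 x'.1 b.2.1
  rw [conjLoop_eq a s hs, conjLoop_eq b t ht,
    conjLoop_eq h (kArr s t (by rw [hs, ht, ha, hb])) ((deg_kArr _ _ _).trans (hs.trans ha))]
  rfl

/-- The map `a ↦ u ⊗ a` as a linear map. -/
def loopVecLin {p : LoopPt G X.pt} (u : X.Loops p) : ℂ →ₗ[ℂ] X.transgression.fiber p :=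
  (TorsorLine.coord u).symm.toLinearMap

@[simp] theorem loopVecLin_apply {p : LoopPt G X.pt} (u : X.Loops p) (a : ℂ) :
    loopVecLin u a = loopVec u a := rfl

theorem loopCoord_tr {p q : LoopPt G X.pt} (h : p ⟶ q) (u : X.Loops p)
    (a : X.transgression.fiber p) :
    loopCoord (conjLoop h u) (X.transgression.tr h a) = loopCoord u a := by
  conv_lhs => rw [← loopVec_loopCoord u a, tr_loopVec, loopCoord_loopVec]

end EqGerbe

theorem sqrt_k_ne_zero (X : MGerbe.{u} G) (x : X.pt) : (Real.sqrt (X.k x) : ℂ) ≠ 0 :=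
  Complex.ofReal_ne_zero.2 (Real.sqrt_pos.2 (X.k x).2).ne'

theorem sqrt_k_mul_self (X : MGerbe.{u} G) (x : X.pt) :
    (Real.sqrt (X.k x) : ℂ) * (Real.sqrt (X.k x) : ℂ) = ((X.k x : ℝ) : ℂ) := by
  rw [← Complex.ofReal_mul, Real.mul_self_sqrt (X.k x).2.le]

/-! ### Localized vectors as an orthonormal basis -/

section ChObj

variable {X : MGerbe.{u} G} {g : G}

/-- The section supported at a fixed point with a given value. -/
def chSingle (x : Fix X.pt g) : X.transgression.fiber x.loop →ₗ[ℂ] (chObj X).fiber ⟨g⟩ :=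
  WSum.single (wt := fun x : Fix X.pt g => X.k x.1)
    (V := fun x : Fix X.pt g => X.transgression.fiber x.loop) x

theorem evalAt_chSingle (x : Fix X.pt g) (a : X.transgression.fiber x.loop) :
    evalAt x (chSingle x a) = a :=
  WSum.proj_single_same (wt := fun x : Fix X.pt g => X.k x.1)
    (V := fun x : Fix X.pt g => X.transgression.fiber x.loop) x a

theorem evalAt_chSingle_ne {x y : Fix X.pt g} (h : x ≠ y) (a : X.transgression.fiber x.loop) :
    evalAt y (chSingle x a) = 0 :=
  WSum.proj_single_ne (wt := fun x : Fix X.pt g => X.k x.1)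
    (V := fun x : Fix X.pt g => X.transgression.fiber x.loop) h a

theorem sum_chSingle_evalAt [Fintype (Fix X.pt g)] (ψ : (chObj X).fiber ⟨g⟩) :
    ∑ x, chSingle x (evalAt x ψ) = ψ :=
  WSum.sum_single_proj (wt := fun x : Fix X.pt g => X.k x.1)
    (V := fun x : Fix X.pt g => X.transgression.fiber x.loop) ψ

theorem locVec_eq (x : Fix X.pt g) (u : X.Loops x.loop) :
    locVec x u = chSingle x (loopVec u (1 / (Real.sqrt (X.k x.1) : ℂ))) := rfl

theorem chSingle_loopVec (x : Fix X.pt g) (u : X.Loops x.loop) (a : ℂ) :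
    chSingle x (loopVec u a) = ((Real.sqrt (X.k x.1) : ℂ) * a) • locVec x u := by
  rw [locVec_eq, ← map_smul, ← loopVec_smul]
  congr 2
  field_simp [sqrt_k_ne_zero X x.1]

theorem locVec_rot (x : Fix X.pt g) (z : Circle) (u : X.Loops x.loop) :
    locVec x (z • u) = (z : ℂ) • locVec x u := by
  rw [locVec_eq, locVec_eq, loopVec_rot, loopVec_smul, map_smul]

theorem inner_chSingle (x : Fix X.pt g) (a : X.transgression.fiber x.loop)
    (ψ : (chObj X).fiber ⟨g⟩) :
    inner ℂ (chSingle x a) ψ = ((X.k x.1 : ℝ) : ℂ) * inner ℂ a (evalAt x ψ) :=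
  WSum.inner_single (wt := fun x : Fix X.pt g => X.k x.1)
    (V := fun x : Fix X.pt g => X.transgression.fiber x.loop) x a ψ

/-- The weight `k` of the inner product times the factor `1 / √k` of the vector leaves `√k`. -/
theorem inner_locVec (x : Fix X.pt g) (u : X.Loops x.loop) (ψ : (chObj X).fiber ⟨g⟩) :
    inner ℂ (locVec x u) ψ = (Real.sqrt (X.k x.1) : ℂ) * loopCoord u (evalAt x ψ) := by
  rw [locVec_eq, inner_chSingle, inner_eq_loopCoord u, loopCoord_loopVec, ← sqrt_k_mul_self]
  have := sqrt_k_ne_zero X x.1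
  rw [map_div₀, map_one, Complex.conj_ofReal]
  field_simp

theorem inner_chFiber [Fintype (Fix X.pt g)] (ψ φ : (chObj X).fiber ⟨g⟩) :
    inner ℂ ψ φ = ∑ x : Fix X.pt g, ((X.k x.1 : ℝ) : ℂ) * inner ℂ (evalAt x ψ) (evalAt x φ) :=
  WSum.inner_eq_sum (wt := fun x : Fix X.pt g => X.k x.1)
    (V := fun x : Fix X.pt g => X.transgression.fiber x.loop) ψ φ

/-- The localized unit vectors form an orthonormal basis. -/
theorem inner_eq_sum_locVec [Fintype (Fix X.pt g)] (u : ∀ x : Fix X.pt g, X.Loops x.loop)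
    (ψ φ : (chObj X).fiber ⟨g⟩) :
    inner ℂ ψ φ = ∑ x, conj (inner ℂ (locVec x (u x)) ψ) * inner ℂ (locVec x (u x)) φ := by
  rw [inner_chFiber]
  refine Finset.sum_congr rfl fun x _ => ?_
  rw [inner_locVec, inner_locVec, inner_eq_loopCoord (u x), ← sqrt_k_mul_self, map_mul,
    Complex.conj_ofReal]
  ring

theorem eq_sum_locVec [Fintype (Fix X.pt g)] (u : ∀ x : Fix X.pt g, X.Loops x.loop)
    (ψ : (chObj X).fiber ⟨g⟩) : ψ = ∑ x, (inner ℂ (locVec x (u x)) ψ : ℂ) • locVec x (u x) := by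
  conv_lhs => rw [← sum_chSingle_evalAt ψ]
  refine Finset.sum_congr rfl fun x _ => ?_
  rw [inner_locVec, ← chSingle_loopVec, loopVec_loopCoord]

theorem trace_chFiber [Fintype (Fix X.pt g)] (u : ∀ x : Fix X.pt g, X.Loops x.loop)
    (T : (chObj X).fiber ⟨g⟩ →ₗ[ℂ] (chObj X).fiber ⟨g⟩) :
    LinearMap.trace ℂ _ T = ∑ x, inner ℂ (locVec x (u x)) (T (locVec x (u x))) := by
  refine (WSum.trace_eq_sum (wt := fun x : Fix X.pt g => X.k x.1)
    (V := fun x : Fix X.pt g => X.transgression.fiber x.loop) T).trans ?_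
  refine Finset.sum_congr rfl fun x _ => ?_
  rw [inner_locVec]
  change LinearMap.trace ℂ (X.transgression.fiber x.loop) (evalAt x ∘ₗ T ∘ₗ chSingle x) = _
  -- The line over `x` is one-dimensional, so the diagonal block factors through the coordinate in
  -- `ℂ` and cyclicity reduces its trace to one number.
  have h : evalAt x ∘ₗ T ∘ₗ chSingle x = (evalAt x ∘ₗ T ∘ₗ chSingle x ∘ₗ
      loopVecLin (u x)) ∘ₗ loopCoord (u x) :=
    LinearMap.ext fun a => by
      simp only [LinearMap.comp_apply, loopVecLin_apply, loopVec_loopCoord]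
  rw [h, LinearMap.trace_comp_comm']
  have h2 : ∀ A : ℂ →ₗ[ℂ] ℂ, LinearMap.trace ℂ ℂ A = A 1 := fun A => by
    rw [LinearMap.trace_eq_sum_inner A (OrthonormalBasis.singleton Unit ℂ)]
    simp
  rw [h2]
  have h3 : chSingle x (loopVec (u x) 1) = (Real.sqrt (X.k x.1) : ℂ) • locVec x (u x) := by
    rw [chSingle_loopVec, mul_one]
  change loopCoord (u x) (evalAt x (T (chSingle x (loopVec (u x) 1)))) = _
  rw [h3, map_smul, map_smul, map_smul, smul_eq_mul]

theorem k_eq_of_arrow {p q : LoopPt G X.pt} (h : p ⟶ q) : X.k q.pt = X.k p.pt := by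
  rw [← h.2.1, X.k_smul]

theorem tr_chSingle {p q : LoopBG G} (h : p ⟶ q) (x : Fix X.pt p.elt) (x' : Fix X.pt q.elt)
    (f : x.loop ⟶ x'.loop) (hf : f.1 = h.1) (a : X.transgression.fiber x.loop) :
    (chObj X).tr h (chSingle x a) = chSingle x' (X.transgression.tr f a) :=
  pushMap_single X.k X.transgression h x x' f hf a

/-- The metric is `G`-invariant, so source and target have the same normalization factor and
transport permutes the localized vectors. -/
theorem tr_locVec {p q : LoopBG G} (h : p ⟶ q) (x : Fix X.pt p.elt) (x' : Fix X.pt q.elt)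
    (f : x.loop ⟶ x'.loop) (hf : f.1 = h.1) (u : X.Loops x.loop) :
    (chObj X).tr h (locVec x u) = locVec x' (conjLoop f u) := by
  rw [locVec_eq, tr_chSingle h x x' f hf, tr_loopVec, locVec_eq, k_eq_of_arrow f]

theorem inner_tr_chObj {p q : LoopBG G} (h : p ⟶ q) (ψ φ : (chObj X).fiber p) :
    inner ℂ ((chObj X).tr h ψ) ((chObj X).tr h φ) = inner ℂ ψ φ :=
  ((chObj X).property h).inner_map ψ φ

end ChObj

/-! ### Matrix elements between localized vectors -/

variable {X Y Z : MGerbe.{u} G} {g : G}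

/-- The matrix elements of a morphism between localized unit vectors. -/
def matEl (f : chObj X ⟶ chObj Y) (x : Fix X.pt g) (y : Fix Y.pt g) (u : X.Loops x.loop)
    (v : Y.Loops y.loop) : ℂ :=
  inner ℂ (locVec y v) (UnitaryRep.component f ⟨g⟩ (locVec x u))

theorem matEl_rot_left (f : chObj X ⟶ chObj Y) (x : Fix X.pt g) (y : Fix Y.pt g) (z : Circle)
    (u : X.Loops x.loop) (v : Y.Loops y.loop) :
    matEl f x y (z • u) v = z * matEl f x y u v := by
  rw [matEl, locVec_rot, map_smul, inner_smul_right, matEl]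

theorem matEl_rot_right (f : chObj X ⟶ chObj Y) (x : Fix X.pt g) (y : Fix Y.pt g) (z : Circle)
    (u : X.Loops x.loop) (v : Y.Loops y.loop) :
    matEl f x y u (z • v) = ((z⁻¹ : Circle) : ℂ) * matEl f x y u v := by
  rw [matEl, locVec_rot, inner_smul_left, matEl, Circle.coe_inv_eq_conj]

theorem component_tr (f : chObj X ⟶ chObj Y) {p q : LoopBG G} (h : p ⟶ q)
    (ψ : (chObj X).fiber p) : UnitaryRep.component f q ((chObj X).tr h ψ) =
      (chObj Y).tr h (UnitaryRep.component f p ψ) :=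
  LinearMap.congr_fun (congrArg FinHilb.lin (f.hom.naturality h)) ψ

/-- Naturality of `f` brings the transport outside on both sides of the inner product, where
unitarity removes it. In terms of sections this is flatness. -/
theorem matEl_conjLoop (f : chObj X ⟶ chObj Y) {p q : LoopBG G} (h : p ⟶ q)
    {x : Fix X.pt p.elt} {x' : Fix X.pt q.elt} {y : Fix Y.pt p.elt} {y' : Fix Y.pt q.elt}
    (a : x.loop ⟶ x'.loop) (b : y.loop ⟶ y'.loop) (ha : a.1 = h.1) (hb : b.1 = h.1)
    (u : X.Loops x.loop) (v : Y.Loops y.loop) :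
    matEl f x' y' (conjLoop a u) (conjLoop b v) = matEl f x y u v := by
  rw [matEl, ← tr_locVec h x x' a ha, ← tr_locVec h y y' b hb]
  exact (congrArg (inner ℂ _) (component_tr f h _)).trans (inner_tr_chObj h _ _)

/-- The localized vectors span both fibres. The elements `g` and `g'` are kept separate so that the
criterion also applies to the two sides of a naturality square. -/
theorem chLin_ext {g' : G} {S T : (chObj X).fiber ⟨g⟩ →ₗ[ℂ] (chObj Y).fiber ⟨g'⟩}
    (h : ∀ (x : Fix X.pt g) (y : Fix Y.pt g') (u : X.Loops x.loop) (v : Y.Loops y.loop),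
      inner ℂ (locVec y v) (S (locVec x u)) = (inner ℂ (locVec y v) (T (locVec x u)) : ℂ)) :
    S = T := by
  have := Fintype.ofFinite (Fix X.pt g)
  have := Fintype.ofFinite (Fix Y.pt g')
  refine LinearMap.ext fun ψ => ?_
  rw [eq_sum_locVec (fun x => TorsorLine.base _) ψ, map_sum, map_sum]
  refine Finset.sum_congr rfl fun x _ => ?_
  rw [map_smul, map_smul, eq_sum_locVec (fun y => TorsorLine.base _) (S _),
    eq_sum_locVec (fun y => TorsorLine.base _) (T _)]
  simp only [h]

theorem chHom_ext {f f' : chObj X ⟶ chObj Y}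
    (h : ∀ (g : G) (x : Fix X.pt g) (y : Fix Y.pt g) (u : X.Loops x.loop) (v : Y.Loops y.loop),
      matEl f x y u v = matEl f' x y u v) : f = f' :=
  ObjectProperty.hom_ext _ <| NatTrans.ext <| funext fun p => FinHilb.hom_ext <|
    chLin_ext (g := p.elt) (g' := p.elt) (h p.elt)

theorem matEl_add (f f' : chObj X ⟶ chObj Y) (x : Fix X.pt g) (y : Fix Y.pt g)
    (u : X.Loops x.loop) (v : Y.Loops y.loop) :
    matEl (f + f') x y u v = matEl f x y u v + matEl f' x y u v :=
  inner_add_right (𝕜 := ℂ) _ _ _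

theorem matEl_smul (c : ℂ) (f : chObj X ⟶ chObj Y) (x : Fix X.pt g) (y : Fix Y.pt g)
    (u : X.Loops x.loop) (v : Y.Loops y.loop) :
    matEl (c • f) x y u v = c * matEl f x y u v :=
  inner_smul_right (𝕜 := ℂ) _ _ _

theorem matEl_id_self (x : Fix X.pt g) (z : Circle) (u : X.Loops x.loop) :
    matEl (𝟙 (chObj X)) x x u (z • u) = ((z⁻¹ : Circle) : ℂ) := by
  rw [matEl_rot_right, matEl, inner_locVec]
  change _ * (_ * loopCoord u (evalAt x (locVec x u))) = _
  rw [locVec_eq, evalAt_chSingle, loopCoord_loopVec, mul_one_div_cancel (sqrt_k_ne_zero _ _),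
    mul_one]

theorem matEl_id_ne {x y : Fix X.pt g} (h : x ≠ y) (u : X.Loops x.loop) (v : X.Loops y.loop) :
    matEl (𝟙 (chObj X)) x y u v = 0 := by
  rw [matEl, inner_locVec]
  change _ * loopCoord v (evalAt y (locVec x u)) = 0
  rw [locVec_eq, evalAt_chSingle_ne h, map_zero, mul_zero]

/-- Matrix multiplication: the image of `locVec x u` is expanded in the orthonormal basis of the
middle fibre, which is indexed by the fixed points of `g`. -/
theorem matEl_comp [Fintype (Fix Y.pt g)] (f : chObj X ⟶ chObj Y) (f' : chObj Y ⟶ chObj Z)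
    (x : Fix X.pt g) (z : Fix Z.pt g) (u : X.Loops x.loop) (w : Z.Loops z.loop)
    (v : ∀ y : Fix Y.pt g, Y.Loops y.loop) :
    matEl (f ≫ f') x z u w = ∑ y, matEl f' y z (v y) w * matEl f x y u (v y) := by
  change inner ℂ (locVec z w) (UnitaryRep.component f' ⟨g⟩
    (UnitaryRep.component f ⟨g⟩ (locVec x u))) = _
  rw [eq_sum_locVec v (UnitaryRep.component f ⟨g⟩ (locVec x u)), map_sum, inner_sum]
  refine Finset.sum_congr rfl fun y _ => ?_
  rw [map_smul, inner_smul_right, mul_comm]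
  rfl

/-- Together with `isRearrangement_iff` this identifies the character of a kernel with the
rearrangement of its twisted character: both conditions equate matrix elements with coordinates of a
flat section. -/
theorem isGeometricChar_iff (E : Kernel X.toEqGerbe Y.toEqGerbe) (f : chObj X ⟶ chObj Y) :
    IsGeometricChar E f ↔ ∀ (g : G) (x : Fix X.pt g) (y : Fix Y.pt g) (u : X.Loops x.loop)
      (v : Y.Loops y.loop), matEl f x y u v =
        loopCoord (pairArrow v u) ((twChar E).1 (pairLoop y x)) := by
  simp only [loopCoord_twChar]
  rfl

theorem isRearrangement_iff (ξ : (Y.ker X.toEqGerbe).transgression.Flat)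
    (f : chObj X ⟶ chObj Y) :
    IsRearrangement ξ f ↔ ∀ (g : G) (x : Fix X.pt g) (y : Fix Y.pt g) (u : X.Loops x.loop)
      (v : Y.Loops y.loop), matEl f x y u v =
        loopCoord (pairArrow v u) (ξ.1 (pairLoop y x)) := by
  refine forall₅_congr fun g x y u v => ?_
  -- Pairing with `locVec y v` gives `√k` times the coordinate, which cancels the prefactor `1 / √k`
  -- in the prescribed value.
  have := sqrt_k_ne_zero Y y.1
  rw [matEl, inner_locVec, ← (loopCoord_injective v).eq_iff, loopCoord_loopVec,
    one_div_mul_eq_div, eq_div_iff this, mul_comm]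

end MatrixElements

/-! ### The rearrangement of flat sections into morphisms -/

section Rearrangement

open EqGerbe

variable {G : Type v} [Group G]

namespace EqGerbe

variable {Y X : EqGerbe.{u} G} {g g' : G}

/-- These are the factors by which a matrix element changes: conjugate-linear in the vector of the
target, linear in the vector of the source. -/
theorem loopCoord_pairArrow_rot {y : Fix Y.pt g} {x : Fix X.pt g} (z w : Circle)
    (v : Y.Loops y.loop) (u : X.Loops x.loop) (s : (Y.ker X).transgression.fiber (pairLoop y x)) :
    loopCoord (pairArrow (z • v) (w • u)) s =
      ((z⁻¹ : Circle) : ℂ) * (w * loopCoord (pairArrow v u) s) := by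
  rw [pairArrow_rot_left, pairArrow_rot_right, loopCoord_rot, loopCoord_rot, inv_inv]

/-- This is flatness of `ξ` in the form of `matEl_conjLoop`; it will make the rearranged maps
equivariant. -/
theorem loopCoord_pairArrow_conjLoop (ξ : (Y.ker X).transgression.Flat) {y : Fix Y.pt g}
    {x : Fix X.pt g} {y' : Fix Y.pt g'} {x' : Fix X.pt g'} (a : x.loop ⟶ x'.loop)
    (b : y.loop ⟶ y'.loop) (e : b.1 = a.1) (u : X.Loops x.loop) (v : Y.Loops y.loop) :
    loopCoord (pairArrow (conjLoop b v) (conjLoop a u)) (ξ.1 (pairLoop y' x')) =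
      loopCoord (pairArrow v u) (ξ.1 (pairLoop y x)) := by
  let h : pairLoop y x ⟶ pairLoop y' x' :=
    ⟨b.1, TensorPt.ext' b.2.1 ((congrArg (· • x.1) e).trans a.2.1), b.2.2⟩
  rw [← conjLoop_pairArrow h b a rfl e.symm, loopCoord_conjLoop]

theorem conjLoop_conjLoop_inv {p q : LoopPt G X.pt} (h : p ⟶ q) (u : X.Loops q) :
    conjLoop h (conjLoop (Groupoid.inv h) u) = u := by
  obtain ⟨s, hs⟩ := X.exists_arrow h.1 p.pt q.pt h.2.1
  rw [conjLoop_eq h s hs, conjLoop_eq (Groupoid.inv h) (Groupoid.inv s)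
    (by rw [deg_inv, hs]; rfl)]
  refine Subtype.ext ?_
  change Groupoid.inv s ≫ (Groupoid.inv (Groupoid.inv s) ≫ u.1 ≫ Groupoid.inv s) ≫ s = u.1
  simp

/-- The first component of a loop in `Y ⊗ X̄`. -/
def loopFst (p : LoopPt G (Y.ker X).pt) : Fix Y.pt p.elt :=
  ⟨p.pt.fst, congrArg TensorPt.fst p.fix⟩

/-- The second component of a loop in `Y ⊗ X̄`. -/
def loopSnd (p : LoopPt G (Y.ker X).pt) : Fix X.pt p.elt :=
  ⟨p.pt.snd, congrArg TensorPt.snd p.fix⟩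

theorem pairLoop_ind {motive : LoopPt G (Y.ker X).pt → Prop}
    (H : ∀ (g : G) (x : Fix X.pt g) (y : Fix Y.pt g), motive (pairLoop y x))
    (p : LoopPt G (Y.ker X).pt) : motive p := H p.elt (loopSnd p) (loopFst p)

/-- Loops in `Y ⊗ X̄` are pairs of fixed points. -/
def pairLoopEquiv (Y X : EqGerbe.{u} G) :
    LoopPt G (Y.ker X).pt ≃ Σ p : LoopBG G, Fix X.pt p.elt × Fix Y.pt p.elt where
  toFun p := ⟨⟨p.elt⟩, loopSnd p, loopFst p⟩
  invFun q := pairLoop q.2.2 q.2.1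
  left_inv _ := rfl
  right_inv _ := rfl

/-- A reference element of the torsor of arrows over a loop in `Y ⊗ X̄`. -/
def basePair (p : LoopPt G (Y.ker X).pt) : (Y.ker X).Loops p :=
  pairArrow (TorsorLine.base (Y.Loops (loopFst p).loop)) (TorsorLine.base (X.Loops (loopSnd p).loop))

theorem pairFlat_ext {s t : (Y.ker X).transgression.Flat}
    (h : ∀ (g : G) (x : Fix X.pt g) (y : Fix Y.pt g) (u : X.Loops x.loop) (v : Y.Loops y.loop),
      loopCoord (pairArrow v u) (s.1 (pairLoop y x)) =
        loopCoord (pairArrow v u) (t.1 (pairLoop y x))) : s = t := by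
  refine Subtype.ext (funext fun p => ?_)
  induction p using pairLoop_ind with
  | H g x y =>
    exact loopCoord_injective (pairArrow (TorsorLine.base _) (TorsorLine.base _)) (h g x y _ _)

end EqGerbe

variable {X Y Z : MGerbe.{u} G} {g : G}

theorem inner_locVec_self (x : Fix X.pt g) (u : X.Loops x.loop) :
    (inner ℂ (locVec x u) (locVec x u) : ℂ) = 1 := by
  have h := matEl_id_self x 1 u
  rw [one_smul, inv_one, Circle.coe_one] at h
  exact h

theorem inner_locVec_ne {x y : Fix X.pt g} (h : x ≠ y) (u : X.Loops x.loop) (v : X.Loops y.loop) :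
    (inner ℂ (locVec y v) (locVec x u) : ℂ) = 0 := matEl_id_ne h u v

/-- The linear map between fibers of geometric characters given by a flat section. -/
def hatFib (ξ : (Y.ker X.toEqGerbe).transgression.Flat) (g : G) :
    (chObj X).fiber ⟨g⟩ →ₗ[ℂ] (chObj Y).fiber ⟨g⟩ :=
  letI := Fintype.ofFinite (Fix X.pt g)
  letI := Fintype.ofFinite (Fix Y.pt g)
  ∑ x : Fix X.pt g, ∑ y : Fix Y.pt g, (innerₛₗ ℂ (locVec x (TorsorLine.base _))).smulRight
    (loopCoord (pairArrow (TorsorLine.base _) (TorsorLine.base _)) (ξ.1 (pairLoop y x)) •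
      locVec y (TorsorLine.base _))

theorem inner_hatFib (ξ : (Y.ker X.toEqGerbe).transgression.Flat) (x : Fix X.pt g)
    (y : Fix Y.pt g) (u : X.Loops x.loop) (v : Y.Loops y.loop) :
    inner ℂ (locVec y v) (hatFib ξ g (locVec x u)) =
      loopCoord (pairArrow v u) (ξ.1 (pairLoop y x)) := by
  -- Both sides respond in the same way to phases of `u` and `v`, so it suffices to compare them at
  -- the reference arrows, where `hatFib` is defined.
  obtain ⟨z, rfl⟩ := exists_smul_eq (TorsorLine.base _) v
  obtain ⟨w, rfl⟩ := exists_smul_eq (TorsorLine.base _) u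
  rw [loopCoord_pairArrow_rot, locVec_rot, locVec_rot, inner_smul_left, map_smul,
    inner_smul_right, Circle.coe_inv_eq_conj]
  congr 2
  let _ := Fintype.ofFinite (Fix X.pt g)
  let _ := Fintype.ofFinite (Fix Y.pt g)
  simp only [hatFib, LinearMap.sum_apply, inner_sum, LinearMap.smulRight_apply, innerₛₗ_apply_apply,
    inner_smul_right]
  rw [Finset.sum_eq_single x, Finset.sum_eq_single y]
  · rw [inner_locVec_self, inner_locVec_self, one_mul, mul_one]
  · intro y' _ hy
    rw [inner_locVec_ne hy, mul_zero, mul_zero]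
  · simp
  · intro x' _ hx
    refine Finset.sum_eq_zero fun y' _ => ?_
    rw [inner_locVec_ne hx.symm, zero_mul]
  · simp

/-- The morphism of geometric characters given by a flat section. -/
def hat (ξ : (Y.ker X.toEqGerbe).transgression.Flat) : chObj X ⟶ chObj Y :=
  ObjectProperty.homMk
    { app := fun p => FinHilb.ofLin (hatFib ξ p.elt)
      naturality := fun p q h => FinHilb.hom_ext <|
        chLin_ext (g := p.elt) (g' := q.elt) fun x y' u v' => by
          -- The target fixed point `y'` and its arrow `v'` are transported back along `h`. Both
          -- paths of the naturality square can then be tested against the same localized vector.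
          let y : Fix Y.pt p.elt := y'.move (Groupoid.inv h)
          let b : y.loop ⟶ y'.loop := ⟨h.1, smul_inv_smul h.1 y'.1, h.2⟩
          have h1 := conjLoop_conjLoop_inv b v'
          rw [← h1]
          change inner ℂ _ (hatFib ξ q.elt ((chObj X).tr h (locVec x u))) =
            inner ℂ _ ((chObj Y).tr h (hatFib ξ p.elt (locVec x u)))
          rw [tr_locVec h x (x.move h) (x.arrow h) rfl, ← tr_locVec h y y' b rfl]
          -- Unitarity of the transport removes `h` from the right side, which becomes a coordinate
          -- of `ξ` at the untransported loop; flatness identifies it with the left side.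
          refine Eq.trans ?_ (inner_tr_chObj h _ _).symm
          refine Eq.trans ?_ (inner_hatFib ξ x y u (conjLoop (Groupoid.inv b) v')).symm
          rw [tr_locVec h y y' b rfl]
          refine (inner_hatFib ξ (x.move h) y' _ _).trans ?_
          rw [loopCoord_pairArrow_conjLoop ξ (x.arrow h) b rfl] }

theorem matEl_hat (ξ : (Y.ker X.toEqGerbe).transgression.Flat) (x : Fix X.pt g)
    (y : Fix Y.pt g) (u : X.Loops x.loop) (v : Y.Loops y.loop) :
    matEl (hat ξ) x y u v = loopCoord (pairArrow v u) (ξ.1 (pairLoop y x)) :=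
  inner_hatFib ξ x y u v

theorem isRearrangement_iff_eq_hat (ξ : (Y.ker X.toEqGerbe).transgression.Flat)
    (f : chObj X ⟶ chObj Y) : IsRearrangement ξ f ↔ f = hat ξ := by
  rw [isRearrangement_iff]
  constructor
  · intro h
    exact chHom_ext fun g x y u v => by rw [h, matEl_hat]
  · rintro rfl g x y u v
    exact matEl_hat ξ x y u v

/-- Matrix elements and coordinates have the same dependence on phases. The section assembled from
matrix elements is therefore independent of the reference arrows. -/
theorem matEl_eq_loopCoord (f : chObj X ⟶ chObj Y) (x : Fix X.pt g) (y : Fix Y.pt g)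
    (u u' : X.Loops x.loop) (v v' : Y.Loops y.loop) :
    matEl f x y u v = loopCoord (pairArrow v u) (loopVec (pairArrow v' u') (matEl f x y u' v')) := by
  obtain ⟨z, rfl⟩ := exists_smul_eq v' v
  obtain ⟨w, rfl⟩ := exists_smul_eq u' u
  rw [loopCoord_pairArrow_rot, loopCoord_loopVec, matEl_rot_left, matEl_rot_right]
  ring

/-- The section given by the matrix elements of a morphism of geometric characters. -/
def matSection (f : chObj X ⟶ chObj Y) (p : LoopPt G (Y.ker X.toEqGerbe).pt) :
    (Y.ker X.toEqGerbe).transgression.fiber p :=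
  loopVec (basePair p) (matEl f (loopSnd p) (loopFst p) (TorsorLine.base _) (TorsorLine.base _))

theorem loopCoord_matSection (f : chObj X ⟶ chObj Y) (x : Fix X.pt g) (y : Fix Y.pt g)
    (u : X.Loops x.loop) (v : Y.Loops y.loop) :
    loopCoord (pairArrow v u) (matSection f (pairLoop y x)) = matEl f x y u v := by
  rw [matEl_eq_loopCoord f x y u (TorsorLine.base _) v (TorsorLine.base _)]
  rfl

/-- An arrow of loops in `Y ⊗ X̄` is one element of `G` that moves both fixed points, so flatness
reduces to the conjugation invariance `matEl_conjLoop`. -/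
theorem tr_matSection (f : chObj X ⟶ chObj Y) {p q : LoopPt G (Y.ker X.toEqGerbe).pt}
    (h : p ⟶ q) :
    (Y.ker X.toEqGerbe).transgression.tr h (matSection f p) = matSection f q := by
  induction p using pairLoop_ind with
  | H g x y =>
    induction q using pairLoop_ind with
    | H g' x' y' =>
      let a : x.loop ⟶ x'.loop := ⟨h.1, congrArg TensorPt.snd h.2.1, h.2.2⟩
      let b : y.loop ⟶ y'.loop := ⟨h.1, congrArg TensorPt.fst h.2.1, h.2.2⟩
      let k : (⟨g⟩ : LoopBG G) ⟶ ⟨g'⟩ := ⟨h.1, h.2.2⟩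
      have u := TorsorLine.base (X.Loops x.loop)
      have v := TorsorLine.base (Y.Loops y.loop)
      refine loopCoord_injective (conjLoop h (pairArrow v u)) ?_
      rw [loopCoord_tr, conjLoop_pairArrow h b a rfl rfl, loopCoord_matSection,
        loopCoord_matSection]
      exact (matEl_conjLoop f k a b rfl rfl u v).symm

/-- The flat section given by the matrix elements of a morphism of geometric characters. -/
def unhat (f : chObj X ⟶ chObj Y) : (Y.ker X.toEqGerbe).transgression.Flat :=
  ⟨matSection f, tr_matSection f⟩

theorem loopCoord_unhat (f : chObj X ⟶ chObj Y) (x : Fix X.pt g) (y : Fix Y.pt g)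
    (u : X.Loops x.loop) (v : Y.Loops y.loop) :
    loopCoord (pairArrow v u) ((unhat f).1 (pairLoop y x)) = matEl f x y u v :=
  loopCoord_matSection f x y u v

/-- The rearrangement of flat sections into morphisms of geometric characters. -/
def hatEquiv (X Y : MGerbe.{u} G) :
    (Y.ker X.toEqGerbe).transgression.Flat ≃ₗ[ℂ] (chObj X ⟶ chObj Y) where
  toFun := hat
  invFun := unhat
  map_add' ξ ζ := chHom_ext fun g x y u v => by
    rw [matEl_add, matEl_hat, matEl_hat, matEl_hat]
    exact map_add (loopCoord (pairArrow v u)) _ _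
  map_smul' c ξ := chHom_ext fun g x y u v => by
    rw [RingHom.id_apply, matEl_smul, matEl_hat, matEl_hat]
    exact map_smul (loopCoord (pairArrow v u)) _ _
  left_inv ξ := pairFlat_ext fun g x y u v => by rw [loopCoord_unhat, matEl_hat]
  right_inv f := chHom_ext fun g x y u v => by rw [matEl_hat, loopCoord_unhat]

/-- The rearrangement is isometric. -/
theorem homInner_hat [Finite G] (ξ ζ : (Y.ker X.toEqGerbe).transgression.Flat) :
    UnitaryRep.homInner (hat ξ) (hat ζ) = UnitaryRep.flatInner _ ξ ζ := by
  have := Fintype.ofFinite (LoopBG G)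
  have := Fintype.ofFinite (LoopPt G (Y.ker X.toEqGerbe).pt)
  have := fun g : G => Fintype.ofFinite (Fix X.pt g)
  have := fun g : G => Fintype.ofFinite (Fix Y.pt g)
  -- A loop of `Y ⊗ X̄` is an element of `G` with a pair of fixed points, so the sum over loops
  -- splits into a double sum for each `g`, with the same weight `1 / |G|` as on `ΛBG`.
  rw [UnitaryRep.homInner, finsum_eq_sum_of_fintype,
    flatInner_eq_sum ξ ζ basePair,
    ← (pairLoopEquiv Y.toEqGerbe X.toEqGerbe).symm.sum_comp, Fintype.sum_sigma, Finset.mul_sum]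
  refine Finset.sum_congr rfl fun p _ => ?_
  rw [numArrows_loopBG, div_eq_inv_mul, Fintype.sum_prod_type]
  congr 1
  -- In the orthonormal bases the trace of `f† f'` is the sum of `conj (f_yx) * f'_yx` over all
  -- matrix entries.
  refine (trace_chFiber (g := p.elt) (fun x => TorsorLine.base (X.Loops x.loop)) _).trans ?_
  refine Finset.sum_congr rfl fun x _ => ?_
  rw [LinearMap.comp_apply, LinearMap.adjoint_inner_right]
  refine (inner_eq_sum_locVec (g := p.elt) (fun y => TorsorLine.base (Y.Loops y.loop)) _ _).trans ?_
  refine Finset.sum_congr rfl fun y _ => ?_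
  exact congrArg₂ (fun a b => conj a * b) (matEl_hat ξ x y _ _) (matEl_hat ζ x y _ _)

end Rearrangement

/-! ### The geometric character functor -/

section CharacterFunctor

open EqGerbe Kernel

variable {G : Type v} [Group G] {X Y Z : MGerbe.{u} G}

/-- The geometric character of a kernel. -/
def chMap (E : Kernel X.toEqGerbe Y.toEqGerbe) : chObj X ⟶ chObj Y := hat (twChar E)

theorem isGeometricChar_iff_eq_chMap (E : Kernel X.toEqGerbe Y.toEqGerbe)
    (f : chObj X ⟶ chObj Y) : IsGeometricChar E f ↔ f = chMap E := by
  rw [isGeometricChar_iff, ← isRearrangement_iff, isRearrangement_iff_eq_hat, chMap]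

theorem chMap_congr {E E' : Kernel X.toEqGerbe Y.toEqGerbe} (e : E ≅ E') :
    chMap E = chMap E' := by rw [chMap, twChar_congr e, chMap]

theorem matEl_chMap {g : G} (E : Kernel X.toEqGerbe Y.toEqGerbe) (x : Fix X.pt g)
    (y : Fix Y.pt g) (u : X.Loops x.loop) (v : Y.Loops y.loop) :
    matEl (chMap E) x y u v =
      conj (LinearMap.trace ℂ _ (E.act v.1 u.1 (v.2.trans u.2.symm))) := by
  rw [chMap, matEl_hat, loopCoord_twChar]
  rfl

/-- The arrow `u ⊗ ū` fixes the generator of the one-dimensional diagonal fibre. -/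
theorem trace_idK_act {x : X.pt} (u : x ⟶ x) :
    LinearMap.trace ℂ _ ((idK X).act u u rfl) = 1 := by
  have h1 : (idK X).act u u rfl = LinearMap.id := idK_ext fun _ => idK_act_idOne u
  let _ : Unique (ULift.{u} (PLift (x = x))) := ⟨⟨⟨⟨rfl⟩⟩⟩, fun _ => Subsingleton.elim _ _⟩
  have h2 : Module.finrank ℂ ((idK X).fib x x) = 1 :=
    (Module.finrank_fintype_fun_eq_card ℂ (η := ULift.{u} (PLift (x = x)))).trans
      Fintype.card_unique
  rw [h1, LinearMap.trace_id, h2, Nat.cast_one]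

/-- The trace of `zu ⊗ ū` on the identity kernel is `z`, and the fibre vanishes off the diagonal.
After conjugation these are the inner products of the localized vectors. -/
theorem chMap_idK : chMap (idK X) = 𝟙 (chObj X) := by
  refine chHom_ext fun g x y u v => ?_
  rw [matEl_chMap]
  by_cases h : x = y
  · subst h
    obtain ⟨z, rfl⟩ := exists_smul_eq u v
    have h1 := act_rot_left (idK X) u.1 u.1 rfl z (by rw [deg_rot])
    refine (congrArg (fun A => conj (LinearMap.trace ℂ _ A)) h1).trans ?_
    rw [map_smul, trace_idK_act, matEl_id_self, smul_eq_mul, mul_one, Circle.coe_inv_eq_conj]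
  · have h1 : (idK X).act v.1 u.1 (v.2.trans u.2.symm) = 0 :=
      idK_ext fun e => (h (Subtype.ext e.symm)).elim
    rw [h1, matEl_id_ne h, map_zero, map_zero]

theorem sum_fix {S : Type u} [MulAction G S] [Fintype S] (g : G) [Fintype (Fix S g)]
    {A : Type*} [AddCommMonoid A] (f : S → A) (h : ∀ x, g • x ≠ x → f x = 0) :
    ∑ x, f x = ∑ x : Fix S g, f x.1 := by
  refine (Fintype.sum_of_injective Subtype.val Subtype.val_injective _ _ ?_ fun _ => rfl).symm
  intro x hx
  exact h x fun e => hx ⟨⟨x, e⟩, rfl⟩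

/-- The arrow sends the summand of `y` to that of `g • y`, so only fixed points contribute; there it
acts by `F(w ⊗ v̄) ⊗ E(v ⊗ ū)`, whose trace is a product. -/
theorem trace_comp_act {g : G} [Fintype (Fix Y.pt g)] (E : Kernel X.toEqGerbe Y.toEqGerbe)
    (F : Kernel Y.toEqGerbe Z.toEqGerbe) {x : Fix X.pt g} {z : Fix Z.pt g}
    (u : X.Loops x.loop) (w : Z.Loops z.loop) (v : ∀ y : Fix Y.pt g, Y.Loops y.loop) :
    LinearMap.trace ℂ _ ((comp E F).act w.1 u.1 (w.2.trans u.2.symm)) =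
      ∑ y, LinearMap.trace ℂ _ (F.act w.1 (v y).1 (w.2.trans (v y).2.symm)) *
        LinearMap.trace ℂ _ (E.act (v y).1 u.1 ((v y).2.trans u.2.symm)) := by
  have := Fintype.ofFinite Y.pt
  refine (WSum.trace_eq_sum (wt := fun y : Y.pt => (Y.k y)⁻¹)
    (V := fun y => F.fib z.1 y ⊗[ℂ] E.fib y x.1)
    (compAct E F w.1 u.1 (w.2.trans u.2.symm))).trans ?_
  rw [sum_fix g]
  · refine Finset.sum_congr rfl fun y _ => ?_
    rw [← LinearMap.trace_tensorProduct']
    congr 1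
    refine TensorProduct.ext' fun a b => ?_
    have h := compAct_ten E F w.1 u.1 (w.2.trans u.2.symm) (v y).1
      (w.2.trans (v y).2.symm) ((v y).2.trans u.2.symm) a b
    refine (congrArg (WSum.proj y.1) h).trans ?_
    rw [ten, WSum.proj_single_same, TensorProduct.map_tmul]
  -- If `g` moves `y`, the action lands in another summand and the diagonal block is zero.
  · intro y hy
    rw [← map_zero (LinearMap.trace ℂ (F.fib z.1 y ⊗[ℂ] E.fib y x.1))]
    congr 1
    refine TensorProduct.ext' fun a b => ?_
    have h := compAct_ten E F w.1 u.1 (w.2.trans u.2.symm) (Bundle.arr g y)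
      (w.2.trans (Bundle.deg_arr g y).symm) ((Bundle.deg_arr g y).trans u.2.symm) a b
    refine (congrArg (WSum.proj y) h).trans ?_
    rw [ten, WSum.proj_single_ne hy, LinearMap.zero_apply]

/-- The sum over fixed points in `trace_comp_act`, once conjugated, is the matrix product of
`matEl_comp`. -/
theorem chMap_comp (E : Kernel X.toEqGerbe Y.toEqGerbe) (F : Kernel Y.toEqGerbe Z.toEqGerbe) :
    chMap (comp E F) = chMap E ≫ chMap F := by
  refine chHom_ext fun g x z u w => ?_
  have := Fintype.ofFinite (Fix Y.pt g)
  rw [matEl_comp _ _ x z u w (fun y => TorsorLine.base (Y.Loops y.loop)), matEl_chMap,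
    trace_comp_act E F u w (fun y => TorsorLine.base (Y.Loops y.loop)), map_sum]
  refine Finset.sum_congr rfl fun y _ => ?_
  rw [matEl_chMap, matEl_chMap, map_mul]

/-- The geometric character as a functor on the Grothendieck category. -/
def chFunctor (G : Type v) [Group G] : GrothCat.{u} G ⥤ HilbG.{u} G where
  obj X := chObj X.of
  map := isoLift chMap chMap_congr
  map_id _ := chMap_idK
  map_comp := by
    rintro _ _ _ ⟨E⟩ ⟨F⟩
    exact chMap_comp E F

/-! ### The complex linear extension -/

section Complexified

variable [Finite G]

/-- The linear extension of the geometric character. -/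
def chLin (X Y : MGerbe.{u} G) :
    K0C (Kernel X.toEqGerbe Y.toEqGerbe) ≃ₗ[ℂ] (chObj X ⟶ chObj Y) :=
  (chiEquiv (Y.ker X.toEqGerbe)).trans (hatEquiv X Y)

theorem chLin_apply (a : K0C (Kernel X.toEqGerbe Y.toEqGerbe)) :
    chLin X Y a = hat (chiEquiv (Y.ker X.toEqGerbe) a) := rfl

theorem chiEquiv_mk {X : EqGerbe.{u} G} [Finite X.pt] (E : Bundle X) :
    chiEquiv X (K0C.mk E) = twChar E := chiC_mk E

@[simp] theorem chLin_mk (E : Kernel X.toEqGerbe Y.toEqGerbe) :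
    chLin X Y (K0C.mk E) = chMap E := by
  rw [chLin_apply, chiEquiv_mk, chMap]

theorem K0C.induction {C : Type*} [Category* C] [Preadditive C] {P : K0C C → Prop} (zero : P 0)
    (mk : ∀ E, P (K0C.mk E)) (smul : ∀ (c : ℂ) a, P a → P (c • a))
    (add : ∀ a b, P a → P b → P (a + b)) (a : K0C C) : P a := by
  induction a using TensorProduct.induction_on with
  | zero => exact zero
  | add a b ha hb => exact add a b ha hb
  | tmul c a =>
    suffices h : ∀ a : K0 C, P ((1 : ℂ) ⊗ₜ[ℤ] a) by
      have h' := smul c _ (h a)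
      rwa [TensorProduct.smul_tmul', smul_eq_mul, mul_one] at h'
    intro a
    induction a using K0.induction with
    | zero => rw [TensorProduct.tmul_zero]; exact zero
    | mk E => exact mk E
    | neg a h =>
      -- Closure under negation is the case of the scalar `-1`.
      have h' := smul (-1) _ h
      rwa [neg_one_smul, ← TensorProduct.tmul_neg] at h'
    | add a b ha hb => rw [TensorProduct.tmul_add]; exact add _ _ ha hb

/-- Both sides are complex bilinear, so the identity reduces to classes of kernels, where it is
`chMap_comp`. -/
theorem chLin_comp (a : K0C (Kernel X.toEqGerbe Y.toEqGerbe))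
    (b : K0C (Kernel Y.toEqGerbe Z.toEqGerbe)) :
    chLin X Z (extC compK a b) = chLin X Y a ≫ chLin Y Z b := by
  induction a using K0C.induction with
  | zero => rw [map_zero, LinearMap.zero_apply, map_zero, map_zero, Limits.zero_comp]
  | add a a' h h' => rw [extC_add_left, map_add, map_add, Preadditive.add_comp, h, h']
  | smul c a h => rw [extC_smul_left, map_smul, map_smul, Linear.smul_comp, h]
  | mk E =>
    induction b using K0C.induction with
    | zero => rw [map_zero, map_zero, map_zero, Limits.comp_zero]
    | add a a' h h' => rw [extC_add_right, map_add, map_add, Preadditive.comp_add, h, h']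
    | smul c a h => rw [extC_smul_right, map_smul, map_smul, Linear.comp_smul, h]
    | mk F =>
      have h : extC compK (K0C.mk E) (K0C.mk F) = K0C.mk (comp E F) := by
        rw [K0C.mk, K0C.mk, extC_tmul, compK_mk, one_mul, K0C.mk]
      rw [h, chLin_mk, chLin_mk, chLin_mk, chMap_comp]

theorem homInner_chLin (a b : K0C (Kernel X.toEqGerbe Y.toEqGerbe)) :
    UnitaryRep.homInner (chLin X Y a) (chLin X Y b) = K0C.form a b := by
  rw [chLin_apply, chLin_apply, homInner_hat]
  exact flatInner_chiC a b

/-- The complexified geometric character functor. -/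
def chFunctorC (G : Type v) [Group G] [Finite G] : GrothCatC.{u} G ⥤ HilbG.{u} G where
  obj X := chObj X.of
  map {X Y} a := chLin X.of Y.of a
  map_id X := (chLin_mk (idK X.of)).trans chMap_idK
  map_comp a b := chLin_comp a b

instance : (chFunctorC.{u} G).Full where
  map_surjective {X Y} f := (chLin X.of Y.of).surjective f

instance : (chFunctorC.{u} G).Faithful where
  map_injective {X Y} _ _ h := (chLin X.of Y.of).injective h

/-- The theorem asks for functors only up to equality of objects. The functors constructed here have
the values `chObj X` by definition, so the transports in its conclusion are identities. -/
theorem eq_eqToHom_comp {C : Type*} [Category* C] {A B : C} (f : A ⟶ B) (h : A = A)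
    (h' : B = B) : f = eqToHom h ≫ f ≫ eqToHom h'.symm := by
  rw [eqToHom_refl, eqToHom_refl, Category.id_comp, Category.comp_id]

end Complexified

end CharacterFunctor

end GerbeChar

end

/-! ### The main theorem -/

theorem mainTheorem5 {G : Type v} [Group G] [Finite G] :
    ∃ ch : ∀ {X Y : MGerbe.{u} G}, Kernel X.toEqGerbe Y.toEqGerbe → (chObj X ⟶ chObj Y),
      -- the formula for the matrix elements of `ch E` defines a morphism of equivariant bundles
      (∀ {X Y : MGerbe.{u} G} (E : Kernel X.toEqGerbe Y.toEqGerbe) (f : chObj X ⟶ chObj Y),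
        IsGeometricChar E f ↔ f = ch E) ∧
      -- `ch` is functorial with respect to composition of kernels
      (∀ X : MGerbe.{u} G, ch (Kernel.idK X) = 𝟙 (chObj X)) ∧
      (∀ {X Y Z : MGerbe.{u} G} (E : Kernel X.toEqGerbe Y.toEqGerbe)
        (F : Kernel Y.toEqGerbe Z.toEqGerbe), ch (Kernel.comp E F) = ch E ≫ ch F) ∧
      -- `ch` depends only on isomorphism classes
      (∀ {X Y : MGerbe.{u} G} (E E' : Kernel X.toEqGerbe Y.toEqGerbe),
        Nonempty (E ≅ E') → ch E = ch E') ∧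
      -- `ch` descends to a functor on the Grothendieck category
      (∃ (F : GrothCat.{u} G ⥤ HilbG.{u} G) (hF : ∀ X : MGerbe.{u} G, F.obj ⟨X⟩ = chObj X),
        ∀ {X Y : MGerbe.{u} G} (E : Kernel X.toEqGerbe Y.toEqGerbe),
          F.map (GrothCat.cls E) = eqToHom (hF X) ≫ ch E ≫ eqToHom (hF Y).symm) ∧
      -- its complexification is a unitarily fully faithful functor
      (∃ (F : GrothCatC.{u} G ⥤ HilbG.{u} G) (hF : ∀ X : MGerbe.{u} G, F.obj ⟨X⟩ = chObj X),
        (∀ {X Y : MGerbe.{u} G} (E : Kernel X.toEqGerbe Y.toEqGerbe),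
          F.map (GrothCatC.cls E) = eqToHom (hF X) ≫ ch E ≫ eqToHom (hF Y).symm) ∧
        (∀ {X Y : GrothCatC.{u} G} (a b : X ⟶ Y), F.map (a + b) = F.map a + F.map b) ∧
        (∀ {X Y : GrothCatC.{u} G} (c : ℂ) (a : X ⟶ Y), F.map (c • a) = c • F.map a) ∧
        F.Full ∧ F.Faithful ∧
        (∀ {X Y : GrothCatC.{u} G} (a b : X ⟶ Y),
          UnitaryRep.homInner (F.map a) (F.map b) = K0C.form a b) ∧
        -- on morphisms it is the rearrangement of the twisted character isomorphism
        ∀ X Y : MGerbe.{u} G,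
          ∃ (χ : K0C (Kernel X.toEqGerbe Y.toEqGerbe) ≃ₗ[ℂ]
              (Y.ker X.toEqGerbe).transgression.Flat)
            (hat : (Y.ker X.toEqGerbe).transgression.Flat ≃ₗ[ℂ] (chObj X ⟶ chObj Y)),
            (∀ E, EqGerbe.IsTwistedChar E (χ (K0C.mk E))) ∧
            (∀ a b, UnitaryRep.flatInner _ (χ a) (χ b) = K0C.form a b) ∧
            (∀ ξ f, IsRearrangement ξ f ↔ f = hat ξ) ∧
            (∀ ξ ζ, UnitaryRep.homInner (hat ξ) (hat ζ) = UnitaryRep.flatInner _ ξ ζ) ∧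
            ∀ a : (⟨X⟩ : GrothCatC.{u} G) ⟶ ⟨Y⟩,
              F.map a = eqToHom (hF X) ≫ hat (χ a) ≫ eqToHom (hF Y).symm) := by
  refine ⟨chMap, isGeometricChar_iff_eq_chMap, fun X => chMap_idK, chMap_comp,
    fun E E' ⟨e⟩ => chMap_congr e, ⟨chFunctor G, fun X => rfl, fun E => ?_⟩,
    chFunctorC G, fun X => rfl, fun E => ?_, fun {X Y} a b => (chLin X.of Y.of).map_add a b,
    fun {X Y} c a => (chLin X.of Y.of).map_smul c a, inferInstance, inferInstance,
    fun a b => homInner_chLin a b, fun X Y => ⟨EqGerbe.chiEquiv (Y.ker X.toEqGerbe),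
      hatEquiv X Y, fun E => ?_, EqGerbe.flatInner_chiC, isRearrangement_iff_eq_hat,
      homInner_hat, fun a => ?_⟩⟩
  · exact eq_eqToHom_comp (chMap E) rfl rfl
  · exact (chLin_mk E).trans (eq_eqToHom_comp (chMap E) rfl rfl)
  · rw [chiEquiv_mk]
    exact EqGerbe.isTwistedChar_twChar E
  · exact eq_eqToHom_comp (chLin X Y a) rfl rfl
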